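/- Let $n\ge 1$ and $0\le k\le n-1$ be integers, let $m\in\mathbf R$ and $0\le\varrho\le 1$, and write $\langle\xi\rangle=(1+|\xi|^2)^{1/2}$. Let $a:\mathbf R^n\times\mathbf R^n\to\mathbf C$ be an amplitude in $L^\infty S^m_\varrho$: $a(x,\xi)$ is measurable in $x$, smooth in $\xi$, and $\sup_{\xi\in\mathbf R^n}\langle\xi\rangle^{-m+\varrho|\alpha|}\|\partial_\xi^\alpha a(\cdot,\xi)\|_{L^\infty(\mathbf R^n)}<\infty$ for all multi-indices $\alpha$. Let $\phi(x,\xi)$ be a real-valued phase in $L^\infty\Phi^2$: $\phi$ is measurable in $x$, smooth and positively homogeneous of degree $1$ in $\xi\in\mathbf R^n\setminus 0$, and $\sup_{\xi\ne 0}|\xi|^{-1+|\alpha|}\|\partial_\xi^\alpha\phi(\cdot,\xi)\|_{L^\infty(\mathbf R^n)}<\infty$ for all multi-indices $|\alpha|\ge 2$. Let $E=\pi_1(\operatorname{supp}a)$ be the projection of the (closed) support of $a$ to the $x$-variables. Suppose that $\phi$ satisfies the rough corank-$k$ condition: there are linear subspaces $V_{x,\xi}\in\mathrm{Gr}(n,n-k)$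 of $\mathbf R^n$, depending continuously on $(x,\xi)\in\overline E\times\mathbf S^{n-1}$, and constants $c_1,c_2>0$ such that, with $\pi_{V_{x,\xi}}$ the orthogonal projection onto $V_{x,\xi}$, $$|\partial_\xi\phi(x,\xi)-\partial_\xi\phi(y,\xi)|+c_1|x-y|^2\ \ge\ c_2\,|\pi_{V_{x,\xi}}(x-y)|\qquad\text{for all }x,y\in E,\ \xi\in\mathbf S^{n-1}.$$ Consider the Fourier integral operator $$Tu(x)=(2\pi)^{-n}\int_{\mathbf R^n}e^{i\phi(x,\xi)}a(x,\xi)\,\widehat u(\xi)\,d\xi,\qquad \widehat u(\xi)=\int_{\mathbf R^n} e^{-i\langle y,\xi\rangle}u(y)\,dy,\quad u\in C_c^\infty(\mathbf R^n).$$ If $$m<-\frac{n+k-1}{4}+\frac{(n-k)(\varrho-1)}{2},$$ then $T$ extends to a bounded linear operator from $L^2_{\rm comp}(\mathbf R^n)$ to $L^2_{\rm loc}(\mathbf R^n)$; that is, for all compact sets $K,K'\subset\mathbf R^n$ there is a constant $C$ such that the extension satisfies $\|Tu\|_{L^2(K')}\le C\|u\|_{L^2}$ for every $u\in L^2$ vanishing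 almost everywhere outside $K$. -/

import Mathlib

open MeasureTheory Filter
open scoped ContDiff NNReal ENNReal

noncomputable section

namespace RoughFIO

/-- The space `ℝⁿ` with its Euclidean norm. -/
abbrev Rn (n : ℕ) : Type := EuclideanSpace ℝ (Fin n)

/-- The Japanese bracket `⟨ξ⟩ = (1 + |ξ|²)^{1/2}`. -/
def bracket {n : ℕ} (ξ : Rn n) : ℝ := Real.sqrt (1 + ‖ξ‖ ^ 2)

/-- The class `L^∞ S^m_ρ` of rough amplitudes `a(x, ξ)`: measurable in `x`, smooth in `ξ`, and for
every order `j` the quantity `⟨ξ⟩^{-m + ρ j} ‖∂_ξ^j a(·, ξ)‖_{L^∞}` is bounded in `ξ`. All the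
partial derivatives `∂_ξ^α a` with `|α| = j` are collected in the `j`-th Fréchet derivative. -/
structure IsRoughAmplitude {n : ℕ} (m ρ : ℝ) (a : Rn n → Rn n → ℂ) : Prop where
  measurable : ∀ ξ : Rn n, AEMeasurable (fun x : Rn n => a x ξ) volume
  smooth : ∀ x : Rn n, ContDiff ℝ ∞ (a x)
  bound : ∀ j : ℕ, ∃ C : ℝ, ∀ ξ : Rn n, ∀ᵐ x : Rn n,
    bracket ξ ^ (-m + ρ * (j : ℝ)) * ‖iteratedFDeriv ℝ j (a x) ξ‖ ≤ C

/-- The class `L^∞ Φ^l` of rough phases `φ(x, ξ)`, `ξ ≠ 0`: measurable in `x`, smooth and positively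
homogeneous of degree one in `ξ ≠ 0`, and for every order `j ≥ l` the quantity
`|ξ|^{-1 + j} ‖∂_ξ^j φ(·, ξ)‖_{L^∞}` is bounded in `ξ ≠ 0`. The values `φ(x, 0)` play no role. -/
structure IsRoughPhase {n : ℕ} (l : ℕ) (φ : Rn n → Rn n → ℝ) : Prop where
  measurable : ∀ ξ : Rn n, ξ ≠ 0 → AEMeasurable (fun x : Rn n => φ x ξ) volume
  smooth : ∀ x : Rn n, ContDiffOn ℝ ∞ (φ x) {0}ᶜ
  homogeneous : ∀ x ξ : Rn n, ξ ≠ 0 → ∀ t : ℝ, 0 < t → φ x (t • ξ) = t * φ x ξ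
  bound : ∀ j : ℕ, l ≤ j → ∃ C : ℝ, ∀ ξ : Rn n, ξ ≠ 0 → ∀ᵐ x : Rn n,
    ‖ξ‖ ^ (-1 + (j : ℝ)) * ‖iteratedFDeriv ℝ j (φ x) ξ‖ ≤ C

/-- `π₁(supp a)`: the projection to the spatial variables of the (closed) support of `a`. -/
def spatialSupport {n : ℕ} (a : Rn n → Rn n → ℂ) : Set (Rn n) :=
  Prod.fst '' tsupport (Function.uncurry a)

/-- The rough corank-`k` condition on `φ` relative to `a`: there are `(n-k)`-dimensional subspaces
`V x ξ`, and constants `c₁, c₂ > 0`, with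
`|∂_ξ φ(x, ξ) - ∂_ξ φ(y, ξ)| + c₁ |x - y|² ≥ c₂ |π_{V x ξ} (x - y)|`
for `x, y ∈ π₁(supp a)` and `ξ` in the unit sphere. Continuity of `V` in the Grassmannian is
continuity of the orthogonal projections in operator norm; it is required up to the closure of
`π₁(supp a)`. -/
def RoughCorank {n : ℕ} (k : ℕ) (a : Rn n → Rn n → ℂ) (φ : Rn n → Rn n → ℝ) : Prop :=
  ∃ V : Rn n → Rn n → Submodule ℝ (Rn n),
    (∀ x ∈ closure (spatialSupport a), ∀ ξ ∈ Metric.sphere (0 : Rn n) 1,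
      Module.finrank ℝ (V x ξ) + k = n) ∧
    ContinuousOn (fun p : Rn n × Rn n => (V p.1 p.2).starProjection)
      (closure (spatialSupport a) ×ˢ Metric.sphere (0 : Rn n) 1) ∧
    ∃ c₁ c₂ : ℝ, 0 < c₁ ∧ 0 < c₂ ∧
      ∀ x ∈ spatialSupport a, ∀ y ∈ spatialSupport a, ∀ ξ ∈ Metric.sphere (0 : Rn n) 1,
        c₂ * ‖(V x ξ).starProjection (x - y)‖
          ≤ ‖gradient (φ x) ξ - gradient (φ y) ξ‖ + c₁ * ‖x - y‖ ^ 2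

/-- The Fourier transform `û(ξ) = ∫ e^{-i⟨y, ξ⟩} u(y) dy`. -/
def fourierHat {n : ℕ} (u : Rn n → ℂ) (ξ : Rn n) : ℂ :=
  ∫ y : Rn n, Complex.exp (-(Complex.I * ((inner ℝ y ξ : ℝ) : ℂ))) * u y

/-- The Fourier integral operator
`T u(x) = (2π)^{-n} ∫ e^{i φ(x, ξ)} a(x, ξ) û(ξ) dξ` with amplitude `a` and phase `φ`. -/
def fio {n : ℕ} (a : Rn n → Rn n → ℂ) (φ : Rn n → Rn n → ℝ) (u : Rn n → ℂ) (x : Rn n) : ℂ :=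
  (((2 * Real.pi) ^ n)⁻¹ : ℝ) *
    ∫ ξ : Rn n, Complex.exp (Complex.I * (φ x ξ : ℂ)) * a x ξ * fourierHat u ξ

/-- `L²_comp(ℝⁿ)`: square integrable functions vanishing outside a compact set (modulo a.e.
equality). -/
def L2comp (n : ℕ) : Submodule ℂ (Rn n →ₘ[volume] ℂ) where
  carrier := {f | MemLp f 2 volume ∧ ∃ K : Set (Rn n), IsCompact K ∧ ∀ᵐ x, x ∉ K → f x = 0}
  zero_mem' := by
    refine ⟨(MemLp.zero' (p := 2) (μ := volume)).ae_eq
      (AEEqFun.coeFn_zero (β := ℂ)).symm, ∅, isCompact_empty, ?_⟩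
    filter_upwards [AEEqFun.coeFn_zero (μ := (volume : Measure (Rn n))) (β := ℂ)] with x hx _
    simp [hx]
  add_mem' := by
    rintro f g ⟨hf, K, hK, hfK⟩ ⟨hg, L, hL, hgL⟩
    refine ⟨(hf.add hg).ae_eq (AEEqFun.coeFn_add f g).symm, K ∪ L, hK.union hL, ?_⟩
    filter_upwards [AEEqFun.coeFn_add f g, hfK, hgL] with x hx h1 h2 hxKL
    rw [Set.mem_union, not_or] at hxKL
    simp [hx, h1 hxKL.1, h2 hxKL.2]
  smul_mem' := by
    rintro c f ⟨hf, K, hK, hfK⟩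
    refine ⟨(hf.const_smul c).ae_eq (AEEqFun.coeFn_smul c f).symm, K, hK, ?_⟩
    filter_upwards [AEEqFun.coeFn_smul c f, hfK] with x hx h1 hxK
    simp [hx, h1 hxK]

/-- `L²_loc(ℝⁿ)`: measurable functions, square integrable on every compact set (modulo a.e.
equality). -/
def L2loc (n : ℕ) : Submodule ℂ (Rn n →ₘ[volume] ℂ) where
  carrier := {f | ∀ K : Set (Rn n), IsCompact K → MemLp f 2 (volume.restrict K)}
  zero_mem' := fun K _ => (MemLp.zero' (p := 2) (μ := volume.restrict K)).ae_eq
    (ae_restrict_of_ae (AEEqFun.coeFn_zero (β := ℂ)).symm)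
  add_mem' := fun {f g} hf hg K hK => ((hf K hK).add (hg K hK)).ae_eq
    (ae_restrict_of_ae (AEEqFun.coeFn_add f g).symm)
  smul_mem' := fun c f hf K hK => ((hf K hK).const_smul c).ae_eq
    (ae_restrict_of_ae (AEEqFun.coeFn_smul c f).symm)

/-- Boundedness (continuity) of a linear operator from `L²_comp`, the inductive limit of the spaces
`L²_K`, to the Fréchet space `L²_loc`: for all compact `K, K'` there is a constant `C` with
`‖S u‖_{L²(K')} ≤ C ‖u‖_{L²}` for all `u` supported in `K`. -/
def IsBoundedCompLoc {n : ℕ} (S : L2comp n →ₗ[ℂ] L2loc n) : Prop :=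
  ∀ K K' : Set (Rn n), IsCompact K → IsCompact K' → ∃ C : ℝ≥0, ∀ u : L2comp n,
    (∀ᵐ x, x ∉ K → (u : Rn n →ₘ[volume] ℂ) x = 0) →
      eLpNorm (S u : Rn n →ₘ[volume] ℂ) 2 (volume.restrict K')
        ≤ (C : ℝ≥0∞) * eLpNorm (u : Rn n →ₘ[volume] ℂ) 2 volume

/-- `S` extends the operator `T`, which is given on smooth compactly supported functions. -/
def ExtendsOnTest {n : ℕ} (S : L2comp n →ₗ[ℂ] L2loc n) (T : (Rn n → ℂ) → Rn n → ℂ) : Prop :=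
  ∀ u : Rn n → ℂ, ContDiff ℝ ∞ u → HasCompactSupport u →
    ∀ f : L2comp n, (f : Rn n →ₘ[volume] ℂ) =ᵐ[volume] u →
      (S f : Rn n →ₘ[volume] ℂ) =ᵐ[volume] T u

end RoughFIO

end

/-! A Littlewood-Paley decomposition reduces the theorem to gaining a negative power of λ for the
piece of `T` at frequencies |ξ| ~ λ; by Plancherel the piece may be regarded as an operator acting
on v = û. Nothing is smooth in x, so decay can come only from integrating in ξ, and a `T T*`
argument is used. After ξ = λη the kernel of `T T*` at (x, y) is λ^(n+2m) ∫ e^{iλF(η)} b(η) dη,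
where F = φ(x,·) − φ(y,·) is homogeneous of degree one and b lives on an annulus, each derivative of
b costing Λ = λ^(1−ρ). By compactness the subspaces of the corank condition can be frozen, locally
in x and in the direction of ξ, to one subspace V₀ of dimension d = n − k. For nearby x, y with x −
y ∈ V₀ the condition becomes |∇F| ≥ δ = c₀|x − y|. Schur's test is therefore applied on slices x₀ +
V₀ (`exists_slice_bound`), and the slices are averaged over x₀ (`lintegral_le_of_slices`).

The higher derivatives of F are bounded but not O(|x − y|), so ordinary non-stationary phase is too
weak and two mechanisms are combined in `exists_kernel_bound`. First, on balls of radius comparable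
to h = λ^(μ−1), μ = min(ρ, 1/2), the phase λF is linear up to a remainder with bounded derivatives;
the integral is negligible once λhδ = λ^μ δ ≥ λ^ε (`exists_nonstationary_bound`). Second, F(tη) =
tF(η), so integration along rays discards everything except the set where |F| ≤ τ = λ^(ε−ρ). That
set has measure O(λ^ε τ/δ) because |∇F| ≥ δ (`exists_sublevel_bound`), whence the bound λ^(2ε−ρ)/δ
(`exists_radial_bound`). Integrating it over |x − y| ≲ λ^(ε−μ) in d dimensions gives λ^(−ρ−μ(d−1))
up to small powers. The squared norm of a piece is thus O(λ^(n+2m−ρ−μ(d−1)+σ)), and the hypothesis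
on m makes the exponent negative for small σ, since ρ − 1/2 ≤ μ (`exponent_neg`).

The pieces are then summed geometrically on each compact set (`exists_dyadicOp_bound`). Their sum is
the extension, and dominated convergence identifies it with the integral on test functions
(`sumOp_fourierHat_eq`). A preliminary reduction replaces the almost everywhere hypotheses, whose
null sets depend on ξ, by bounds on a single conull set (`exists_isGoodSet`). -/

open MeasureTheory Filter
open scoped ContDiff NNReal ENNReal

noncomputable section

namespace RoughFIO

/-! ### Derivative bounds for products, affine substitutions and exponentials. -/

section Calculus

variable {E G : Type*} [NormedAddCommGroup E] [NormedSpace ℝ E]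
  [NormedAddCommGroup G] [NormedSpace ℝ G]

/-- Leibniz bound for a product, at scale `Λ`. -/
theorem norm_iteratedFDeriv_mul_le_scale {f g : E → ℂ} {s : Set E} (hs : IsOpen s)
    (hf : ContDiffOn ℝ ∞ f s) (hg : ContDiffOn ℝ ∞ g s) {x : E} (hx : x ∈ s) {q : ℕ}
    {A B Λ : ℝ} (hA : ∀ i ≤ q, ‖iteratedFDeriv ℝ i f x‖ ≤ A * Λ ^ i)
    (hB : ∀ i ≤ q, ‖iteratedFDeriv ℝ i g x‖ ≤ B * Λ ^ i) :
    ‖iteratedFDeriv ℝ q (fun y => f y * g y) x‖ ≤ 2 ^ q * (A * B) * Λ ^ q := by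
  have key := norm_iteratedFDerivWithin_mul_le (n := q) hf hg hs.uniqueDiffOn hx
    (by exact_mod_cast le_top)
  simp only [iteratedFDerivWithin_of_isOpen _ hs hx] at key
  refine key.trans ?_
  have hsum : (2 : ℝ) ^ q = ∑ i ∈ Finset.range (q + 1), (q.choose i : ℝ) := by
    exact_mod_cast (Nat.sum_range_choose q).symm
  rw [hsum, Finset.sum_mul, Finset.sum_mul]
  refine Finset.sum_le_sum fun i hi => ?_
  have hi' : i ≤ q := Nat.lt_succ_iff.mp (Finset.mem_range.mp hi)
  have hA0 : 0 ≤ A * Λ ^ i := (norm_nonneg _).trans (hA i hi')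
  calc (q.choose i : ℝ) * ‖iteratedFDeriv ℝ i f x‖ * ‖iteratedFDeriv ℝ (q - i) g x‖
      ≤ (q.choose i : ℝ) * (A * Λ ^ i) * (B * Λ ^ (q - i)) := by
        gcongr
        · exact hA i hi'
        · exact hB _ (Nat.sub_le _ _)
    _ = (q.choose i : ℝ) * (A * B) * (Λ ^ i * Λ ^ (q - i)) := by ring
    _ = _ := by rw [← pow_add, Nat.add_sub_cancel' hi']

/-- Derivatives of a composition with an affine map. -/
theorem norm_iteratedFDeriv_comp_affine_le {F : Type*} [NormedAddCommGroup F] [NormedSpace ℝ F]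
    {f : E → F} {s : Set E} (hs : IsOpen s) (hf : ContDiffOn ℝ ∞ f s) (p : E) (g : G →L[ℝ] E)
    {w : G} (hw : p + g w ∈ s) (i : ℕ) :
    ‖iteratedFDeriv ℝ i (fun w => f (p + g w)) w‖
      ≤ ‖iteratedFDeriv ℝ i f (p + g w)‖ * ‖g‖ ^ i := by
  set s' : Set E := (fun y => p + y) ⁻¹' s with hs'
  have hs'o : IsOpen s' := hs.preimage (by fun_prop)
  have hf' : ContDiffOn ℝ ∞ (fun y => f (p + y)) s' :=
    hf.comp (contDiff_const.add contDiff_id).contDiffOn fun y hy => hy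
  have ho : IsOpen (g ⁻¹' s') := hs'o.preimage g.continuous
  have hwm : g w ∈ s' := hw
  have key := g.iteratedFDerivWithin_comp_right (n := ∞) hf' hs'o.uniqueDiffOn ho.uniqueDiffOn
    (x := w) hwm (i := i) (by exact_mod_cast le_top)
  rw [iteratedFDerivWithin_of_isOpen _ ho hwm, iteratedFDerivWithin_of_isOpen _ hs'o hwm,
    iteratedFDeriv_comp_add_left] at key
  change ‖iteratedFDeriv ℝ i ((fun y => f (p + y)) ∘ g) w‖ ≤ _
  rw [key]
  refine (ContinuousMultilinearMap.norm_compContinuousLinearMap_le _ _).trans ?_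
  simp

theorem norm_iteratedFDeriv_cexp_I_mul (i : ℕ) (t : ℝ) :
    ‖iteratedFDeriv ℝ i (fun t : ℝ => Complex.exp (Complex.I * (t : ℂ))) t‖ = 1 := by
  rw [norm_iteratedFDeriv_eq_norm_iteratedDeriv]
  have : ∀ i : ℕ, iteratedDeriv i (fun t : ℝ => Complex.exp (Complex.I * (t : ℂ)))
      = fun t : ℝ => Complex.I ^ i * Complex.exp (Complex.I * (t : ℂ)) := by
    intro i
    induction i with
    | zero => simp
    | succ i ih =>
      rw [iteratedDeriv_succ, ih]
      funext t
      have h1 : HasDerivAt (fun t : ℝ => Complex.I * (t : ℂ)) Complex.I t := by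
        simpa using (Complex.ofRealCLM.hasDerivAt (x := t)).const_mul Complex.I
      have := (h1.cexp.const_mul (Complex.I ^ i)).deriv
      rw [this, pow_succ]
      ring
  rw [this]
  simp [Complex.norm_exp]

/-- Derivatives of `e^{iR}` for a real function `R` with bounded derivatives. -/
theorem norm_iteratedFDeriv_cexp_le {R : E → ℝ} {s : Set E} (hs : IsOpen s)
    (hR : ContDiffOn ℝ ∞ R s) {x : E} (hx : x ∈ s) {q : ℕ} {D : ℝ} (hD : 1 ≤ D)
    (hb : ∀ i, 1 ≤ i → i ≤ q → ‖iteratedFDeriv ℝ i R x‖ ≤ D) :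
    ‖iteratedFDeriv ℝ q (fun y => Complex.exp (Complex.I * (R y : ℂ))) x‖
      ≤ q.factorial * D ^ q := by
  have hg : ContDiff ℝ ∞ (fun t : ℝ => Complex.exp (Complex.I * (t : ℂ))) := by
    have h0 : ContDiff ℝ ∞ (fun t : ℝ => (t : ℂ)) := Complex.ofRealCLM.contDiff
    exact (contDiff_const.mul h0).cexp
  have key := norm_iteratedFDerivWithin_comp_le (n := q) (x := x) (C := 1) (D := D)
    (t := Set.univ) hg.contDiffOn hR (by exact_mod_cast le_top) uniqueDiffOn_univ hs.uniqueDiffOn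
    (Set.mapsTo_univ _ _) hx
    (fun i _ => by
      rw [iteratedFDerivWithin_univ]; exact (norm_iteratedFDeriv_cexp_I_mul i _).le)
    -- The Faà di Bruno estimate expects `D ^ i`; since `1 ≤ D`, the uniform bound `D` is enough.
    (fun i h1 h2 => by
      rw [iteratedFDerivWithin_of_isOpen _ hs hx]
      exact (hb i h1 h2).trans (le_self_pow₀ hD (by omega)))
  rw [iteratedFDerivWithin_of_isOpen _ hs hx, mul_one] at key
  exact key

/-- The product of a function which is smooth near the support of a smooth one is smooth. -/
theorem contDiff_mul_of_tsupport_subset {u g : E → ℂ} {s : Set E} (hs : IsOpen s)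
    (hu : ContDiffOn ℝ ∞ u s) (hg : ContDiff ℝ ∞ g) (hgs : tsupport g ⊆ s) :
    ContDiff ℝ ∞ (fun x => u x * g x) := by
  rw [contDiff_iff_contDiffAt]
  intro x
  by_cases hx : x ∈ tsupport g
  · exact (hu.contDiffAt (hs.mem_nhds (hgs hx))).mul hg.contDiffAt
  · refine (contDiffAt_const (c := (0 : ℂ))).congr_of_eventuallyEq ?_
    filter_upwards [(isClosed_tsupport g).isOpen_compl.mem_nhds hx] with y hy
    rw [image_eq_zero_of_notMem_tsupport hy, mul_zero]

theorem iteratedFDeriv_eq_zero_of_notMem_tsupport {F : Type*} [NormedAddCommGroup F]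
    [NormedSpace ℝ F] {g : E → F} {x : E}
    (hx : x ∉ tsupport g) (q : ℕ) : iteratedFDeriv ℝ q g x = 0 := by
  by_contra h
  exact hx (tsupport_iteratedFDeriv_subset (𝕜 := ℝ) (n := q) (subset_tsupport _ h))

end Calculus

/-! ### Decay of Fourier integrals of smooth compactly supported functions. -/

section Decay

variable {V : Type*} [NormedAddCommGroup V] [InnerProductSpace ℝ V] [FiniteDimensional ℝ V]
  [MeasurableSpace V] [BorelSpace V]

/-- Decay of the Fourier integral of a smooth compactly supported function. -/
theorem norm_oscillatory_integral_le {c : V → ℂ} (hc : ContDiff ℝ ∞ c) {R : ℝ}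
    (hsupp : ∀ w, c w ≠ 0 → ‖w‖ ≤ R) (N : ℕ) {A Λ : ℝ} (hA0 : 0 ≤ A) (hΛ : 1 ≤ Λ)
    (hA : ∀ q ≤ N, ∀ w, ‖iteratedFDeriv ℝ q c w‖ ≤ A * Λ ^ q) (L : V) :
    ‖L‖ ^ N * ‖∫ w, Complex.exp (Complex.I * ((inner ℝ w L : ℝ) : ℂ)) * c w‖
      ≤ (4 * Real.pi) ^ N * (N + 1) * (volume (Metric.closedBall (0 : V) R)).toReal * A * Λ ^ N := by
  have htsupp : tsupport c ⊆ Metric.closedBall 0 R :=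
    closure_minimal (fun w hw => by simpa using hsupp w hw) Metric.isClosed_closedBall
  have hcs : HasCompactSupport c :=
    HasCompactSupport.of_support_subset_isCompact (isCompact_closedBall 0 R)
      ((subset_tsupport c).trans htsupp)
  have hint : ∀ q : ℕ, Integrable (fun v => ‖iteratedFDeriv ℝ q c v‖) :=
    fun q => ((hc.continuous_iteratedFDeriv (m := q) (by exact_mod_cast le_top)).norm).integrable_of_hasCompactSupport
      (hcs.iteratedFDeriv q).norm
  -- The normalisation turns e^{i⟨w, L⟩} into Mathlib's e^{−2πi⟨w, ξ⟩}; it produces the factor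
  -- (2π)^N below, and the derivative estimate for the transform a further 2^N.
  set ξ : V := (-(2 * Real.pi)⁻¹ : ℝ) • L with hξ
  have hF : ∫ w, Complex.exp (Complex.I * ((inner ℝ w L : ℝ) : ℂ)) * c w
      = FourierTransform.fourier c ξ := by
    rw [Real.fourier_eq']
    refine integral_congr_ae (Eventually.of_forall fun w => ?_)
    simp only [smul_eq_mul]
    congr 2
    rw [hξ, inner_smul_right, mul_comm]
    congr 2
    field_simp
  have hcomp : ∀ k q : ℕ, Integrable (fun v => ‖v‖ ^ k * ‖iteratedFDeriv ℝ q c v‖) := by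
    intro k q
    refine (Continuous.integrable_of_hasCompactSupport ?_ ?_)
    · exact (continuous_norm.pow k).mul
        (hc.continuous_iteratedFDeriv (m := q) (by exact_mod_cast le_top)).norm
    · exact ((hcs.iteratedFDeriv q).norm).mul_left
  have key := Real.pow_mul_norm_iteratedFDeriv_fourier_le (K := 0) (N := ⊤) (k := 0) (n := N)
    (f := c) hc (fun k q _ _ => hcomp k q) le_rfl le_top ξ
  simp only [norm_iteratedFDeriv_zero, pow_zero, one_mul, Nat.cast_zero, mul_zero, zero_add,
    Finset.range_one, Finset.singleton_product, Finset.sum_map, Function.Embedding.coeFn_mk] at key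
  have hball : ∀ q ≤ N, ∫ v, ‖iteratedFDeriv ℝ q c v‖
      ≤ (volume (Metric.closedBall (0 : V) R)).toReal * A * Λ ^ N := by
    intro q hq
    have h1 : ∫ v, ‖iteratedFDeriv ℝ q c v‖
        = ∫ v in Metric.closedBall (0 : V) R, ‖iteratedFDeriv ℝ q c v‖ := by
      refine (setIntegral_eq_integral_of_forall_compl_eq_zero fun v hv => ?_).symm
      rw [iteratedFDeriv_eq_zero_of_notMem_tsupport (fun h => hv (htsupp h)), norm_zero]
    rw [h1]
    calc ∫ v in Metric.closedBall (0 : V) R, ‖iteratedFDeriv ℝ q c v‖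
        ≤ ∫ v in Metric.closedBall (0 : V) R, A * Λ ^ N := by
          refine integral_mono (hint q).integrableOn (integrableOn_const measure_closedBall_lt_top.ne) fun v => ?_
          exact (hA q hq v).trans (by gcongr)
      _ = _ := by
          rw [setIntegral_const, smul_eq_mul, Measure.real, mul_assoc]
  have hsum : ∑ q ∈ Finset.range (N + 1), ∫ v, ‖iteratedFDeriv ℝ q c v‖
      ≤ (N + 1) * ((volume (Metric.closedBall (0 : V) R)).toReal * A * Λ ^ N) := by
    refine (Finset.sum_le_card_nsmul _ _ _ fun q hq =>
      hball q (Nat.lt_succ_iff.mp (Finset.mem_range.mp hq))).trans ?_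
    simp
  have hL : ‖L‖ = (2 * Real.pi) * ‖ξ‖ := by
    rw [hξ, norm_smul]
    have : (0 : ℝ) < Real.pi := Real.pi_pos
    rw [norm_neg, Real.norm_of_nonneg (by positivity)]
    field_simp
  rw [hF, hL, mul_pow, mul_assoc]
  calc (2 * Real.pi) ^ N * (‖ξ‖ ^ N * ‖FourierTransform.fourier c ξ‖)
      ≤ (2 * Real.pi) ^ N * (2 ^ N * ((N + 1) * ((volume (Metric.closedBall (0 : V) R)).toReal * A * Λ ^ N))) := by
        refine mul_le_mul_of_nonneg_left (key.trans ?_) (by have := Real.pi_pos; positivity)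
        exact mul_le_mul_of_nonneg_left hsum (by positivity)
    _ = _ := by
        have h4 : (4 * Real.pi) ^ N = (2 * Real.pi) ^ N * 2 ^ N := by
          rw [← mul_pow]; congr 1; ring
        rw [h4]
        ring

end Decay

/-! ### Non-stationary phase at the scale where the phase is linear. -/

section Oscillatory

variable {V : Type*} [NormedAddCommGroup V] [InnerProductSpace ℝ V]

/-- A phase function `F`, smooth and positively homogeneous of degree one away from the origin,
with derivatives of order at least two bounded on an annulus. -/
structure IsHomPhase (Cφ : ℕ → ℝ) (F : V → ℝ) : Prop where
  smooth : ContDiffOn ℝ ∞ F {0}ᶜ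
  homogeneous : ∀ η : V, η ≠ 0 → ∀ t : ℝ, 0 < t → F (t • η) = t * F η
  bound : ∀ j : ℕ, 2 ≤ j → ∀ η : V, 1 / 8 ≤ ‖η‖ → ‖η‖ ≤ 4 → ‖iteratedFDeriv ℝ j F η‖ ≤ Cφ j

/-- An amplitude `b` supported in an annulus, with derivatives growing at scale `Λ`. -/
structure IsAnnularAmp (Cb : ℕ → ℝ) (Λ : ℝ) (b : V → ℂ) : Prop where
  smooth : ContDiff ℝ ∞ b
  half_le : ∀ η : V, b η ≠ 0 → 1 / 2 ≤ ‖η‖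
  le_two : ∀ η : V, b η ≠ 0 → ‖η‖ ≤ 2
  bound : ∀ j : ℕ, ∀ η : V, ‖iteratedFDeriv ℝ j b η‖ ≤ Cb j * Λ ^ j

theorem IsHomPhase.neg {Cφ : ℕ → ℝ} {F : V → ℝ} (hF : IsHomPhase Cφ F) :
    IsHomPhase Cφ (fun η => -F η) where
  smooth := hF.smooth.neg
  homogeneous η hη t ht := by rw [hF.homogeneous η hη t ht]; ring
  bound j hj η h1 h2 := by
    have : (fun η => -F η) = -F := rfl
    rw [this, iteratedFDeriv_neg_apply, norm_neg]
    exact hF.bound j hj η h1 h2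

theorem IsAnnularAmp.tsupport_subset {Cb : ℕ → ℝ} {Λ : ℝ} {b : V → ℂ} (hb : IsAnnularAmp Cb Λ b) :
    tsupport b ⊆ {0}ᶜ ∩ Metric.closedBall 0 2 := by
  have h1 : tsupport b ⊆ {η : V | 1 / 2 ≤ ‖η‖} :=
    closure_minimal (fun w hw => hb.half_le w hw) (isClosed_le continuous_const continuous_norm)
  have h2 : tsupport b ⊆ Metric.closedBall 0 2 :=
    closure_minimal (fun w hw => by simpa using hb.le_two w hw) Metric.isClosed_closedBall
  refine fun w hw => ⟨fun h0 => ?_, h2 hw⟩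
  have : (1 : ℝ) / 2 ≤ ‖w‖ := h1 hw
  rw [Set.mem_singleton_iff.mp h0, norm_zero] at this
  norm_num at this

theorem contDiffOn_cexp_mul {F : V → ℝ} {s : Set V} (hF : ContDiffOn ℝ ∞ F s) (lam : ℝ) :
    ContDiffOn ℝ ∞ (fun η => Complex.exp (Complex.I * ((lam * F η : ℝ) : ℂ))) s := by
  have h0 : ContDiff ℝ ∞ (fun t : ℝ => Complex.exp (Complex.I * (t : ℂ))) := by
    have h0 : ContDiff ℝ ∞ (fun t : ℝ => (t : ℂ)) := Complex.ofRealCLM.contDiff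
    exact (contDiff_const.mul h0).cexp
  exact h0.comp_contDiffOn (contDiffOn_const.mul hF)

theorem contDiff_phase_mul_amp {Cφ Cb : ℕ → ℝ} {Λ : ℝ} {F : V → ℝ} {b : V → ℂ}
    (hF : IsHomPhase Cφ F) (hb : IsAnnularAmp Cb Λ b) (lam : ℝ) :
    ContDiff ℝ ∞ (fun η => Complex.exp (Complex.I * ((lam * F η : ℝ) : ℂ)) * b η) :=
  contDiff_mul_of_tsupport_subset isOpen_compl_singleton (contDiffOn_cexp_mul hF.smooth lam)
    hb.smooth (hb.tsupport_subset.trans Set.inter_subset_left)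

theorem norm_cexp_I_mul_ofReal (t : ℝ) : ‖Complex.exp (Complex.I * (t : ℂ))‖ = 1 := by
  rw [mul_comm]; exact Complex.norm_exp_ofReal_mul_I t

theorem iteratedFDeriv_clm_eq_zero {W : Type*} [NormedAddCommGroup W] [NormedSpace ℝ W]
    (ℓ : V →L[ℝ] W) {i : ℕ} (hi : 2 ≤ i) (x : V) : iteratedFDeriv ℝ i (fun y => ℓ y) x = 0 := by
  obtain ⟨j, rfl⟩ := Nat.exists_eq_add_of_le' hi
  rw [← norm_eq_zero, ← norm_iteratedFDeriv_fderiv, norm_eq_zero]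
  have : fderiv ℝ (fun y => ℓ y) = fun _ => ℓ := by funext y; exact ℓ.fderiv
  rw [this, iteratedFDeriv_succ_const]
  rfl

/-- Mean value inequality for the gradient. The radius 3/8 keeps the ball around `p` inside the
annulus 1/8 ≤ |η| ≤ 4 where the second derivatives are controlled. -/
theorem IsHomPhase.norm_fderiv_sub_le {Cφ : ℕ → ℝ} {F : V → ℝ} (hF : IsHomPhase Cφ F) {p y : V}
    (hp1 : 1 / 2 ≤ ‖p‖) (hp2 : ‖p‖ ≤ 2) (hy : ‖y - p‖ < 3 / 8) :
    ‖fderiv ℝ F y - fderiv ℝ F p‖ ≤ Cφ 2 * ‖y - p‖ := by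
  have hmem : ∀ x ∈ Metric.ball p (3 / 8), 1 / 8 ≤ ‖x‖ ∧ ‖x‖ ≤ 4 := by
    intro x hx
    have h1 : ‖x - p‖ < 3 / 8 := by simpa [dist_eq_norm] using hx
    have h2 := norm_sub_norm_le p x
    have h3 := norm_sub_norm_le x p
    rw [norm_sub_rev] at h2
    constructor <;> linarith
  have hne : ∀ x ∈ Metric.ball p (3 / 8), x ∈ ({0}ᶜ : Set V) := by
    intro x hx h0
    have := (hmem x hx).1
    rw [Set.mem_singleton_iff.mp h0, norm_zero] at this
    norm_num at this
  have hd : ∀ x ∈ Metric.ball p (3 / 8), DifferentiableAt ℝ (fderiv ℝ F) x := by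
    intro x hx
    have : ContDiffAt ℝ ∞ F x := hF.smooth.contDiffAt (isOpen_compl_singleton.mem_nhds (hne x hx))
    exact (this.fderiv_right (m := ∞) (by simp)).differentiableAt (by simp)
  refine (convex_ball p (3 / 8)).norm_image_sub_le_of_norm_fderiv_le (𝕜 := ℝ) hd (fun x hx => ?_)
    (Metric.mem_ball_self (by norm_num)) (by simpa [dist_eq_norm] using hy)
  rw [← norm_iteratedFDeriv_one, norm_iteratedFDeriv_fderiv]
  exact hF.bound 2 le_rfl x (hmem x hx).1 (hmem x hx).2

theorem iteratedFDeriv_ofReal_norm {ψ : V → ℝ} (hψ : ContDiff ℝ ∞ ψ) (i : ℕ) (w : V) :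
    ‖iteratedFDeriv ℝ i (fun w => (ψ w : ℂ)) w‖ = ‖iteratedFDeriv ℝ i ψ w‖ :=
  Complex.ofRealLI.norm_iteratedFDeriv_comp_left (n := ∞) hψ.contDiffAt (by exact_mod_cast le_top)

variable [FiniteDimensional ℝ V] [MeasurableSpace V] [BorelSpace V]

/-- Writing an integral as an average over translations. -/
theorem integral_eq_integral_integral_translate {f : V → ℂ} (hf : Continuous f)
    (hfi : Integrable f) {ψ : V → ℝ} (hψ : Continuous ψ) (hψi : Integrable ψ)
    (hψ1 : ∫ w, ψ w = 1) (h : ℝ) :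
    ∫ η, f η = ∫ z, ∫ w, (ψ w : ℂ) * f (z + h • w) := by
  have hswap : Integrable (Function.uncurry fun z w => (ψ w : ℂ) * f (z + h • w))
      ((volume : Measure V).prod volume) := by
    rw [integrable_prod_iff']
    · refine ⟨Eventually.of_forall fun w => ?_, ?_⟩
      · exact (hfi.comp_add_right (h • w)).const_mul (ψ w : ℂ)
      · simp only [Function.uncurry_apply_pair, norm_mul]
        have : ∀ w, ∫ z, ‖(ψ w : ℂ)‖ * ‖f (z + h • w)‖ = ‖ψ w‖ * ∫ z, ‖f z‖ := by
          intro w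
          rw [integral_const_mul, integral_add_right_eq_self (fun z => ‖f z‖)]
          simp
        simp_rw [this]
        exact hψi.norm.mul_const _
    · refine Continuous.aestronglyMeasurable ?_
      have : Continuous fun p : V × V => (ψ p.2 : ℂ) * f (p.1 + h • p.2) := by fun_prop
      exact this
  rw [integral_integral_swap hswap]
  have : ∀ w, ∫ z, (ψ w : ℂ) * f (z + h • w) = (ψ w : ℂ) * ∫ z, f z := by
    intro w
    rw [integral_const_mul, integral_add_right_eq_self]
  simp_rw [this]
  rw [integral_mul_const, integral_complex_ofReal, hψ1]
  simp

/-- A bound for finitely many constants. -/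
theorem exists_one_le_bound (C : ℕ → ℝ) (N : ℕ) : ∃ M : ℝ, 1 ≤ M ∧ ∀ j ≤ N, C j ≤ M := by
  refine ⟨1 + ∑ j ∈ Finset.range (N + 1), |C j|, ?_, fun j hj => ?_⟩
  · have : 0 ≤ ∑ j ∈ Finset.range (N + 1), |C j| := Finset.sum_nonneg fun _ _ => abs_nonneg _
    linarith
  · have := Finset.single_le_sum (f := fun j => |C j|) (fun _ _ => abs_nonneg _)
      (Finset.mem_range.mpr (Nat.lt_succ_of_le hj))
    have h2 := le_abs_self (C j)
    linarith

variable (V) in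
theorem exists_smooth_average : ∃ ψ : V → ℝ, ContDiff ℝ ∞ ψ ∧ HasCompactSupport ψ ∧
    ∫ w, ψ w = 1 ∧ (tsupport ψ ⊆ Metric.closedBall 0 (1 / 8)) ∧
    ∃ Cψ : ℕ → ℝ, ∀ j w, ‖iteratedFDeriv ℝ j ψ w‖ ≤ Cψ j := by
  let f : ContDiffBump (0 : V) := ⟨1 / 16, 1 / 8, by norm_num, by norm_num⟩
  have hc : ContDiff ℝ ∞ (f.normed volume) := f.contDiff_normed
  have hs : HasCompactSupport (f.normed volume) := f.hasCompactSupport_normed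
  refine ⟨f.normed volume, hc, hs, f.integral_normed, f.tsupport_normed_eq.subset, ?_⟩
  have : ∀ j, ∃ C, ∀ w, ‖iteratedFDeriv ℝ j (f.normed volume) w‖ ≤ C := fun j =>
    (hs.iteratedFDeriv j).exists_bound_of_continuous
      (hc.continuous_iteratedFDeriv (m := j) (by exact_mod_cast le_top))
  choose C hC using this
  exact ⟨C, hC⟩

/-- The contribution of one ball of radius `h / 8` to the oscillatory integral: there the phase is
essentially linear. -/
theorem exists_local_oscillatory_bound (Cφ Cb Cψ : ℕ → ℝ) (N : ℕ) : ∃ C : ℝ, 0 ≤ C ∧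
    ∀ ψ : V → ℝ, ContDiff ℝ ∞ ψ → tsupport ψ ⊆ Metric.closedBall 0 (1 / 8) →
    (∀ j w, ‖iteratedFDeriv ℝ j ψ w‖ ≤ Cψ j) →
    ∀ lam Λ h δ : ℝ, 0 ≤ lam → 0 ≤ Λ → 0 < h → h ≤ 1 → lam * h ^ 2 ≤ 1 → h * Λ ≤ 1 → 0 ≤ δ →
    ∀ F : V → ℝ, IsHomPhase Cφ F → ∀ b : V → ℂ, IsAnnularAmp Cb Λ b →
    (∀ η, b η ≠ 0 → δ ≤ ‖fderiv ℝ F η‖) → ∀ z : V,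
    (lam * h * δ) ^ N * ‖∫ w, (ψ w : ℂ) *
      (Complex.exp (Complex.I * ((lam * F (z + h • w) : ℝ) : ℂ)) * b (z + h • w))‖ ≤ C := by
  obtain ⟨M, hM1, hM⟩ := exists_one_le_bound Cφ (N + 2)
  obtain ⟨B, hB1, hB⟩ := exists_one_le_bound Cb N
  obtain ⟨P, hP1, hP⟩ := exists_one_le_bound Cψ N
  set A : ℝ := 2 ^ N * ((N.factorial * M ^ N) * (2 ^ N * (P * B))) with hA
  refine ⟨(4 * Real.pi) ^ N * (N + 1) * (volume (Metric.closedBall (0 : V) (1 / 8))).toReal * A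
    * 1 ^ N, by have := Real.pi_pos; positivity, ?_⟩
  intro ψ hψ hψs hψb lam Λ h δ hlam hΛ hh0 hh1 hlh hhΛ hδ F hF b hb hgrad z
  -- Either the integrand vanishes identically, or the ball contains a point where `b ≠ 0`; the
  -- phase is linearised there because the gradient bound is available only at such points.
  by_cases hex : ∃ w0 : V, ‖w0‖ ≤ 1 / 8 ∧ b (z + h • w0) ≠ 0
  swap
  · have hz : ∀ w, (ψ w : ℂ) *
        (Complex.exp (Complex.I * ((lam * F (z + h • w) : ℝ) : ℂ)) * b (z + h • w)) = 0 := by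
      intro w
      by_cases hw : w ∈ tsupport ψ
      · have hw' : ‖w‖ ≤ 1 / 8 := by simpa using hψs hw
        have : b (z + h • w) = 0 := by
          by_contra hne
          exact hex ⟨w, hw', hne⟩
        rw [this]; simp
      · rw [image_eq_zero_of_notMem_tsupport hw]; simp
    simp_rw [hz]
    simp only [integral_zero, norm_zero, mul_zero]
    have := Real.pi_pos
    positivity
  obtain ⟨w0, hw0, hbw0⟩ := hex
  set p : V := z + h • w0 with hp
  have hp1 : 1 / 2 ≤ ‖p‖ := hb.half_le p hbw0
  have hp2 : ‖p‖ ≤ 2 := hb.le_two p hbw0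
  -- An open neighbourhood of the support of `ψ`. For `w ∈ s` one has |w − w0| < 1/4 + 1/8 = 3/8, so
  -- the whole rescaled neighbourhood stays in the annulus 1/8 ≤ |η| ≤ 4.
  set s : Set V := Metric.ball 0 (1 / 4) with hs
  have hso : IsOpen s := Metric.isOpen_ball
  have hdist : ∀ w ∈ s, ‖z + h • w - p‖ ≤ h * (3 / 8) ∧ ‖z + h • w - p‖ < 3 / 8 := by
    intro w hw
    have hw' : ‖w‖ < 1 / 4 := by simpa [hs] using hw
    have h1 : ‖w - w0‖ < 3 / 8 := (norm_sub_le _ _).trans_lt (by linarith)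
    have h2 : z + h • w - p = h • (w - w0) := by rw [hp, smul_sub]; abel
    rw [h2, norm_smul, Real.norm_of_nonneg hh0.le]
    constructor <;> nlinarith [norm_nonneg (w - w0)]
  have hann : ∀ w ∈ s, 1 / 8 ≤ ‖z + h • w‖ ∧ ‖z + h • w‖ ≤ 4 := by
    intro w hw
    have h1 := (hdist w hw).2
    have h2 := norm_sub_norm_le p (z + h • w)
    have h3 := norm_sub_norm_le (z + h • w) p
    rw [norm_sub_rev] at h2
    constructor <;> linarith
  have hne : ∀ w ∈ s, z + h • w ∈ ({0}ᶜ : Set V) := by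
    intro w hw h0
    have := (hann w hw).1
    rw [Set.mem_singleton_iff.mp h0, norm_zero] at this
    norm_num at this
  set g : V →L[ℝ] V := h • ContinuousLinearMap.id ℝ V with hg
  have hgn : ‖g‖ ≤ h := by
    refine (norm_smul_le h (ContinuousLinearMap.id ℝ V)).trans ?_
    rw [Real.norm_of_nonneg hh0.le]
    exact mul_le_of_le_one_right hh0.le ContinuousLinearMap.norm_id_le
  have hgw : ∀ w, g w = h • w := fun w => rfl
  set ℓ : V →L[ℝ] ℝ := (lam * h) • fderiv ℝ F p with hℓ
  set L : V := (InnerProductSpace.toDual ℝ V).symm ℓ with hL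
  have hLw : ∀ w, inner ℝ w L = ℓ w := by
    intro w
    rw [real_inner_comm, hL, InnerProductSpace.toDual_symm_apply]
  have hLn : ‖L‖ = lam * h * ‖fderiv ℝ F p‖ := by
    rw [hL, LinearIsometryEquiv.norm_map, hℓ, norm_smul, Real.norm_of_nonneg (by positivity)]
  -- The phase minus its linear part at `p` (up to a constant). The first derivative of `R` is O(λh
  -- · h) by the mean value inequality, the i-th is O(λh^i) for i ≥ 2; both are O(1) because λh² ≤ 1
  -- and h ≤ 1. Hence e^{iR} can be absorbed into the amplitude.
  set R : V → ℝ := fun w => lam * F (z + h • w) - ℓ w with hR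
  have hFs : ContDiffOn ℝ ∞ (fun w => F (z + g w)) s :=
    hF.smooth.comp (contDiff_const.add g.contDiff).contDiffOn hne
  have hFs' : ContDiffOn ℝ ∞ (fun w => lam * F (z + g w)) s := contDiffOn_const.mul hFs
  have hRs : ContDiffOn ℝ ∞ R s := hFs'.sub ℓ.contDiff.contDiffOn
  have hM0 : 0 ≤ M := by linarith
  have hRb : ∀ w ∈ s, ∀ i, 1 ≤ i → i ≤ N → ‖iteratedFDeriv ℝ i R w‖ ≤ M := by
    intro w hw i hi1 hiN
    have hcd : ContDiffAt ℝ ∞ F (z + g w) :=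
      hF.smooth.contDiffAt (isOpen_compl_singleton.mem_nhds (hne w hw))
    have hFw : ContDiffAt ℝ i (fun w => lam * F (z + g w)) w :=
      ((hFs'.contDiffAt (hso.mem_nhds hw))).of_le (by exact_mod_cast le_top)
    have hFw0 : ContDiffAt ℝ i (fun w => F (z + g w)) w :=
      ((hFs.contDiffAt (hso.mem_nhds hw))).of_le (by exact_mod_cast le_top)
    rcases hi1.eq_or_lt with rfl | hi2
    · rw [norm_iteratedFDeriv_one]
      have hd : HasFDerivAt R (lam • (fderiv ℝ F (z + g w)).comp g - ℓ) w := by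
        have h1 : HasFDerivAt (fun w => z + g w) g w := by
          simpa using (g.hasFDerivAt (x := w)).const_add z
        have h2 := (hcd.differentiableAt (by simp)).hasFDerivAt.comp w h1
        exact (h2.const_mul lam).sub ℓ.hasFDerivAt
      rw [hd.fderiv]
      have : lam • (fderiv ℝ F (z + g w)).comp g - ℓ
          = (lam * h) • (fderiv ℝ F (z + g w) - fderiv ℝ F p) := by
        ext v
        simp [hg, hℓ]
        ring
      rw [this, norm_smul, Real.norm_of_nonneg (by positivity)]
      have h3 := hF.norm_fderiv_sub_le hp1 hp2 (hdist w hw).2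
      have h4 : Cφ 2 * ‖z + h • w - p‖ ≤ M * (h * (3 / 8)) :=
        mul_le_mul (hM 2 (by omega)) (hdist w hw).1 (norm_nonneg _) hM0
      calc lam * h * ‖fderiv ℝ F (z + g w) - fderiv ℝ F p‖
          ≤ lam * h * (M * (h * (3 / 8))) :=
            mul_le_mul_of_nonneg_left (h3.trans h4) (by positivity)
        _ = (lam * h ^ 2) * (M * (3 / 8)) := by ring
        _ ≤ 1 * (M * (3 / 8)) := mul_le_mul_of_nonneg_right hlh (by positivity)
        _ ≤ M := by linarith
    · have hsub : iteratedFDeriv ℝ i R w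
          = iteratedFDeriv ℝ i (fun w => lam * F (z + g w)) w
            - iteratedFDeriv ℝ i (fun w => ℓ w) w :=
        fun_iteratedFDeriv_sub_apply hFw ℓ.contDiff.contDiffAt
      have hsm : iteratedFDeriv ℝ i (fun w => lam * F (z + g w)) w
          = lam • iteratedFDeriv ℝ i (fun w => F (z + g w)) w :=
        iteratedFDeriv_const_smul_apply' (a := lam) hFw0
      rw [hsub, iteratedFDeriv_clm_eq_zero ℓ hi2, sub_zero, hsm, norm_smul,
        Real.norm_of_nonneg hlam]
      have h1 := norm_iteratedFDeriv_comp_affine_le isOpen_compl_singleton hF.smooth z g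
        (w := w) (hne w hw) i
      have h2 : ‖iteratedFDeriv ℝ i F (z + g w)‖ ≤ M :=
        (hF.bound i hi2 _ (hann w hw).1 (hann w hw).2).trans (hM i (by omega))
      have h3 : ‖g‖ ^ i ≤ h ^ 2 :=
        (pow_le_pow_left₀ (norm_nonneg _) hgn i).trans (pow_le_pow_of_le_one hh0.le hh1 hi2)
      calc lam * ‖iteratedFDeriv ℝ i (fun w => F (z + g w)) w‖
          ≤ lam * (M * h ^ 2) := by
            refine mul_le_mul_of_nonneg_left (h1.trans ?_) hlam
            exact mul_le_mul h2 h3 (by positivity) hM0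
        _ = (lam * h ^ 2) * M := by ring
        _ ≤ 1 * M := mul_le_mul_of_nonneg_right hlh hM0
        _ = M := one_mul M
  -- the smooth compactly supported factor
  set bt : V → ℂ := fun w => (ψ w : ℂ) * b (z + g w) with hbt
  have hψc : ContDiff ℝ ∞ (fun w => (ψ w : ℂ)) := Complex.ofRealCLM.contDiff.comp hψ
  have hbg : ContDiff ℝ ∞ (fun w => b (z + g w)) := hb.smooth.comp (contDiff_const.add g.contDiff)
  have hbts : ContDiff ℝ ∞ bt := hψc.mul hbg
  have hbtt : tsupport bt ⊆ Metric.closedBall 0 (1 / 8) := by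
    refine closure_minimal (fun w hw => ?_) Metric.isClosed_closedBall
    refine hψs (subset_tsupport _ fun h0 => hw ?_)
    simp [hbt, h0]
  have hbtb : ∀ q ≤ N, ∀ w, ‖iteratedFDeriv ℝ q bt w‖ ≤ 2 ^ N * (P * B) := by
    intro q hq w
    have h1 := norm_iteratedFDeriv_mul_le_scale (q := q) (x := w) (A := P) (B := B) (Λ := 1)
      isOpen_univ hψc.contDiffOn hbg.contDiffOn (Set.mem_univ _)
      (fun i hi => by
        rw [iteratedFDeriv_ofReal_norm hψ, one_pow, mul_one]
        exact (hψb i w).trans (hP i (hi.trans hq)))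
      (fun i hi => by
        rw [one_pow, mul_one]
        refine (norm_iteratedFDeriv_comp_affine_le isOpen_univ hb.smooth.contDiffOn z g
          (Set.mem_univ _) i).trans ?_
        calc ‖iteratedFDeriv ℝ i b (z + g w)‖ * ‖g‖ ^ i ≤ (B * Λ ^ i) * h ^ i := by
              refine mul_le_mul ((hb.bound i _).trans ?_)
                (pow_le_pow_left₀ (norm_nonneg _) hgn i) (by positivity) (by positivity)
              exact mul_le_mul_of_nonneg_right (hB i (hi.trans hq)) (by positivity)
          _ = B * (h * Λ) ^ i := by rw [mul_pow]; ring
          _ ≤ B * 1 := by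
              refine mul_le_mul_of_nonneg_left (pow_le_one₀ (by positivity) hhΛ) (by linarith)
          _ = B := mul_one B)
    refine h1.trans ?_
    rw [one_pow, mul_one]
    exact mul_le_mul_of_nonneg_right (pow_le_pow_right₀ (by norm_num) hq) (by positivity)
  -- The remaining amplitude has derivatives bounded independently of λ, so only the linear phase w
  -- ↦ ⟨w, L⟩ with |L| ≥ λhδ still oscillates.
  set c : V → ℂ := fun w => Complex.exp (Complex.I * (R w : ℂ)) * bt w with hc
  have hss : Metric.closedBall (0 : V) (1 / 8) ⊆ s :=
    Metric.closedBall_subset_ball (by norm_num)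
  have hexpR : ContDiffOn ℝ ∞ (fun w => Complex.exp (Complex.I * (R w : ℂ))) s := by
    have := contDiffOn_cexp_mul hRs 1
    simpa using this
  have hcs : ContDiff ℝ ∞ c :=
    contDiff_mul_of_tsupport_subset hso hexpR hbts (hbtt.trans hss)
  have hcsupp : ∀ w, c w ≠ 0 → ‖w‖ ≤ 1 / 8 := by
    intro w hw
    have : bt w ≠ 0 := fun h0 => hw (by simp [hc, h0])
    simpa using hbtt (subset_tsupport _ this)
  have hcb : ∀ q ≤ N, ∀ w, ‖iteratedFDeriv ℝ q c w‖ ≤ A * 1 ^ q := by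
    intro q hq w
    by_cases hw : w ∈ s
    · have h1 := norm_iteratedFDeriv_mul_le_scale (q := q) (x := w) (A := N.factorial * M ^ N)
        (B := 2 ^ N * (P * B)) (Λ := 1) hso hexpR hbts.contDiffOn hw
        (fun i hi => by
          rw [one_pow, mul_one]
          refine (norm_iteratedFDeriv_cexp_le hso hRs hw hM1
            fun j hj1 hj2 => hRb w hw j hj1 (hj2.trans (hi.trans hq))).trans ?_
          refine mul_le_mul ?_ (pow_le_pow_right₀ hM1 (hi.trans hq)) (by positivity) (by positivity)
          exact_mod_cast Nat.factorial_le (hi.trans hq))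
        (fun i hi => by rw [one_pow, mul_one]; exact hbtb i (hi.trans hq) w)
      refine h1.trans ?_
      rw [one_pow, mul_one, mul_one, hA]
      exact mul_le_mul_of_nonneg_right (pow_le_pow_right₀ (by norm_num) hq) (by positivity)
    · have : w ∉ tsupport c := by
        intro h
        have : tsupport c ⊆ Metric.closedBall 0 (1 / 8) :=
          closure_minimal (fun w hw => by simpa using hcsupp w hw) Metric.isClosed_closedBall
        exact hw (hss (this h))
      rw [iteratedFDeriv_eq_zero_of_notMem_tsupport this, norm_zero]
      positivity
  have hint : ∫ w, (ψ w : ℂ) *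
      (Complex.exp (Complex.I * ((lam * F (z + h • w) : ℝ) : ℂ)) * b (z + h • w))
      = ∫ w, Complex.exp (Complex.I * ((inner ℝ w L : ℝ) : ℂ)) * c w := by
    refine integral_congr_ae (Eventually.of_forall fun w => ?_)
    simp only [hc, hbt, hLw, hgw, hR]
    rw [← mul_assoc (Complex.exp (Complex.I * ((ℓ w : ℝ) : ℂ))), ← Complex.exp_add, ← mul_add]
    rw [show ((ℓ w : ℝ) : ℂ) + ((lam * F (z + h • w) - ℓ w : ℝ) : ℂ)
      = ((lam * F (z + h • w) : ℝ) : ℂ) by push_cast; ring]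
    ring
  rw [hint]
  refine le_trans ?_ (norm_oscillatory_integral_le hcs hcsupp N (by positivity) le_rfl hcb L)
  refine mul_le_mul_of_nonneg_right (pow_le_pow_left₀ (by positivity) ?_ N) (norm_nonneg _)
  rw [hLn]
  exact mul_le_mul_of_nonneg_left (hgrad p hbw0) (by positivity)

/-- Non-stationary phase for phases with bounded derivatives, at the scale `h` on which the phase
is essentially linear. -/
theorem exists_nonstationary_bound (Cφ Cb : ℕ → ℝ) (N : ℕ) : ∃ C : ℝ, 0 ≤ C ∧
    ∀ lam Λ h δ : ℝ, 0 ≤ lam → 0 ≤ Λ → 0 < h → h ≤ 1 → lam * h ^ 2 ≤ 1 → h * Λ ≤ 1 → 0 ≤ δ →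
    ∀ F : V → ℝ, IsHomPhase Cφ F → ∀ b : V → ℂ, IsAnnularAmp Cb Λ b →
    (∀ η, b η ≠ 0 → δ ≤ ‖fderiv ℝ F η‖) →
    (lam * h * δ) ^ N * ‖∫ η, Complex.exp (Complex.I * ((lam * F η : ℝ) : ℂ)) * b η‖ ≤ C := by
  obtain ⟨ψ, hψ, hψc, hψ1, hψs, Cψ, hψb⟩ := exists_smooth_average V
  obtain ⟨C, hC0, hC⟩ := exists_local_oscillatory_bound (V := V) Cφ Cb Cψ N
  refine ⟨C * (volume (Metric.closedBall (0 : V) 3)).toReal, by positivity, ?_⟩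
  intro lam Λ h δ hlam hΛ hh0 hh1 hlh hhΛ hδ F hF b hb hgrad
  set f : V → ℂ := fun η => Complex.exp (Complex.I * ((lam * F η : ℝ) : ℂ)) * b η with hf
  have hfs : ContDiff ℝ ∞ f := contDiff_phase_mul_amp hF hb lam
  have hbc : HasCompactSupport b :=
    HasCompactSupport.of_support_subset_isCompact (isCompact_closedBall 0 2)
      ((subset_tsupport b).trans (hb.tsupport_subset.trans Set.inter_subset_right))
  have hfc : HasCompactSupport f := hbc.mul_left
  rw [integral_eq_integral_integral_translate hfs.continuous
    (hfs.continuous.integrable_of_hasCompactSupport hfc) hψ.continuous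
    (hψ.continuous.integrable_of_hasCompactSupport hψc) hψ1 h]
  set I : V → ℂ := fun z => ∫ w, (ψ w : ℂ) * f (z + h • w) with hI
  -- A translate contributes only if it meets the support of `b`, so |z| ≤ 2 + 1/8; averaging the
  -- local bound over a ball of fixed volume costs only a constant.
  have hI0 : ∀ z, z ∉ Metric.closedBall (0 : V) 3 → I z = 0 := by
    intro z hz
    have hz' : 3 < ‖z‖ := by simpa using hz
    have : ∀ w, (ψ w : ℂ) * f (z + h • w) = 0 := by
      intro w
      by_cases hw : w ∈ tsupport ψ
      · have hw' : ‖w‖ ≤ 1 / 8 := by simpa using hψs hw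
        have : b (z + h • w) = 0 := by
          by_contra hne
          have h1 := hb.le_two _ hne
          have h2 : ‖h • w‖ ≤ 1 / 8 := by
            rw [norm_smul, Real.norm_of_nonneg hh0.le]; nlinarith [norm_nonneg w]
          have h3 := norm_sub_le (z + h • w) (h • w)
          rw [add_sub_cancel_right] at h3
          linarith
        simp [hf, this]
      · rw [image_eq_zero_of_notMem_tsupport hw]; simp
    simp only [hI, this, integral_zero]
  have hset : ∫ z, I z = ∫ z in Metric.closedBall (0 : V) 3, I z :=
    (setIntegral_eq_integral_of_forall_compl_eq_zero hI0).symm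
  set a : ℝ := (lam * h * δ) ^ N with ha
  have ha0 : 0 ≤ a := by positivity
  have hbound : ∀ z ∈ Metric.closedBall (0 : V) 3, ‖(a : ℂ) * I z‖ ≤ C := by
    intro z _
    rw [norm_mul, Complex.norm_real, Real.norm_of_nonneg ha0]
    exact hC ψ hψ hψs hψb lam Λ h δ hlam hΛ hh0 hh1 hlh hhΛ hδ F hF b hb hgrad z
  have := norm_setIntegral_le_of_norm_le_const (μ := (volume : Measure V))
    (measure_closedBall_lt_top (x := (0 : V)) (r := 3)) hbound
  rw [integral_const_mul, norm_mul, Complex.norm_real, Real.norm_of_nonneg ha0] at this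
  rw [hset]
  exact this

end Oscillatory

/-! ### Measure of the set where a homogeneous phase is small. -/

section Sublevel

/-- A function with `N` zeros on an interval is controlled by its `N`-th derivative. -/
theorem abs_le_of_zeros (N : ℕ) : ∀ (g : ℕ → ℝ → ℝ) (α β M : ℝ),
    (∀ i < N, ∀ t ∈ Set.Icc α β, HasDerivAt (g i) (g (i + 1) t) t) →
    (∀ t ∈ Set.Icc α β, |g N t| ≤ M) → ∀ z : ℕ → ℝ, (∀ i < N, z i ∈ Set.Icc α β ∧ g 0 (z i) = 0) →
    (∀ i, i + 1 < N → z i < z (i + 1)) → ∀ t ∈ Set.Icc α β, |g 0 t| ≤ (β - α) ^ N * M := by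
  induction N with
  | zero =>
    intro g α β M _ hM z _ _ t ht
    simpa using hM t ht
  | succ N ih =>
    intro g α β M hg hM z hz hmono t ht
    -- Rolle's theorem gives `N` increasing zeros of the derivative, to which the induction
    -- hypothesis applies; the value 0 for `i ≥ N` is junk.
    have hr : ∀ i, ∃ c, i < N → c ∈ Set.Ioo (z i) (z (i + 1)) ∧ g 1 c = 0 := by
      intro i
      by_cases hi : i < N
      · have hlt := hmono i (by omega)
        have hsub : Set.Icc (z i) (z (i + 1)) ⊆ Set.Icc α β :=
          Set.Icc_subset_Icc (hz i (by omega)).1.1 (hz (i + 1) (by omega)).1.2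
        obtain ⟨c, hc, hc0⟩ := exists_hasDerivAt_eq_zero (f := g 0) (f' := g 1) hlt
          (fun s hs => (hg 0 (by omega) s (hsub hs)).continuousAt.continuousWithinAt)
          (by rw [(hz i (by omega)).2, (hz (i + 1) (by omega)).2])
          (fun s hs => hg 0 (by omega) s (hsub (Set.Ioo_subset_Icc_self hs)))
        exact ⟨c, fun _ => ⟨hc, hc0⟩⟩
      · exact ⟨0, fun h => absurd h hi⟩
    choose z' hz' using hr
    have h1 : ∀ s ∈ Set.Icc α β, |g 1 s| ≤ (β - α) ^ N * M := by
      refine ih (fun i => g (i + 1)) α β M (fun i hi s hs => hg (i + 1) (by omega) s hs)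
        hM z' (fun i hi => ⟨?_, (hz' i hi).2⟩) (fun i hi => ?_)
      · have h2 := (hz' i hi).1
        exact ⟨(hz i (by omega)).1.1.trans h2.1.le, h2.2.le.trans (hz (i + 1) (by omega)).1.2⟩
      · exact (hz' i (by omega)).1.2.trans (hz' (i + 1) hi).1.1
    have h0 := hz 0 (by omega)
    have hmv := (convex_Icc α β).norm_image_sub_le_of_norm_hasDerivWithin_le
      (f := g 0) (f' := g 1) (C := (β - α) ^ N * M)
      (fun s hs => (hg 0 (by omega) s hs).hasDerivWithinAt) h1 h0.1 ht
    rw [h0.2, sub_zero, Real.norm_eq_abs, Real.norm_eq_abs] at hmv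
    have h3 : |t - z 0| ≤ β - α := by
      rw [abs_le]; constructor <;> linarith [ht.1, ht.2, h0.1.1, h0.1.2]
    have h4 : 0 ≤ (β - α) ^ N * M := (abs_nonneg _).trans (h1 t ht)
    calc |g 0 t| ≤ (β - α) ^ N * M * |t - z 0| := hmv
      _ ≤ (β - α) ^ N * M * (β - α) := mul_le_mul_of_nonneg_left h3 h4
      _ = _ := by ring

/-- A bounded set of large measure contains many separated points. -/
theorem exists_separated_of_lt_volume (N : ℕ) {w : ℝ} (hw : 0 ≤ w) : ∀ (A : Set ℝ) (α β : ℝ),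
    A ⊆ Set.Icc α β → ENNReal.ofReal (N * w) < volume A →
    ∃ t : ℕ → ℝ, (∀ i ≤ N, t i ∈ A) ∧ ∀ i < N, t i + w ≤ t (i + 1) := by
  induction N with
  | zero =>
    intro A α β _ hA
    have hne : A.Nonempty := by
      by_contra h
      rw [Set.not_nonempty_iff_eq_empty.mp h] at hA
      simp at hA
    obtain ⟨a, ha⟩ := hne
    exact ⟨fun _ => a, fun _ _ => ha, fun i hi => absurd hi (Nat.not_lt_zero i)⟩
  | succ N ih =>
    intro A α β hAs hA
    have hne : A.Nonempty := by
      by_contra h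
      rw [Set.not_nonempty_iff_eq_empty.mp h] at hA
      simp at hA
    have hfin : volume A ≠ ⊤ := ((measure_mono hAs).trans_lt measure_Icc_lt_top).ne
    have hv : ((N + 1 : ℕ) : ℝ) * w < (volume A).toReal :=
      (ENNReal.ofReal_lt_iff_lt_toReal (by positivity) hfin).mp hA
    have hbdd : BddBelow A := ⟨α, fun x hx => (hAs hx).1⟩
    -- The infimum need not be attained. The point `a` is taken so close to it that deleting [inf A,
    -- a + w) leaves measure greater than `N * w`, which feeds the induction.
    obtain ⟨a, haA, ha⟩ := exists_lt_of_csInf_lt hne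
      (show sInf A < sInf A + ((volume A).toReal - ((N + 1 : ℕ) : ℝ) * w) by linarith)
    have hsub : A ⊆ Set.Ico (sInf A) (a + w) ∪ (A ∩ Set.Ici (a + w)) := by
      intro x hx
      by_cases hxa : x < a + w
      · exact Or.inl ⟨csInf_le hbdd hx, hxa⟩
      · exact Or.inr ⟨hx, not_lt.mp hxa⟩
    have hfin' : volume (A ∩ Set.Ici (a + w)) ≠ ⊤ :=
      ((measure_mono Set.inter_subset_left).trans_lt hfin.lt_top).ne
    have hge : sInf A ≤ a := csInf_le hbdd haA
    have hle : (volume A).toReal ≤ (a + w - sInf A) + (volume (A ∩ Set.Ici (a + w))).toReal := by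
      have h1 := (measure_mono hsub).trans (measure_union_le (μ := volume) _ _)
      rw [Real.volume_Ico] at h1
      have h2 := ENNReal.toReal_mono (ENNReal.add_ne_top.mpr ⟨ENNReal.ofReal_ne_top, hfin'⟩) h1
      rwa [ENNReal.toReal_add ENNReal.ofReal_ne_top hfin',
        ENNReal.toReal_ofReal (by linarith)] at h2
    obtain ⟨t, ht, htw⟩ := ih (A ∩ Set.Ici (a + w)) α β (Set.inter_subset_left.trans hAs) (by
      rw [ENNReal.ofReal_lt_iff_lt_toReal (by positivity) hfin']
      push_cast at hv ha
      linarith)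
    refine ⟨fun i => Nat.casesOn i a t, fun i hi => ?_, fun i hi => ?_⟩
    · cases i with
      | zero => exact haA
      | succ i => exact (ht i (by omega)).1
    · cases i with
      | zero => exact (ht 0 (by omega)).2
      | succ i => exact htw i (by omega)

/-- One-dimensional sublevel estimate. -/
theorem volume_sublevel_Icc_le {N : ℕ} {g : ℕ → ℝ → ℝ} {α β M τ d : ℝ} (hτ : 0 < τ) (hd : 0 < d)
    (hN : 1 ≤ N) (hg : ∀ i < N + 1, ∀ t ∈ Set.Icc α β, HasDerivAt (g i) (g (i + 1) t) t)
    (hM : ∀ t ∈ Set.Icc α β, |g (N + 1) t| ≤ M) (hr : (β - α) ^ N * M < d / 4) :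
    volume {t | t ∈ Set.Icc α β ∧ |g 0 t| ≤ τ ∧ d ≤ g 1 t} ≤ ENNReal.ofReal (N * (4 * τ / d)) := by
  by_contra hcon
  push Not at hcon
  -- Two points of the set at distance at least `w` have a chord of slope at most 2τ/w = d/2.
  set w : ℝ := 4 * τ / d with hw
  have hw0 : 0 < w := by positivity
  obtain ⟨t, ht, htw⟩ := exists_separated_of_lt_volume N hw0.le _ α β (fun x hx => hx.1) hcon
  have hlt : ∀ i < N, t i < t (i + 1) := fun i hi => by linarith [htw i hi]
  -- Between consecutive chosen points `g 1` drops from at least d to at most d/2, so it takes the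
  -- value 3d/4. These `N` zeros force |g 1 − 3d/4| < d/4 on the whole interval, contradicting `d ≤
  -- g 1 (t 0)`.
  have hz : ∀ i, ∃ z, i < N → z ∈ Set.Ioo (t i) (t (i + 1)) ∧ g 1 z - 3 * d / 4 = 0 := by
    intro i
    by_cases hi : i < N
    swap
    · exact ⟨0, fun h => absurd h hi⟩
    have hsub : Set.Icc (t i) (t (i + 1)) ⊆ Set.Icc α β :=
      Set.Icc_subset_Icc (ht i hi.le).1.1 (ht (i + 1) hi).1.2
    obtain ⟨s, hs, hs1⟩ := exists_hasDerivAt_eq_slope (g 0) (g 1) (hlt i hi)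
      (fun s hs => (hg 0 (by omega) s (hsub hs)).continuousAt.continuousWithinAt)
      (fun s hs => hg 0 (by omega) s (hsub (Set.Ioo_subset_Icc_self hs)))
    have hs2 : g 1 s ≤ d / 2 := by
      rw [hs1, div_le_iff₀ (by linarith [hlt i hi])]
      have h1 := abs_le.mp (ht i hi.le).2.1
      have h2 := abs_le.mp (ht (i + 1) hi).2.1
      have h3 : d / 2 * w ≤ d / 2 * (t (i + 1) - t i) :=
        mul_le_mul_of_nonneg_left (by linarith [htw i hi]) (by positivity)
      have h4 : d / 2 * w = 2 * τ := by rw [hw]; field_simp; ring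
      linarith
    have hcont : ContinuousOn (g 1) (Set.Icc (t i) s) := fun x hx =>
      (hg 1 (by omega) x (hsub ⟨hx.1, hx.2.trans hs.2.le⟩)).continuousAt.continuousWithinAt
    have hmem : 3 * d / 4 ∈ Set.Ioo (g 1 s) (g 1 (t i)) :=
      ⟨by linarith, by linarith [(ht i hi.le).2.2]⟩
    obtain ⟨z, hz, hz1⟩ := intermediate_value_Ioo' hs.1.le hcont hmem
    exact ⟨z, fun _ => ⟨⟨hz.1, hz.2.trans hs.2⟩, by rw [hz1, sub_self]⟩⟩
  choose z hz using hz
  have key := abs_le_of_zeros N (fun i s => if i = 0 then g 1 s - 3 * d / 4 else g (i + 1) s) α β M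
    (fun i hi s hs => by
      rcases Nat.eq_zero_or_pos i with rfl | hi0
      · simpa using (hg 1 (by omega) s hs).sub_const (3 * d / 4)
      · simpa [hi0.ne'] using hg (i + 1) (by omega) s hs)
    (fun s hs => by simpa [show N ≠ 0 by omega] using hM s hs) z
    (fun i hi => ⟨⟨(ht i hi.le).1.1.trans (hz i hi).1.1.le,
      (hz i hi).1.2.le.trans (ht (i + 1) hi).1.2⟩, by simpa using (hz i hi).2⟩)
    (fun i hi => (hz i (by omega)).1.2.trans (hz (i + 1) hi).1.1) (t 0) (ht 0 (Nat.zero_le _)).1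
  simp only [if_true] at key
  have h1 := (ht 0 (Nat.zero_le _)).2.2
  have h2 := (le_abs_self _).trans key
  linarith

variable {V : Type*} [NormedAddCommGroup V] [InnerProductSpace ℝ V]

theorem hasDerivAt_iteratedDeriv_of_contDiffAt {f : ℝ → ℝ} {t : ℝ} (h : ContDiffAt ℝ ∞ f t)
    (i : ℕ) : HasDerivAt (iteratedDeriv i f) (iteratedDeriv (i + 1) f t) t := by
  have hd : DifferentiableAt ℝ (iteratedDeriv i f) t := by
    rw [iteratedDeriv_eq_equiv_comp]
    exact (LinearIsometryEquiv.differentiableAt _).comp t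
      (h.differentiableAt_iteratedFDeriv (by exact_mod_cast ENat.natCast_lt_top i))
  rw [iteratedDeriv_succ]
  exact hd.hasDerivAt

/-- The restriction of a homogeneous phase to a short segment. -/
theorem volume_sublevel_segment_le {Cφ : ℕ → ℝ} {F : V → ℝ} (hF : IsHomPhase Cφ F) {N : ℕ}
    (hN : 1 ≤ N) {M τ d r : ℝ} (hτ : 0 < τ) (hd : 0 < d) (hM : Cφ (N + 1) ≤ M)
    (hr1 : r ≤ 1 / 8) (hr : r ^ N * M < d / 4) {e : V} (he : ‖e‖ = 1) (η : V) :
    volume {t : ℝ | t ∈ Set.Icc 0 r ∧ (1 / 4 ≤ ‖η + t • e‖ ∧ ‖η + t • e‖ ≤ 2) ∧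
      |F (η + t • e)| ≤ τ ∧ d ≤ fderiv ℝ F (η + t • e) e} ≤ ENNReal.ofReal (N * (4 * τ / d)) := by
  set A := {t : ℝ | t ∈ Set.Icc 0 r ∧ (1 / 4 ≤ ‖η + t • e‖ ∧ ‖η + t • e‖ ≤ 2) ∧
      |F (η + t • e)| ≤ τ ∧ d ≤ fderiv ℝ F (η + t • e) e} with hA
  -- A point of the set anchors the segment: since its length is at most 1/8, all of it lies in 1/8
  -- ≤ |η| ≤ 4, where the derivative bounds hold.
  rcases A.eq_empty_or_nonempty with h0 | ⟨t0, ht0⟩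
  · rw [h0]; simp
  have hann : ∀ t ∈ Set.Icc 0 r, 1 / 8 ≤ ‖η + t • e‖ ∧ ‖η + t • e‖ ≤ 4 := by
    intro t ht
    have h1 : ‖(η + t • e) - (η + t0 • e)‖ ≤ 1 / 8 := by
      rw [add_sub_add_left_eq_sub, ← sub_smul, norm_smul, he, mul_one, Real.norm_eq_abs, abs_le]
      constructor <;> linarith [ht.1, ht.2, ht0.1.1, ht0.1.2]
    have h2 := norm_sub_norm_le (η + t0 • e) (η + t • e)
    have h3 := norm_sub_norm_le (η + t • e) (η + t0 • e)
    rw [norm_sub_rev] at h2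
    constructor <;> linarith [ht0.2.1.1, ht0.2.1.2]
  have hne : ∀ t ∈ Set.Icc 0 r, η + t • e ∈ ({0}ᶜ : Set V) := by
    intro t ht h0
    have := (hann t ht).1
    rw [Set.mem_singleton_iff.mp h0, norm_zero] at this
    norm_num at this
  set g : ℝ →L[ℝ] V := ContinuousLinearMap.toSpanSingleton ℝ e with hg
  have hgn : ‖g‖ = 1 := by rw [hg, ContinuousLinearMap.norm_toSpanSingleton, he]
  set f : ℝ → ℝ := fun t => F (η + g t) with hf
  have hgt : ∀ t, g t = t • e := fun t => rfl
  have hcd : ∀ t ∈ Set.Icc 0 r, ContDiffAt ℝ ∞ f t := by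
    intro t ht
    have h1 : ContDiffAt ℝ ∞ F (η + g t) :=
      hF.smooth.contDiffAt (isOpen_compl_singleton.mem_nhds (hne t ht))
    exact h1.comp t (contDiff_const.add g.contDiff).contDiffAt
  have hd1 : ∀ t ∈ Set.Icc 0 r, iteratedDeriv 1 f t = fderiv ℝ F (η + t • e) e := by
    intro t ht
    rw [iteratedDeriv_one]
    have h1 : ContDiffAt ℝ ∞ F (η + g t) :=
      hF.smooth.contDiffAt (isOpen_compl_singleton.mem_nhds (hne t ht))
    have h2 : HasDerivAt (fun t => η + g t) e t := by
      have := (g.hasDerivAt (x := t)).const_add η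
      simpa [hg] using this
    exact ((h1.differentiableAt (by simp)).hasFDerivAt.comp_hasDerivAt t h2).deriv
  have key := volume_sublevel_Icc_le (N := N) (g := fun i => iteratedDeriv i f) (α := 0) (β := r)
    (M := M) hτ hd hN (fun i _ t ht => hasDerivAt_iteratedDeriv_of_contDiffAt (hcd t ht) i)
    (fun t ht => by
      rw [← Real.norm_eq_abs, ← norm_iteratedFDeriv_eq_norm_iteratedDeriv]
      refine (norm_iteratedFDeriv_comp_affine_le isOpen_compl_singleton hF.smooth η g
        (hne t ht) (N + 1)).trans ?_
      rw [hgn, one_pow, mul_one]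
      exact (hF.bound (N + 1) (by omega) _ (hann t ht).1 (hann t ht).2).trans hM)
    (by simpa using hr)
  refine (measure_mono fun t ht => ?_).trans key
  refine ⟨ht.1, ?_, ?_⟩
  · simpa [hf, hgt] using ht.2.2.1
  · rw [hd1 t ht.1]; exact ht.2.2.2

variable [FiniteDimensional ℝ V] [MeasurableSpace V] [BorelSpace V]

/-- Integrating along segments in a fixed direction. -/
theorem volume_le_of_segments {A : Set V} (hA : MeasurableSet A) (hA2 : A ⊆ Metric.closedBall 0 2)
    {r : ℝ} (hr1 : r ≤ 1) {e : V} (he : ‖e‖ = 1) {B : ℝ≥0∞}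
    (hB : ∀ η, volume {t : ℝ | t ∈ Set.Icc 0 r ∧ η + t • e ∈ A} ≤ B) :
    ENNReal.ofReal r * volume A ≤ volume (Metric.closedBall (0 : V) 3) * B := by
  set φ : V → ℝ → ℝ≥0∞ := fun η t => A.indicator 1 (η + t • e) with hφ
  have hmeas : Measurable (Function.uncurry φ) := by
    have h1 : Measurable fun p : V × ℝ => p.1 + p.2 • e := by fun_prop
    exact (measurable_one.indicator hA).comp h1
  -- For fixed `t` the integral over `η` is the volume of `A` by translation invariance;
  -- interchanging the integrals leaves the one-dimensional measures.
  have h1 : ∫⁻ t in Set.Icc 0 r, ∫⁻ η, φ η t = ENNReal.ofReal r * volume A := by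
    have : ∀ t, ∫⁻ η, φ η t = volume A := by
      intro t
      simp only [hφ]
      rw [lintegral_add_right_eq_self (fun η => A.indicator (1 : V → ℝ≥0∞) η), lintegral_indicator_one hA]
    simp_rw [this]
    rw [lintegral_const, Measure.restrict_apply_univ, Real.volume_Icc, sub_zero, mul_comm]
  have h2 : ∫⁻ t in Set.Icc 0 r, ∫⁻ η, φ η t = ∫⁻ η, ∫⁻ t in Set.Icc 0 r, φ η t :=
    lintegral_lintegral_swap (f := fun t η => φ η t) (hmeas.comp measurable_swap).aemeasurable
  have h3 : ∀ η, ∫⁻ t in Set.Icc 0 r, φ η t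
      ≤ (Metric.closedBall (0 : V) 3).indicator (fun _ => B) η := by
    intro η
    by_cases hη : η ∈ Metric.closedBall (0 : V) 3
    · rw [Set.indicator_of_mem hη]
      refine le_trans ?_ (hB η)
      have hmA : MeasurableSet {t : ℝ | η + t • e ∈ A} := by
        have : Measurable fun t : ℝ => η + t • e := by fun_prop
        exact this hA
      have : ∀ t, φ η t = {t : ℝ | η + t • e ∈ A}.indicator 1 t := fun t => rfl
      simp_rw [this]
      rw [lintegral_indicator_one hmA, Measure.restrict_apply hmA]
      exact measure_mono fun t ht => ⟨ht.2, ht.1⟩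
    · rw [Set.indicator_of_notMem hη]
      refine le_of_eq ((lintegral_congr_ae ?_).trans lintegral_zero)
      filter_upwards [ae_restrict_mem measurableSet_Icc] with t ht
      refine Set.indicator_of_notMem (fun hmem => hη ?_) _
      have h4 : ‖η + t • e‖ ≤ 2 := by simpa using hA2 hmem
      have h5 := norm_sub_le (η + t • e) (t • e)
      rw [add_sub_cancel_right, norm_smul, he, mul_one, Real.norm_of_nonneg ht.1] at h5
      have := ht.2
      rw [mem_closedBall_zero_iff]
      linarith
  rw [← h1, h2]
  refine (lintegral_mono h3).trans ?_
  rw [lintegral_indicator_const Metric.isClosed_closedBall.measurableSet, mul_comm]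

/-- Sublevel estimate for homogeneous phases with non-vanishing gradient. -/
theorem exists_sublevel_bound (Cφ : ℕ → ℝ) {ε : ℝ} (hε : 0 < ε) : ∃ C : ℝ, 0 ≤ C ∧
    ∀ lam δ τ : ℝ, 1 ≤ lam → lam⁻¹ ≤ δ → 0 < τ → ∀ F : V → ℝ, IsHomPhase Cφ F →
    ∀ Ω : Set V, MeasurableSet Ω → (∀ η ∈ Ω, 1 / 4 ≤ ‖η‖ ∧ ‖η‖ ≤ 2 ∧ δ ≤ ‖fderiv ℝ F η‖) →
    volume {η | η ∈ Ω ∧ |F η| ≤ τ} ≤ ENNReal.ofReal (C * (lam ^ ε * τ / δ)) := by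
  -- With Nε ≥ 1 segments of length about λ^(−ε) are short enough: r^N is at most a constant times
  -- λ⁻¹ ≤ δ. Bounds on sufficiently high derivatives thus replace the smallness of second
  -- derivatives, at the price of the factor λ^ε.
  obtain ⟨N, hN⟩ := exists_nat_gt (1 / ε)
  have hN1 : 1 ≤ N := by
    have : (0 : ℝ) < N := lt_trans (by positivity) hN
    exact_mod_cast this
  have hNε : 1 ≤ N * ε := by
    rw [div_lt_iff₀ hε] at hN; exact hN.le
  set n : ℕ := Module.finrank ℝ V with hn
  set M : ℝ := max 1 (Cφ (N + 1)) with hM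
  have hM1 : 1 ≤ M := le_max_left _ _
  set c : ℝ := 1 / (8 * (n + 1) * M) with hc
  have hc0 : 0 < c := by positivity
  have hn1 : (1 : ℝ) ≤ n + 1 := by have := Nat.cast_nonneg (α := ℝ) n; linarith
  have hc8 : c ≤ 1 / 8 := by
    rw [hc]
    refine one_div_le_one_div_of_le (by norm_num) ?_
    nlinarith
  have hcM : c * M = 1 / (8 * (n + 1)) := by
    rw [hc]; field_simp
  set W : ℝ := (volume (Metric.closedBall (0 : V) 3)).toReal with hW
  refine ⟨2 * n * (W * (N * (4 * (n + 1))) / c), by positivity, ?_⟩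
  intro lam δ τ hlam hδ hτ F hF Ω hΩ hΩF
  have hlam0 : 0 < lam := by linarith
  have hδ0 : 0 < δ := lt_of_lt_of_le (by positivity) hδ
  set r : ℝ := c * lam ^ (-ε) with hr
  have hr0 : 0 < r := by positivity
  have hlε : lam ^ (-ε) ≤ 1 := Real.rpow_le_one_of_one_le_of_nonpos hlam (by linarith)
  have hr8 : r ≤ 1 / 8 := by
    calc r ≤ c * 1 := mul_le_mul_of_nonneg_left hlε hc0.le
      _ ≤ 1 / 8 := by linarith
  -- If all partial derivatives were at most `d` in absolute value, the gradient would have norm at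
  -- most n·d < δ. Hence some ±∂ᵢF exceeds `d`; the sign is absorbed by passing to −F.
  set d : ℝ := δ / (n + 1) with hd
  have hd0 : 0 < d := by positivity
  have hrN : r ^ N * M < d / 4 := by
    have h1 : (lam ^ (-ε)) ^ N ≤ lam⁻¹ := by
      rw [← Real.rpow_natCast, ← Real.rpow_mul hlam0.le, ← Real.rpow_neg_one]
      exact Real.rpow_le_rpow_of_exponent_le hlam (by nlinarith)
    have h2 : c ^ N ≤ c := by
      calc c ^ N ≤ c ^ 1 := pow_le_pow_of_le_one hc0.le (by linarith) hN1
        _ = c := pow_one c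
    calc r ^ N * M = c ^ N * (lam ^ (-ε)) ^ N * M := by rw [hr, mul_pow]
      _ ≤ c * lam⁻¹ * M := by gcongr
      _ = (c * M) * lam⁻¹ := by ring
      _ ≤ (c * M) * δ := mul_le_mul_of_nonneg_left hδ (by positivity)
      _ = d / 8 := by rw [hcM, hd]; field_simp
      _ < d / 4 := by linarith
  -- one direction
  have hdir : ∀ (G : V → ℝ), IsHomPhase Cφ G → ∀ e : V, ‖e‖ = 1 →
      volume {η | η ∈ Ω ∧ |G η| ≤ τ ∧ d ≤ fderiv ℝ G η e}
        ≤ ENNReal.ofReal (W * (N * (4 * τ / d)) / r) := by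
    intro G hG e he
    have hGm : Measurable G := measurable_of_continuousOn_compl_singleton 0 hG.smooth.continuousOn
    have hmA : MeasurableSet {η | η ∈ Ω ∧ |G η| ≤ τ ∧ d ≤ fderiv ℝ G η e} := by
      refine hΩ.inter (MeasurableSet.inter ?_ ?_)
      · exact measurableSet_le (continuous_abs.measurable.comp hGm) measurable_const
      · exact measurableSet_le measurable_const (measurable_fderiv_apply_const ℝ G e)
    have key := volume_le_of_segments (r := r) hmA
      (fun η hη => by simpa using (hΩF η hη.1).2.1) (by linarith) he
      (B := ENNReal.ofReal (N * (4 * τ / d))) (fun η => by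
        refine (measure_mono fun t ht => ?_).trans (volume_sublevel_segment_le hG hN1 hτ hd0
          (le_max_right 1 _) hr8 hrN he η)
        exact ⟨ht.1, ⟨(hΩF _ ht.2.1).1, (hΩF _ ht.2.1).2.1⟩, ht.2.2⟩)
    rw [show volume (Metric.closedBall (0 : V) 3) = ENNReal.ofReal W from
      (ENNReal.ofReal_toReal measure_closedBall_lt_top.ne).symm,
      ← ENNReal.ofReal_mul (by positivity), mul_comm] at key
    rw [ENNReal.ofReal_div_of_pos hr0]
    rwa [ENNReal.le_div_iff_mul_le (Or.inl (by simpa using hr0)) (Or.inl ENNReal.ofReal_ne_top)]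
  set b := stdOrthonormalBasis ℝ V with hb
  have hcover : {η | η ∈ Ω ∧ |F η| ≤ τ} ⊆ ⋃ i : Fin n,
      ({η | η ∈ Ω ∧ |F η| ≤ τ ∧ d ≤ fderiv ℝ F η (b i)} ∪
        {η | η ∈ Ω ∧ |(fun y => -F y) η| ≤ τ ∧ d ≤ fderiv ℝ (fun y => -F y) η (b i)}) := by
    rintro η ⟨hηΩ, hητ⟩
    by_contra hcon
    simp only [Set.mem_iUnion, Set.mem_union, Set.mem_ofPred_eq, not_exists, not_or, not_and,
      not_le, abs_neg, fderiv_fun_neg, neg_apply] at hcon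
    have hlt : ∀ i, |fderiv ℝ F η (b i)| ≤ d := fun i => by
      rw [abs_le]
      have h1 := (hcon i).1 hηΩ hητ
      have h2 := (hcon i).2 hηΩ hητ
      constructor <;> linarith
    have hnorm : ‖fderiv ℝ F η‖ ≤ n * d := by
      refine ContinuousLinearMap.opNorm_le_bound _ (by positivity) fun v => ?_
      conv_lhs => rw [← b.sum_repr v]
      rw [map_sum]
      refine (norm_sum_le _ _).trans ?_
      have : ∀ i ∈ Finset.univ, ‖fderiv ℝ F η (b.repr v i • b i)‖ ≤ d * ‖v‖ := by
        intro i _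
        rw [map_smul, norm_smul, Real.norm_eq_abs (fderiv ℝ F η (b i)), mul_comm]
        have h1 : ‖b.repr v i‖ ≤ ‖v‖ := by
          rw [b.repr_apply_apply]
          refine (norm_inner_le_norm _ _).trans ?_
          rw [b.orthonormal.1 i, one_mul]
        exact mul_le_mul (hlt i) h1 (norm_nonneg _) hd0.le
      refine (Finset.sum_le_sum this).trans ?_
      simp [hn, mul_assoc]
    have h1 := (hΩF η hηΩ).2.2.trans hnorm
    have h2 : (n + 1) * d = δ := by rw [hd]; field_simp
    linarith
  calc volume {η | η ∈ Ω ∧ |F η| ≤ τ}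
      ≤ ∑ i : Fin n, (ENNReal.ofReal (W * (N * (4 * τ / d)) / r)
          + ENNReal.ofReal (W * (N * (4 * τ / d)) / r)) := by
        refine (measure_mono hcover).trans ((measure_iUnion_fintype_le _ _).trans ?_)
        refine Finset.sum_le_sum fun i _ => (measure_union_le _ _).trans ?_
        exact add_le_add (hdir F hF (b i) (b.orthonormal.1 i))
          (hdir _ hF.neg (b i) (b.orthonormal.1 i))
    _ = ENNReal.ofReal (2 * n * (W * (N * (4 * τ / d)) / r)) := by
        rw [← ENNReal.ofReal_add (by positivity) (by positivity), Finset.sum_const,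
          Finset.card_univ, Fintype.card_fin, ← ENNReal.ofReal_nsmul]
        congr 1
        rw [nsmul_eq_mul]; ring
    _ = _ := by
        congr 1
        rw [hd, hr, Real.rpow_neg hlam0.le]
        field_simp

end Sublevel

/-! ### The gain from homogeneity, by integration along rays. -/

section Radial

variable {V : Type*} [NormedAddCommGroup V] [InnerProductSpace ℝ V]

/-- The gradient is homogeneous of degree zero, so a lower bound at one point holds along its whole
ray; differentiate F(ty) = tF(y) in y. -/
theorem fderiv_smul_of_homogeneous {F : V → ℝ} (hs : ContDiffOn ℝ ∞ F {0}ᶜ)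
    (hh : ∀ η : V, η ≠ 0 → ∀ t : ℝ, 0 < t → F (t • η) = t * F η) {η : V}
    (hη : η ≠ 0) {t : ℝ} (ht : 0 < t) : fderiv ℝ F (t • η) = fderiv ℝ F η := by
  have hd : ∀ y : V, y ≠ 0 → DifferentiableAt ℝ F y := fun y hy =>
    (hs.contDiffAt (isOpen_compl_singleton.mem_nhds hy)).differentiableAt (by simp)
  have h1 : HasFDerivAt (fun y => F (t • y))
      ((fderiv ℝ F (t • η)).comp (t • ContinuousLinearMap.id ℝ V)) η :=
    (hd (t • η) (smul_ne_zero ht.ne' hη)).hasFDerivAt.comp η ((hasFDerivAt_id η).const_smul t)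
  have h2 : HasFDerivAt (fun y => F (t • y)) (t • fderiv ℝ F η) η := by
    refine ((hd η hη).hasFDerivAt.const_mul t).congr_of_eventuallyEq ?_
    filter_upwards [isOpen_compl_singleton.mem_nhds hη] with y hy
    exact hh y hy t ht
  have h3 := h1.unique h2
  ext v
  have := congrArg (fun L : V →L[ℝ] ℝ => L v) h3
  simp only [ContinuousLinearMap.comp_apply, smul_apply, ContinuousLinearMap.id_apply,
    map_smul, smul_eq_mul] at this
  exact mul_left_cancel₀ ht.ne' this

variable [FiniteDimensional ℝ V] [MeasurableSpace V] [BorelSpace V]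

/-- The weight t^(−n) in the normalisation compensates the Jacobian of η ↦ tη, so averaging over
dilations with `c` reproduces the integral. The support lies strictly inside (1, 2). -/
theorem exists_radial_weight (n : ℕ) : ∃ c : ℝ → ℝ, ContDiff ℝ ∞ c ∧
    (∀ t, c t ≠ 0 → t ∈ Set.Icc (5 / 4 : ℝ) (7 / 4)) ∧
    (∫ t, c t * (t ^ n)⁻¹ = 1) ∧ ∃ Cc : ℕ → ℝ, ∀ j t, ‖iteratedFDeriv ℝ j c t‖ ≤ Cc j := by
  let f : ContDiffBump (3 / 2 : ℝ) := ⟨1 / 8, 1 / 4, by norm_num, by norm_num⟩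
  have hfc : ContDiff ℝ ∞ (f.normed volume) := f.contDiff_normed
  have hc : ContDiff ℝ ∞ (fun t => f.normed volume t * t ^ n) := hfc.mul (contDiff_id.pow n)
  have hs : HasCompactSupport (fun t => f.normed volume t * t ^ n) :=
    f.hasCompactSupport_normed.mul_right
  have hmem : ∀ t, f.normed volume t ≠ 0 → t ∈ Set.Icc (5 / 4 : ℝ) (7 / 4) := by
    intro t ht
    have : t ∈ Metric.ball (3 / 2 : ℝ) (1 / 4) := f.support_normed_eq (μ := volume) ▸ ht
    rw [Real.ball_eq_Ioo] at this
    constructor <;> linarith [this.1, this.2]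
  refine ⟨_, hc, fun t ht => hmem t (left_ne_zero_of_mul ht), ?_, ?_⟩
  · rw [← f.integral_normed (μ := volume)]
    refine integral_congr_ae (Eventually.of_forall fun t => ?_)
    by_cases ht : f.normed volume t = 0
    · simp [ht]
    · have : (0 : ℝ) < t := by linarith [(hmem t ht).1]
      simp only
      field_simp
  · have : ∀ j, ∃ C, ∀ w, ‖iteratedFDeriv ℝ j (fun t => f.normed volume t * t ^ n) w‖ ≤ C :=
      fun j => (hs.iteratedFDeriv j).exists_bound_of_continuous
        (hc.continuous_iteratedFDeriv (m := j) (by exact_mod_cast le_top))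
    choose C hC using this
    exact ⟨C, hC⟩

/-- Averaging an integral over dilations. -/
theorem integral_eq_integral_integral_dilate {f : V → ℂ} (hf : Continuous f)
    (hf2 : ∀ η, f η ≠ 0 → ‖η‖ ≤ 2) {c : ℝ → ℝ} (hc : Continuous c)
    (hcs : ∀ t, c t ≠ 0 → t ∈ Set.Icc (5 / 4 : ℝ) (7 / 4))
    (hc1 : ∫ t, c t * (t ^ Module.finrank ℝ V)⁻¹ = 1) :
    ∫ η, f η = ∫ η, ∫ t, (c t : ℂ) * f (t • η) := by
  have hswap : Integrable (Function.uncurry fun (t : ℝ) (η : V) => (c t : ℂ) * f (t • η))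
      ((volume : Measure ℝ).prod volume) := by
    refine Continuous.integrable_of_hasCompactSupport ?_ ?_
    · have : Continuous fun p : ℝ × V => (c p.1 : ℂ) * f (p.1 • p.2) := by fun_prop
      exact this
    · refine HasCompactSupport.of_support_subset_isCompact
        ((isCompact_Icc (a := (5 / 4 : ℝ)) (b := 7 / 4)).prod (isCompact_closedBall (0 : V) 2)) ?_
      rintro ⟨t, η⟩ hp
      have hp' : (c t : ℂ) * f (t • η) ≠ 0 := hp
      have h1 := hcs t (by simpa using left_ne_zero_of_mul hp')
      have h2 := hf2 _ (right_ne_zero_of_mul hp')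
      refine ⟨h1, ?_⟩
      rw [norm_smul, Real.norm_of_nonneg (by linarith [h1.1])] at h2
      rw [mem_closedBall_zero_iff]
      nlinarith [h1.1, norm_nonneg η]
  rw [← integral_integral_swap hswap]
  have : ∀ t, ∫ η, (c t : ℂ) * f (t • η)
      = ((c t * (t ^ Module.finrank ℝ V)⁻¹ : ℝ) : ℂ) * ∫ η, f η := by
    intro t
    by_cases ht : c t = 0
    · simp [ht]
    have ht0 : (0 : ℝ) < t := by linarith [(hcs t ht).1]
    rw [integral_const_mul, Measure.integral_comp_smul, abs_of_nonneg (by positivity),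
      Complex.real_smul]
    push_cast
    ring
  simp_rw [this]
  rw [integral_mul_const, integral_complex_ofReal, hc1]
  simp

/-- First order gain in the oscillatory integral, from integration along rays. -/
theorem exists_radial_bound (Cφ Cb : ℕ → ℝ) {ε : ℝ} (hε : 0 < ε) (N : ℕ) : ∃ C : ℝ, 0 ≤ C ∧
    ∀ lam Λ δ τ : ℝ, 1 ≤ lam → 1 ≤ Λ → lam⁻¹ ≤ δ → 0 < τ →
    ∀ F : V → ℝ, IsHomPhase Cφ F → ∀ b : V → ℂ, IsAnnularAmp Cb Λ b →
    (∀ η, b η ≠ 0 → δ ≤ ‖fderiv ℝ F η‖) →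
    ‖∫ η, Complex.exp (Complex.I * ((lam * F η : ℝ) : ℂ)) * b η‖
      ≤ C * (lam ^ ε * τ / δ + (Λ / (lam * τ)) ^ N) := by
  obtain ⟨c, hcc, hcs, hc1, Cc, hCc⟩ := exists_radial_weight (Module.finrank ℝ V)
  obtain ⟨S, hS0, hS⟩ := exists_sublevel_bound (V := V) Cφ hε
  obtain ⟨B, hB1, hB⟩ := exists_one_le_bound Cb N
  obtain ⟨P, hP1, hP⟩ := exists_one_le_bound Cc N
  set A : ℝ := 2 ^ N * (P * (B * 2 ^ N)) with hA
  have hA0 : 0 ≤ A := by positivity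
  set D : ℕ → ℝ := fun N => (4 * Real.pi) ^ N * (N + 1)
    * (volume (Metric.closedBall (0 : ℝ) 2)).toReal * A with hD
  have hD0 : ∀ N, 0 ≤ D N := fun N => by have := Real.pi_pos; positivity
  set W : ℝ := (volume (Metric.closedBall (0 : V) 2)).toReal with hW
  refine ⟨D 0 * S + D N * W, by have := hD0 0; have := hD0 N; positivity, ?_⟩
  intro lam Λ δ τ hlam hΛ hδ hτ F hF b hb hgrad
  have hlam0 : 0 < lam := by linarith
  have hδ0 : 0 < δ := lt_of_lt_of_le (by positivity) hδ
  set f : V → ℂ := fun η => Complex.exp (Complex.I * ((lam * F η : ℝ) : ℂ)) * b η with hf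
  have hfs : ContDiff ℝ ∞ f := contDiff_phase_mul_amp hF hb lam
  have hf2 : ∀ η, f η ≠ 0 → ‖η‖ ≤ 2 := fun η hη => hb.le_two η (right_ne_zero_of_mul hη)
  rw [integral_eq_integral_integral_dilate hfs.continuous hf2 hcc.continuous hcs hc1]
  set J : V → ℂ := fun η => ∫ t, (c t : ℂ) * f (t • η) with hJ
  -- The points whose rays meet the support of `b`. The open parameter interval contains the support
  -- of `c`; `Ω` is open as a union of open sets, hence measurable, and inherits the gradient bound
  -- by homogeneity.
  set Ω : Set V := ⋃ t ∈ Set.Ioo (1 : ℝ) 2, {η | b (t • η) ≠ 0} with hΩ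
  have hΩo : IsOpen Ω := by
    refine isOpen_biUnion fun t _ => ?_
    have : Continuous fun η : V => b (t • η) := hb.smooth.continuous.comp (continuous_const_smul t)
    exact isOpen_ne_fun this continuous_const
  have hΩmem : ∀ η ∈ Ω, 1 / 4 ≤ ‖η‖ ∧ ‖η‖ ≤ 2 ∧ δ ≤ ‖fderiv ℝ F η‖ := by
    intro η hη
    simp only [hΩ, Set.mem_iUnion] at hη
    obtain ⟨t, ht, hbt⟩ := hη
    have ht0 : 0 < t := by linarith [ht.1]
    have h1 := hb.half_le _ hbt
    have h2 := hb.le_two _ hbt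
    rw [norm_smul, Real.norm_of_nonneg ht0.le] at h1 h2
    have h3 : 1 / 4 ≤ ‖η‖ := by nlinarith [ht.2, norm_nonneg η]
    have hη0 : η ≠ 0 := by
      intro h0
      rw [h0, norm_zero] at h3
      norm_num at h3
    refine ⟨h3, by nlinarith [ht.1, norm_nonneg η], ?_⟩
    rw [← fderiv_smul_of_homogeneous hF.smooth hF.homogeneous hη0 ht0]
    exact hgrad _ hbt
  have hJ0 : ∀ η, η ∉ Ω → J η = 0 := by
    intro η hη
    have : ∀ t, (c t : ℂ) * f (t • η) = 0 := by
      intro t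
      by_cases ht : c t = 0
      · simp [ht]
      have h1 := hcs t ht
      have : b (t • η) = 0 := by
        by_contra hne
        refine hη ?_
        simp only [hΩ, Set.mem_iUnion]
        exact ⟨t, ⟨by linarith [h1.1], by linarith [h1.2]⟩, hne⟩
      simp [hf, this]
    simp only [hJ, this, integral_zero]
  -- Because F(tη) = tF(η) exactly, J(η) is a one-dimensional Fourier integral at frequency λF(η),
  -- with amplitude c(t)b(tη) varying at scale 1/Λ.
  have hJb : ∀ η ∈ Ω, ∀ N' ≤ N, |lam * F η| ^ N' * ‖J η‖ ≤ D N' * Λ ^ N' := by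
    intro η hη N' hN'
    have hη2 := hΩmem η hη
    have hη0 : η ≠ 0 := by
      intro h0
      have := hη2.1
      rw [h0, norm_zero] at this
      norm_num at this
    set g : ℝ →L[ℝ] V := ContinuousLinearMap.toSpanSingleton ℝ η with hg
    have hgn : ‖g‖ ≤ 2 := by rw [hg, ContinuousLinearMap.norm_toSpanSingleton]; exact hη2.2.1
    have hgt : ∀ t, g t = t • η := fun t => rfl
    set k : ℝ → ℂ := fun t => (c t : ℂ) * b (0 + g t) with hk
    have hcC : ContDiff ℝ ∞ (fun t => (c t : ℂ)) := Complex.ofRealCLM.contDiff.comp hcc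
    have hbg : ContDiff ℝ ∞ (fun t => b (0 + g t)) :=
      hb.smooth.comp (contDiff_const.add g.contDiff)
    have hks : ContDiff ℝ ∞ k := hcC.mul hbg
    have hksupp : ∀ t, k t ≠ 0 → ‖t‖ ≤ 2 := by
      intro t ht
      have h1 := hcs t (by simpa using left_ne_zero_of_mul ht)
      rw [Real.norm_of_nonneg (by linarith [h1.1])]
      linarith [h1.2]
    have hkb : ∀ q ≤ N', ∀ t, ‖iteratedFDeriv ℝ q k t‖ ≤ A * Λ ^ q := by
      intro q hq t
      have hqN := hq.trans hN'
      have h1 := norm_iteratedFDeriv_mul_le_scale (q := q) (x := t) (A := P) (B := B * 2 ^ N)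
        (Λ := Λ) isOpen_univ hcC.contDiffOn hbg.contDiffOn (Set.mem_univ _)
        (fun i hi => by
          rw [iteratedFDeriv_ofReal_norm hcc]
          exact (hCc i t).trans ((hP i (hi.trans hqN)).trans
            (le_mul_of_one_le_right (by linarith) (one_le_pow₀ hΛ))))
        (fun i hi => by
          refine (norm_iteratedFDeriv_comp_affine_le isOpen_univ hb.smooth.contDiffOn 0 g
            (Set.mem_univ _) i).trans ?_
          calc ‖iteratedFDeriv ℝ i b (0 + g t)‖ * ‖g‖ ^ i ≤ (B * Λ ^ i) * 2 ^ N := by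
                refine mul_le_mul ((hb.bound i _).trans ?_) ?_ (by positivity) (by positivity)
                · exact mul_le_mul_of_nonneg_right (hB i (hi.trans hqN)) (by positivity)
                · exact (pow_le_pow_left₀ (norm_nonneg _) hgn i).trans
                    (pow_le_pow_right₀ (by norm_num) (hi.trans hqN))
            _ = B * 2 ^ N * Λ ^ i := by ring)
      refine h1.trans (mul_le_mul_of_nonneg_right ?_ (by positivity))
      rw [hA]
      exact mul_le_mul_of_nonneg_right (pow_le_pow_right₀ (by norm_num) hqN) (by positivity)
    have key := norm_oscillatory_integral_le hks hksupp N' hA0 hΛ hkb (lam * F η)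
    have hJk : J η = ∫ t, Complex.exp (Complex.I * ((inner ℝ t (lam * F η) : ℝ) : ℂ)) * k t := by
      refine integral_congr_ae (Eventually.of_forall fun t => ?_)
      simp only [hk, hf, hgt, zero_add]
      by_cases ht : c t = 0
      · simp [ht]
      have ht0 : (0 : ℝ) < t := by linarith [(hcs t ht).1]
      rw [hF.homogeneous η hη0 t ht0]
      have : (inner ℝ t (lam * F η) : ℝ) = lam * (t * F η) := by
        simp
        ring
      rw [this]
      ring
    rw [hJk]
    exact key
  have hFm : Measurable F := measurable_of_continuousOn_compl_singleton 0 hF.smooth.continuousOn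
  set T : Set V := {η | η ∈ Ω ∧ |F η| ≤ τ} with hT
  have hTm : MeasurableSet T := hΩo.measurableSet.inter
    (measurableSet_le (continuous_abs.measurable.comp hFm) measurable_const)
  have hTvol : volume T ≤ ENNReal.ofReal (S * (lam ^ ε * τ / δ)) :=
    hS lam δ τ hlam hδ hτ F hF Ω hΩo.measurableSet hΩmem
  set X : ℝ := (Λ / (lam * τ)) ^ N with hX
  have hX0 : 0 ≤ X := by positivity
  -- The order 0 bound is used where |F| ≤ τ, a small set by the sublevel estimate, and the order N
  -- bound elsewhere.
  have hpt : ∀ η, ‖J η‖ ≤ T.indicator (fun _ => D 0) η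
      + (Metric.closedBall (0 : V) 2).indicator (fun _ => D N * X) η := by
    intro η
    have hn1 : 0 ≤ T.indicator (fun _ => D 0) η := Set.indicator_nonneg (fun _ _ => hD0 0) _
    have hn2 : 0 ≤ (Metric.closedBall (0 : V) 2).indicator (fun _ => D N * X) η :=
      Set.indicator_nonneg (fun _ _ => mul_nonneg (hD0 N) hX0) _
    by_cases hη : η ∈ Ω
    · by_cases hητ : |F η| ≤ τ
      · have h1 := hJb η hη 0 (Nat.zero_le _)
        rw [pow_zero, one_mul, pow_zero, mul_one] at h1
        rw [Set.indicator_of_mem (show η ∈ T from ⟨hη, hητ⟩)]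
        linarith
      · push Not at hητ
        have h1 := hJb η hη N le_rfl
        have h2 : η ∈ Metric.closedBall (0 : V) 2 := by simpa using (hΩmem η hη).2.1
        rw [Set.indicator_of_mem h2]
        have h3 : (lam * τ) ^ N * ‖J η‖ ≤ D N * Λ ^ N := by
          refine le_trans ?_ h1
          refine mul_le_mul_of_nonneg_right (pow_le_pow_left₀ (by positivity) ?_ N) (norm_nonneg _)
          rw [abs_mul, abs_of_pos hlam0]
          exact mul_le_mul_of_nonneg_left hητ.le hlam0.le
        have h4 : ‖J η‖ ≤ D N * X := by
          rw [hX, div_pow, ← mul_div_assoc, le_div_iff₀ (by positivity), mul_comm]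
          exact h3
        linarith
    · rw [hJ0 η hη, norm_zero]
      positivity
  have hi1 : Integrable (T.indicator fun _ : V => D 0) :=
    (integrable_indicator_iff hTm).mpr
      (integrableOn_const (hTvol.trans_lt ENNReal.ofReal_lt_top).ne)
  have hi2 : Integrable ((Metric.closedBall (0 : V) 2).indicator fun _ : V => D N * X) :=
    (integrable_indicator_iff Metric.isClosed_closedBall.measurableSet).mpr
      (integrableOn_const measure_closedBall_lt_top.ne)
  have hT' : (volume T).toReal ≤ S * (lam ^ ε * τ / δ) :=
    ENNReal.toReal_le_of_le_ofReal (by positivity) hTvol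
  calc ‖∫ η, J η‖ ≤ ∫ η, (T.indicator (fun _ => D 0) η
      + (Metric.closedBall (0 : V) 2).indicator (fun _ => D N * X) η) :=
        norm_integral_le_of_norm_le (hi1.add hi2) (Eventually.of_forall hpt)
    _ = (volume T).toReal * D 0 + W * (D N * X) := by
        rw [integral_add hi1 hi2, integral_indicator hTm,
          integral_indicator Metric.isClosed_closedBall.measurableSet, setIntegral_const,
          setIntegral_const]
        rfl
    _ ≤ S * (lam ^ ε * τ / δ) * D 0 + W * (D N * X) := by
        have := mul_le_mul_of_nonneg_right hT' (hD0 0)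
        linarith
    _ ≤ (D 0 * S + D N * W) * (lam ^ ε * τ / δ + X) := by
        have h1 : 0 ≤ D 0 * S * X := by have := hD0 0; positivity
        have h2 : 0 ≤ D N * W * (lam ^ ε * τ / δ) := by have := hD0 N; positivity
        nlinarith

end Radial

/-! ### The `T T*` method with Schur's test. -/

section Schur

open ComplexConjugate

variable {X Y : Type*} [MeasurableSpace X] [MeasurableSpace Y]

/-- The `T T*` argument together with Schur's test. -/
theorem integral_norm_sq_le_of_schur (ν : Measure X) (μ : Measure Y) [IsFiniteMeasure ν]
    [IsFiniteMeasure μ] {k : X → Y → ℂ} (hk : StronglyMeasurable (Function.uncurry k)) {B₀ B : ℝ}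
    (hB₀ : ∀ x y, ‖k x y‖ ≤ B₀) (hB : 0 < B)
    (hG : ∀ x, ∫ x', ‖∫ y, k x y * conj (k x' y) ∂μ‖ ∂ν ≤ B) {v : Y → ℂ} (hv : MemLp v 2 μ) :
    Integrable (fun x => ‖∫ y, k x y * v y ∂μ‖ ^ 2) ν ∧
    ∫ x, ‖∫ y, k x y * v y ∂μ‖ ^ 2 ∂ν ≤ B * ∫ y, ‖v y‖ ^ 2 ∂μ := by
  have hvi : Integrable v μ := hv.integrable (by norm_num)
  set h : X → ℂ := fun x => ∫ y, k x y * v y ∂μ with hh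
  set H : ℝ := B₀ * ∫ y, ‖v y‖ ∂μ with hH
  have hkv : AEStronglyMeasurable (fun p : X × Y => k p.1 p.2 * v p.2) (ν.prod μ) :=
    hk.aestronglyMeasurable.mul hv.1.comp_snd
  have hhm : AEStronglyMeasurable h ν := hkv.integral_prod_right'
  have hhb : ∀ x, ‖h x‖ ≤ H := by
    intro x
    rw [hH, ← integral_const_mul]
    refine norm_integral_le_of_norm_le (hvi.norm.const_mul _) (Eventually.of_forall fun y => ?_)
    rw [norm_mul]
    exact mul_le_mul_of_nonneg_right (hB₀ x y) (norm_nonneg _)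
  have hh2 : Integrable (fun x => ‖h x‖ ^ 2) ν :=
    Integrable.of_bound (hhm.norm.pow 2) (H ^ 2) (Eventually.of_forall fun x => by
      rw [norm_pow, norm_norm]; exact pow_le_pow_left₀ (norm_nonneg _) (hhb x) 2)
  refine ⟨hh2, ?_⟩
  -- With h = Tv, the function `g` is the conjugate of T*h. Below P = ‖Tv‖² is the pairing ∫ g v,
  -- and Q = ‖T*h‖² is controlled through the kernel `G` of `T T*`.
  set g : Y → ℂ := fun y => ∫ x, conj (h x) * k x y ∂ν with hg
  have hhc : AEStronglyMeasurable (fun x => conj (h x)) ν :=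
    Complex.continuous_conj.comp_aestronglyMeasurable hhm
  have hhk : AEStronglyMeasurable (fun p : Y × X => conj (h p.2) * k p.2 p.1) (μ.prod ν) :=
    hhc.comp_snd.mul (hk.comp_measurable measurable_swap).aestronglyMeasurable
  have hgm : AEStronglyMeasurable g μ := hhk.integral_prod_right'
  have hgb : ∀ y, ‖g y‖ ≤ (H * B₀) * ν.real Set.univ := by
    intro y
    refine norm_integral_le_of_norm_le_const (Eventually.of_forall fun x => ?_)
    rw [norm_mul, RCLike.norm_conj]
    exact mul_le_mul (hhb x) (hB₀ x y) (norm_nonneg _) ((norm_nonneg _).trans (hhb x))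
  have hg2 : Integrable (fun y => ‖g y‖ ^ 2) μ :=
    Integrable.of_bound (hgm.norm.pow 2) _ (Eventually.of_forall fun y => by
      rw [norm_pow, norm_norm]; exact pow_le_pow_left₀ (norm_nonneg _) (hgb y) 2)
  have hv2 : Integrable (fun y => ‖v y‖ ^ 2) μ := hv.norm.integrable_sq
  set P : ℝ := ∫ x, ‖h x‖ ^ 2 ∂ν with hP
  set Q : ℝ := ∫ y, ‖g y‖ ^ 2 ∂μ with hQ
  -- duality
  have hdual : (P : ℂ) = ∫ y, g y * v y ∂μ := by
    have h1 : (P : ℂ) = ∫ x, ∫ y, conj (h x) * (k x y * v y) ∂μ ∂ν := by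
      rw [hP, ← integral_complex_ofReal]
      refine integral_congr_ae (Eventually.of_forall fun x => ?_)
      simp only
      rw [integral_const_mul, Complex.conj_mul']
      push_cast
      rfl
    have hint : Integrable (Function.uncurry fun x y => conj (h x) * (k x y * v y)) (ν.prod μ) := by
      have hdom : Integrable (fun p : X × Y => (H * B₀) * ‖v p.2‖) (ν.prod μ) :=
        (Integrable.comp_snd hvi.norm ν).const_mul _
      refine hdom.mono' (hhc.comp_fst.mul hkv) (Eventually.of_forall fun p => ?_)
      simp only [Function.uncurry, norm_mul, RCLike.norm_conj]
      rw [← mul_assoc]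
      refine mul_le_mul_of_nonneg_right ?_ (norm_nonneg _)
      exact mul_le_mul (hhb _) (hB₀ _ _) (norm_nonneg _) ((norm_nonneg _).trans (hhb p.1))
    rw [h1, integral_integral_swap hint]
    refine integral_congr_ae (Eventually.of_forall fun y => ?_)
    simp only [hg]
    rw [← integral_mul_const]
    refine integral_congr_ae (Eventually.of_forall fun x => ?_)
    simp only
    ring
  have hgv : Integrable (fun y => ‖g y‖ * ‖v y‖) μ := by
    refine Integrable.mono' (hg2.add hv2) (hgm.norm.mul hv.1.norm) (Eventually.of_forall fun y => ?_)
    rw [Real.norm_of_nonneg (by positivity)]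
    simp only [Pi.add_apply]
    nlinarith [sq_nonneg (‖g y‖ - ‖v y‖), sq_nonneg (‖g y‖ + ‖v y‖)]
  have hP0 : 0 ≤ P := integral_nonneg fun x => by positivity
  -- Cauchy's inequality with weight `B`, chosen so that Q ≤ B·P turns the first term into P/2,
  -- which is absorbed on the left since P is finite.
  have hPle : P ≤ Q / (2 * B) + B / 2 * ∫ y, ‖v y‖ ^ 2 ∂μ := by
    calc P = ‖(P : ℂ)‖ := by rw [Complex.norm_real, Real.norm_of_nonneg hP0]
      _ ≤ ∫ y, ‖g y * v y‖ ∂μ := by rw [hdual]; exact norm_integral_le_integral_norm _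
      _ ≤ ∫ y, (1 / (2 * B) * ‖g y‖ ^ 2 + B / 2 * ‖v y‖ ^ 2) ∂μ := by
          simp only [norm_mul]
          refine integral_mono hgv ((hg2.const_mul _).add (hv2.const_mul _)) fun y => ?_
          have h1 : 0 ≤ (‖g y‖ - B * ‖v y‖) ^ 2 / (2 * B) := by positivity
          have h2 : (‖g y‖ - B * ‖v y‖) ^ 2 / (2 * B)
            = 1 / (2 * B) * ‖g y‖ ^ 2 + B / 2 * ‖v y‖ ^ 2 - ‖g y‖ * ‖v y‖ := by
            field_simp; ring
          simp only
          linarith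
      _ = _ := by
          rw [integral_add (hg2.const_mul _) (hv2.const_mul _), integral_const_mul,
            integral_const_mul]
          ring
  set G : X → X → ℂ := fun x x' => ∫ y, k x y * conj (k x' y) ∂μ with hGdef
  have hGm3 : StronglyMeasurable (fun q : (X × X) × Y => k q.1.1 q.2 * conj (k q.1.2 q.2)) := by
    have h1 : StronglyMeasurable (fun q : (X × X) × Y => k q.1.1 q.2) :=
      hk.comp_measurable (g := fun q : (X × X) × Y => (q.1.1, q.2)) (by fun_prop)
    have h2 : StronglyMeasurable (fun q : (X × X) × Y => k q.1.2 q.2) :=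
      hk.comp_measurable (g := fun q : (X × X) × Y => (q.1.2, q.2)) (by fun_prop)
    exact h1.mul (Complex.continuous_conj.comp_stronglyMeasurable h2)
  have hGm : StronglyMeasurable (fun p : X × X => G p.1 p.2) := hGm3.integral_prod_right'
  have hGb : ∀ x x', ‖G x x'‖ ≤ B₀ * B₀ * μ.real Set.univ := by
    intro x x'
    refine norm_integral_le_of_norm_le_const (Eventually.of_forall fun y => ?_)
    rw [norm_mul, RCLike.norm_conj]
    exact mul_le_mul (hB₀ _ _) (hB₀ _ _) (norm_nonneg _) ((norm_nonneg _).trans (hB₀ x y))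
  have hGsymm : ∀ x x', ‖G x' x‖ = ‖G x x'‖ := by
    intro x x'
    have : G x' x = conj (G x x') := by
      simp only [hGdef]
      rw [← integral_conj]
      refine integral_congr_ae (Eventually.of_forall fun y => ?_)
      simp only [map_mul, Complex.conj_conj]
      ring
    rw [this, RCLike.norm_conj]
  have hhG : Integrable (fun p : X × X => ‖h p.1‖ ^ 2 * ‖G p.1 p.2‖) (ν.prod ν) := by
    refine Integrable.of_bound ((hhm.comp_fst.norm.pow 2).mul hGm.norm.aestronglyMeasurable)
      (H ^ 2 * (B₀ * B₀ * μ.real Set.univ)) (Eventually.of_forall fun p => ?_)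
    rw [Real.norm_of_nonneg (by positivity)]
    exact mul_le_mul (pow_le_pow_left₀ (norm_nonneg _) (hhb _) 2) (hGb _ _) (norm_nonneg _)
      (by positivity)
  have hhG' : Integrable (fun p : X × X => ‖h p.2‖ ^ 2 * ‖G p.1 p.2‖) (ν.prod ν) := by
    refine hhG.swap.congr (Eventually.of_forall fun p => ?_)
    simp only [Function.comp, Prod.swap, hGsymm]
  have hI : ∫ p : X × X, ‖h p.1‖ ^ 2 * ‖G p.1 p.2‖ ∂(ν.prod ν) ≤ B * P := by
    rw [integral_prod _ hhG, hP, ← integral_const_mul]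
    refine integral_mono hhG.integral_prod_left (hh2.const_mul B) fun x => ?_
    simp only
    rw [integral_const_mul, mul_comm]
    exact mul_le_mul_of_nonneg_right (hG x) (by positivity)
  have hI' : ∫ p : X × X, ‖h p.2‖ ^ 2 * ‖G p.1 p.2‖ ∂(ν.prod ν) ≤ B * P := by
    refine le_of_eq_of_le ?_ hI
    rw [← integral_prod_swap]
    simp only [Prod.snd_swap, Prod.fst_swap, hGsymm]
  -- Schur's test: Q is the integral of conj h(x) h(x') G(x, x'). Bounding |h(x)h(x')| by half the
  -- sum of squares, and using |G(x, x')| = |G(x', x)|, only row integrals of `G` are needed.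
  have hQle : Q ≤ B * P := by
    have hQ1 : (Q : ℂ) = ∫ y, ∫ p : X × X, (conj (h p.1) * k p.1 y) * conj (conj (h p.2) * k p.2 y)
        ∂(ν.prod ν) ∂μ := by
      rw [hQ, ← integral_complex_ofReal]
      refine integral_congr_ae (Eventually.of_forall fun y => ?_)
      simp only
      rw [integral_prod_mul (fun x => conj (h x) * k x y) (fun x => conj (conj (h x) * k x y)),
        integral_conj, Complex.mul_conj']
      push_cast
      rfl
    have hm : AEStronglyMeasurable (fun q : (X × X) × Y =>
        (conj (h q.1.1) * k q.1.1 q.2) * conj (conj (h q.1.2) * k q.1.2 q.2))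
        ((ν.prod ν).prod μ) := by
      have h1 : AEStronglyMeasurable (fun q : (X × X) × Y => conj (h q.1.1) * h q.1.2)
          ((ν.prod ν).prod μ) := (hhc.comp_fst.mul hhm.comp_snd).comp_fst
      refine (h1.mul hGm3.aestronglyMeasurable).congr (Eventually.of_forall fun q => ?_)
      simp only [Pi.mul_apply, map_mul, Complex.conj_conj]
      ring
    have hint : Integrable (Function.uncurry fun (p : X × X) (y : Y) =>
        (conj (h p.1) * k p.1 y) * conj (conj (h p.2) * k p.2 y)) ((ν.prod ν).prod μ) := by
      refine Integrable.of_bound hm ((H * B₀) * (H * B₀)) (Eventually.of_forall fun q => ?_)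
      have hb : ∀ x y, ‖conj (h x) * k x y‖ ≤ H * B₀ := by
        intro x y
        rw [norm_mul, RCLike.norm_conj]
        exact mul_le_mul (hhb x) (hB₀ x y) (norm_nonneg _) ((norm_nonneg _).trans (hhb x))
      simp only [Function.uncurry]
      rw [norm_mul, RCLike.norm_conj]
      exact mul_le_mul (hb _ _) (hb _ _) (norm_nonneg _) ((norm_nonneg _).trans (hb q.1.1 q.2))
    rw [← integral_integral_swap hint] at hQ1
    have hQ2 : (Q : ℂ) = ∫ p : X × X, (conj (h p.1) * h p.2) * G p.1 p.2 ∂(ν.prod ν) := by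
      rw [hQ1]
      refine integral_congr_ae (Eventually.of_forall fun p => ?_)
      simp only [hGdef]
      rw [← integral_const_mul]
      refine integral_congr_ae (Eventually.of_forall fun y => ?_)
      simp only [map_mul, Complex.conj_conj]
      ring
    have hQ0 : 0 ≤ Q := integral_nonneg fun x => by positivity
    calc Q = ‖(Q : ℂ)‖ := by rw [Complex.norm_real, Real.norm_of_nonneg hQ0]
      _ ≤ ∫ p : X × X, (1 / 2 * (‖h p.1‖ ^ 2 * ‖G p.1 p.2‖)
            + 1 / 2 * (‖h p.2‖ ^ 2 * ‖G p.1 p.2‖)) ∂(ν.prod ν) := by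
          rw [hQ2]
          refine norm_integral_le_of_norm_le ((hhG.const_mul _).add (hhG'.const_mul _))
            (Eventually.of_forall fun p => ?_)
          rw [norm_mul, norm_mul, RCLike.norm_conj]
          have h1 : ‖h p.1‖ * ‖h p.2‖ ≤ 1 / 2 * (‖h p.1‖ ^ 2 + ‖h p.2‖ ^ 2) := by
            nlinarith [sq_nonneg (‖h p.1‖ - ‖h p.2‖)]
          have h2 := mul_le_mul_of_nonneg_right h1 (norm_nonneg (G p.1 p.2))
          linarith
      _ ≤ B * P := by
          rw [integral_add (hhG.const_mul _) (hhG'.const_mul _), integral_const_mul,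
            integral_const_mul]
          linarith
  have h1 : Q / (2 * B) ≤ P / 2 := by
    rw [div_le_iff₀ (by positivity)]
    linarith
  linarith

end Schur

/-! ### Bounds for the kernel of `T T*` and for its Schur integral. -/

section Kernel

variable {V : Type*} [NormedAddCommGroup V] [InnerProductSpace ℝ V] [FiniteDimensional ℝ V]
  [MeasurableSpace V] [BorelSpace V]

/-- Bound for the kernel of `T T*` in terms of the lower bound `δ` for the gradient. -/
theorem exists_kernel_bound (Cφ Cb : ℕ → ℝ) {ρ ε : ℝ} (hρ₁ : ρ ≤ 1) (hε : 0 < ε)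
    (M : ℝ) : ∃ C : ℝ, 0 ≤ C ∧ ∀ lam δ θ : ℝ, 1 ≤ lam → 0 < δ → 0 ≤ θ → θ ≤ 1 →
    ∀ F : V → ℝ, IsHomPhase Cφ F → ∀ b : V → ℂ, IsAnnularAmp Cb (lam ^ (1 - ρ)) b →
    (∀ η, b η ≠ 0 → δ ≤ ‖fderiv ℝ F η‖) →
    ‖∫ η, Complex.exp (Complex.I * ((lam * F η : ℝ) : ℂ)) * b η‖
      ≤ C * (lam ^ (-M) + if δ < lam ^ (ε - min ρ (1 / 2)) then (lam ^ (2 * ε - ρ) / δ) ^ θ else 0)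
    := by
  obtain ⟨N, hN⟩ := exists_nat_gt (M / ε)
  have hNε : M ≤ ε * N := by
    rw [div_lt_iff₀ hε] at hN; linarith
  obtain ⟨C0, hC0, h0⟩ := exists_nonstationary_bound (V := V) Cφ Cb 0
  obtain ⟨C1, hC1, h1⟩ := exists_nonstationary_bound (V := V) Cφ Cb N
  obtain ⟨C2, hC2, h2⟩ := exists_radial_bound (V := V) Cφ Cb hε N
  refine ⟨C0 + C1 + C2, by positivity, ?_⟩
  intro lam δ θ hlam hδ hθ0 hθ1 F hF b hb hgrad
  have hl0 : 0 < lam := by linarith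
  set μ : ℝ := min ρ (1 / 2) with hμ
  have hμρ : μ ≤ ρ := min_le_left _ _
  have hμ2 : μ ≤ 1 / 2 := min_le_right _ _
  -- The largest scale compatible with both λh² ≤ 1 (μ ≤ 1/2) and hΛ ≤ 1 (μ ≤ ρ).
  set h : ℝ := lam ^ (μ - 1) with hh
  set Λ : ℝ := lam ^ (1 - ρ) with hΛ
  have hΛ1 : 1 ≤ Λ := Real.one_le_rpow hlam (by linarith)
  have hh0 : 0 < h := by positivity
  have hh1 : h ≤ 1 := Real.rpow_le_one_of_one_le_of_nonpos hlam (by linarith)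
  have hlh2 : lam * h ^ 2 ≤ 1 := by
    rw [hh, ← Real.rpow_natCast, ← Real.rpow_mul hl0.le]
    nth_rewrite 1 [← Real.rpow_one lam]
    rw [← Real.rpow_add hl0]
    refine Real.rpow_le_one_of_one_le_of_nonpos hlam ?_
    push_cast
    linarith
  have hhΛ : h * Λ ≤ 1 := by
    rw [hh, hΛ, ← Real.rpow_add hl0]
    exact Real.rpow_le_one_of_one_le_of_nonpos hlam (by linarith)
  have hlh : lam * h = lam ^ μ := by
    rw [hh]
    nth_rewrite 1 [← Real.rpow_one lam]
    rw [← Real.rpow_add hl0]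
    congr 1; ring
  set K := ‖∫ η, Complex.exp (Complex.I * ((lam * F η : ℝ) : ℂ)) * b η‖ with hK
  -- The case of order 0 of the non-stationary estimate is the trivial bound.
  have hK0 : K ≤ C0 := by
    have := h0 lam Λ h δ hl0.le (by linarith) hh0 hh1 hlh2 hhΛ hδ.le F hF b hb hgrad
    rwa [pow_zero, one_mul] at this
  have hpow : (lam ^ ε) ^ N * lam ^ (-M) ≥ 1 := by
    rw [← Real.rpow_natCast, ← Real.rpow_mul hl0.le, ← Real.rpow_add hl0]
    exact Real.one_le_rpow hlam (by linarith)
  have hM0 : 0 < lam ^ (-M) := by positivity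
  split_ifs with hcase
  · set X : ℝ := lam ^ (2 * ε - ρ) / δ with hX
    have hX0 : 0 < X := by positivity
    -- Interpolation with the trivial bound: min(1, X) ≤ X^θ for 0 ≤ θ ≤ 1. Taking θ < 1 later makes
    -- the power of δ = c₀|s − s'| integrable even in dimension one.
    rcases le_total 1 X with hX1 | hX1
    · have h3 : 1 ≤ X ^ θ := Real.one_le_rpow hX1 hθ0
      nlinarith
    · have h3 : X ≤ X ^ θ := by
        have := Real.rpow_le_rpow_of_exponent_ge hX0 hX1 hθ1
        rwa [Real.rpow_one] at this
      -- The sublevel estimate needs δ ≥ λ⁻¹. This is automatic here, since X ≤ 1 means δ ≥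
      -- λ^(2ε−ρ), and ρ ≤ 1.
      have hδ1 : lam⁻¹ ≤ δ := by
        by_contra hcon
        push Not at hcon
        have h4 : lam ^ (2 * ε - ρ) ≤ δ := by rwa [hX, div_le_one hδ] at hX1
        have h5 : lam⁻¹ ≤ lam ^ (2 * ε - ρ) := by
          rw [← Real.rpow_neg_one]
          exact Real.rpow_le_rpow_of_exponent_le hlam (by linarith)
        linarith
      -- The threshold τ = λ^(ε−ρ) makes Λ/(λτ) = λ^(−ε), so the contribution from |F| > τ is at
      -- most a constant times λ^(−M) for the chosen `N`.
      have h4 := h2 lam Λ δ (lam ^ (ε - ρ)) hlam hΛ1 hδ1 (by positivity) F hF b hb hgrad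
      have h5 : lam ^ ε * lam ^ (ε - ρ) / δ = X := by
        rw [hX, ← Real.rpow_add hl0]
        congr 2; ring
      have h6 : Λ / (lam * lam ^ (ε - ρ)) = (lam ^ ε)⁻¹ := by
        rw [hΛ, ← Real.rpow_neg hl0.le, div_eq_iff (by positivity)]
        nth_rewrite 3 [← Real.rpow_one lam]
        rw [← Real.rpow_add hl0, ← Real.rpow_add hl0]
        congr 1; ring
      have h7 : ((lam ^ ε)⁻¹) ^ N ≤ lam ^ (-M) := by
        rw [inv_pow]
        exact (inv_le_iff_one_le_mul₀' (by positivity)).mpr hpow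
      rw [h5, h6] at h4
      have h8 : C2 * (X + ((lam ^ ε)⁻¹) ^ N) ≤ C2 * (lam ^ (-M) + X ^ θ) :=
        mul_le_mul_of_nonneg_left (by linarith) hC2
      have h9 : 0 ≤ (C0 + C1) * (lam ^ (-M) + X ^ θ) := by positivity
      linarith
  · push Not at hcase
    have h3 := h1 lam Λ h δ hl0.le (by linarith) hh0 hh1 hlh2 hhΛ hδ.le F hF b hb hgrad
    rw [hlh] at h3
    have h4 : lam ^ ε ≤ lam ^ μ * δ := by
      calc lam ^ ε = lam ^ μ * lam ^ (ε - μ) := by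
            rw [← Real.rpow_add hl0]; congr 1; ring
        _ ≤ _ := mul_le_mul_of_nonneg_left hcase (by positivity)
    have h5 : (lam ^ ε) ^ N * K ≤ C1 :=
      (mul_le_mul_of_nonneg_right (pow_le_pow_left₀ (by positivity) h4 N) (norm_nonneg _)).trans h3
    have h6 : K ≤ C1 * lam ^ (-M) := by
      calc K ≤ ((lam ^ ε) ^ N * lam ^ (-M)) * K := le_mul_of_one_le_left (norm_nonneg _) hpow
        _ = ((lam ^ ε) ^ N * K) * lam ^ (-M) := by ring
        _ ≤ _ := mul_le_mul_of_nonneg_right h5 hM0.le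
    have h7 : 0 ≤ (C0 + C2) * lam ^ (-M) := by positivity
    rw [add_zero]
    linarith

variable {W : Type*} [NormedAddCommGroup W] [InnerProductSpace ℝ W] [FiniteDimensional ℝ W]
  [MeasurableSpace W] [BorelSpace W]

/-- Integral of a negative power of the norm over a ball. -/
theorem integral_ball_norm_rpow_neg [Nontrivial W] {θ R : ℝ} (hθ : θ < 1) (hR : 0 < R) :
    Integrable (fun x : W => (Metric.ball 0 R).indicator (fun x => ‖x‖ ^ (-θ)) x) ∧
    ∫ x : W, (Metric.ball 0 R).indicator (fun x => ‖x‖ ^ (-θ)) x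
      = Module.finrank ℝ W * (volume (Metric.ball (0 : W) 1)).toReal
        * (R ^ (Module.finrank ℝ W - θ) / (Module.finrank ℝ W - θ)) := by
  set d := Module.finrank ℝ W with hd
  have hd1 : 1 ≤ d := Module.finrank_pos
  have hd1' : (1 : ℝ) ≤ d := by exact_mod_cast hd1
  set f : ℝ → ℝ := (Set.Iio R).indicator fun y => y ^ (-θ) with hf
  have heq : (fun x : W => (Metric.ball 0 R).indicator (fun x => ‖x‖ ^ (-θ)) x)
      = fun x => f ‖x‖ := by
    funext x
    by_cases hx : ‖x‖ < R
    · rw [Set.indicator_of_mem (by simpa using hx), hf, Set.indicator_of_mem (by exact hx)]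
    · rw [Set.indicator_of_notMem (by simpa using hx), hf, Set.indicator_of_notMem (by exact hx)]
  have hfi : ∀ y ∈ Set.Ioi (0 : ℝ), y ^ (d - 1) • f y
      = (Set.Ioo 0 R).indicator (fun y => y ^ ((d : ℝ) - 1 - θ)) y := by
    intro y hy
    by_cases hyR : y < R
    · rw [Set.indicator_of_mem (by exact ⟨hy, hyR⟩), hf, Set.indicator_of_mem (by exact hyR),
        smul_eq_mul, ← Real.rpow_natCast, ← Real.rpow_add hy]
      congr 1
      rw [Nat.cast_sub hd1]
      push_cast
      ring
    · rw [Set.indicator_of_notMem (fun h => hyR h.2), hf, Set.indicator_of_notMem (by exact hyR),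
        smul_zero]
  have hint : IntegrableOn (fun y : ℝ => y ^ ((d : ℝ) - 1 - θ)) (Set.Ioo 0 R) :=
    (intervalIntegrable_iff_integrableOn_Ioo_of_le hR.le).mp
      (intervalIntegral.intervalIntegrable_rpow' (by linarith))
  rw [heq]
  constructor
  · rw [integrable_fun_norm_addHaar volume]
    refine IntegrableOn.congr_fun ?_ (fun y hy => (hfi y hy).symm) measurableSet_Ioi
    exact ((integrable_indicator_iff measurableSet_Ioo).mpr hint).integrableOn
  · rw [integral_fun_norm_addHaar volume, setIntegral_congr_fun measurableSet_Ioi hfi,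
      setIntegral_indicator measurableSet_Ioo, Set.inter_eq_right.mpr Set.Ioo_subset_Ioi_self,
      ← integral_Ioc_eq_integral_Ioo, ← intervalIntegral.integral_of_le hR.le,
      integral_rpow (Or.inl (by linarith)), Real.zero_rpow (by linarith)]
    rw [nsmul_eq_mul, smul_eq_mul, Measure.real, mul_assoc]
    rw [show (d : ℝ) - 1 - θ + 1 = d - θ by ring, sub_zero]

/-- Schur integral of the kernel of `T T*` over a slice. -/
theorem exists_kernel_integral_bound [Nontrivial W] (Cφ Cb : ℕ → ℝ) {ρ σ c₀ : ℝ} (r : ℝ)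
    (hρ₀ : 0 ≤ ρ) (hρ₁ : ρ ≤ 1) (hσ : 0 < σ) (hc₀ : 0 < c₀) : ∃ C : ℝ, 0 ≤ C ∧
    ∀ lam : ℝ, 1 ≤ lam → ∀ (s : W) (K : W → ℂ),
    (∀ s', s' ∈ Metric.closedBall (0 : W) r → s' ≠ s → K s' = 0 ∨ ∃ (F : V → ℝ) (b : V → ℂ),
      IsHomPhase Cφ F ∧ IsAnnularAmp Cb (lam ^ (1 - ρ)) b ∧
      (∀ η, b η ≠ 0 → c₀ * ‖s - s'‖ ≤ ‖fderiv ℝ F η‖) ∧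
      K s' = ∫ η, Complex.exp (Complex.I * ((lam * F η : ℝ) : ℂ)) * b η) →
    ∫ s' in Metric.closedBall (0 : W) r, ‖K s'‖
      ≤ C * lam ^ (-(ρ + min ρ (1 / 2) * (Module.finrank ℝ W - 1)) + σ) := by
  set d := Module.finrank ℝ W with hd
  have hd1 : 1 ≤ d := Module.finrank_pos
  have hd1' : (1 : ℝ) ≤ d := by exact_mod_cast hd1
  set μ : ℝ := min ρ (1 / 2) with hμ
  have hμ0 : 0 ≤ μ := le_min hρ₀ (by norm_num)
  have hμ2 : μ ≤ 1 / 2 := min_le_right _ _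
  -- Small enough that all losses in ε, at most (d + 3)ε in the exponent, fit into σ; also θ = 1 − ε
  -- is then strictly below 1.
  set ε : ℝ := min (1 / 2) (σ / (d + 3)) with hε
  have hε0 : 0 < ε := lt_min (by norm_num) (by positivity)
  have hε1 : ε ≤ 1 / 2 := min_le_left _ _
  have hεσ : ε * (d + 3) ≤ σ := by
    have : ε ≤ σ / (d + 3) := min_le_right _ _
    rwa [le_div_iff₀ (by positivity)] at this
  set θ : ℝ := 1 - ε with hθ
  set M : ℝ := ρ + μ * (d - 1) with hM
  obtain ⟨C, hC0, hC⟩ := exists_kernel_bound (V := V) Cφ Cb hρ₁ hε0 M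
  set U : ℝ := (volume (Metric.closedBall (0 : W) r)).toReal with hU
  set U1 : ℝ := d * (volume (Metric.ball (0 : W) 1)).toReal with hU1
  refine ⟨C * U + C * (c₀ ^ (-θ) * (U1 * (c₀ ^ (-(d - θ)) / (d - θ)))), ?_, ?_⟩
  · have : 0 < d - θ := by linarith
    positivity
  intro lam hlam s K hK
  have hl0 : 0 < lam := by linarith
  have hdθ : 0 < d - θ := by linarith
  -- Beyond this distance c₀|s − s'| exceeds the non-stationary threshold and only the negligible
  -- term remains.
  set R : ℝ := lam ^ (ε - μ) / c₀ with hR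
  have hR0 : 0 < R := by positivity
  obtain ⟨hi, hI⟩ := integral_ball_norm_rpow_neg (W := W) (θ := θ) (R := R) (by linarith) hR0
  set f : W → ℝ := fun x => (Metric.ball 0 R).indicator (fun x => ‖x‖ ^ (-θ)) x with hf
  set a : ℝ := (lam ^ (2 * ε - ρ)) ^ θ * c₀ ^ (-θ) with ha
  have ha0 : 0 ≤ a := by positivity
  have hf0 : ∀ x, 0 ≤ f x := fun x => Set.indicator_nonneg (fun _ _ => by positivity) _
  have hfi : Integrable fun s' => f (s - s') := hi.comp_sub_left s
  have hfI : ∫ s', f (s - s') = ∫ x, f x := integral_sub_left_eq_self f volume s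
  -- On the diagonal the gradient bound degenerates to 0; it is a null set because `W` is
  -- nontrivial.
  have hae : ∀ᵐ s' ∂(volume : Measure W), s' ≠ s := by
    simp [ae_iff]
  have hbound : ∀ᵐ s' ∂(volume.restrict (Metric.closedBall (0 : W) r)),
      ‖K s'‖ ≤ C * lam ^ (-M) + C * a * f (s - s') := by
    filter_upwards [ae_restrict_of_ae hae,
      ae_restrict_mem Metric.isClosed_closedBall.measurableSet] with s' hs' hmem
    have hf1 := hf0 (s - s')
    rcases hK s' hmem hs' with h0 | ⟨F, b, hF, hb, hg, hKe⟩
    · rw [h0, norm_zero]; positivity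
    · have hpos : 0 < ‖s - s'‖ := norm_pos_iff.mpr (sub_ne_zero.mpr hs'.symm)
      have key := hC lam (c₀ * ‖s - s'‖) θ hlam (by positivity) (by linarith) (by linarith) F hF b hb hg
      rw [← hKe] at key
      refine key.trans ?_
      rw [mul_add, mul_assoc]
      refine add_le_add_right (mul_le_mul_of_nonneg_left ?_ hC0) _
      split_ifs with hcase
      · have hlt : ‖s - s'‖ < R := by
          rw [hR, lt_div_iff₀ hc₀]; linarith
        have : f (s - s') = ‖s - s'‖ ^ (-θ) := by
          rw [hf]; exact Set.indicator_of_mem (by simpa using hlt) _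
        rw [this, ha, Real.div_rpow (by positivity) (by positivity),
          Real.mul_rpow hc₀.le hpos.le, Real.rpow_neg hc₀.le, Real.rpow_neg hpos.le]
        refine le_of_eq ?_
        field_simp
      · positivity
  have hic : IntegrableOn (fun _ : W => C * lam ^ (-M)) (Metric.closedBall (0 : W) r) :=
    integrableOn_const measure_closedBall_lt_top.ne
  have hif : IntegrableOn (fun s' : W => C * a * f (s - s')) (Metric.closedBall (0 : W) r) :=
    (hfi.const_mul _).integrableOn
  have hmono : ∫ s' in Metric.closedBall (0 : W) r, ‖K s'‖
      ≤ ∫ s' in Metric.closedBall (0 : W) r, (C * lam ^ (-M) + C * a * f (s - s')) := by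
    refine integral_mono_of_nonneg (Eventually.of_forall fun _ => norm_nonneg _) ?_ hbound
    exact hic.add hif
  refine hmono.trans ?_
  rw [integral_add hic hif, setIntegral_const, integral_const_mul, smul_eq_mul]
  have h1 : ∫ s' in Metric.closedBall (0 : W) r, f (s - s') ≤ ∫ x, f x := by
    rw [← hfI]
    exact setIntegral_le_integral hfi (Eventually.of_forall fun _ => hf0 _)
  have h2 : a * ∫ x, f x = (c₀ ^ (-θ) * (U1 * (c₀ ^ (-(d - θ)) / (d - θ))))
      * lam ^ ((2 * ε - ρ) * θ + (ε - μ) * (d - θ)) := by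
    rw [hI, ← hd, ← hU1, ha, hR, Real.div_rpow (by positivity) hc₀.le, ← Real.rpow_mul hl0.le,
      ← Real.rpow_mul hl0.le, Real.rpow_add hl0, Real.rpow_neg hc₀.le (d - θ)]
    field_simp
  have hexp : lam ^ ((2 * ε - ρ) * θ + (ε - μ) * (d - θ)) ≤ lam ^ (-M + σ) := by
    refine Real.rpow_le_rpow_of_exponent_le hlam ?_
    rw [hM, hθ]
    nlinarith
  have hexp2 : lam ^ (-M) ≤ lam ^ (-M + σ) :=
    Real.rpow_le_rpow_of_exponent_le hlam (by linarith)
  have hcc : 0 ≤ c₀ ^ (-θ) * (U1 * (c₀ ^ (-(d - θ)) / (d - θ))) := by positivity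
  calc U * (C * lam ^ (-M)) + C * a * ∫ s' in Metric.closedBall (0 : W) r, f (s - s')
      ≤ U * (C * lam ^ (-M)) + C * (a * ∫ x, f x) := by
        rw [mul_assoc]
        have := mul_le_mul_of_nonneg_left (mul_le_mul_of_nonneg_left h1 ha0) hC0
        linarith
    _ ≤ U * (C * lam ^ (-M + σ))
        + C * ((c₀ ^ (-θ) * (U1 * (c₀ ^ (-(d - θ)) / (d - θ)))) * lam ^ (-M + σ)) := by
        rw [h2]
        gcongr
    _ = _ := by ring

end Kernel

/-! ### Rescaled frequency pieces and their `L²` estimate on slices. -/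

section Slice

open ComplexConjugate

variable {n : ℕ}

/-- Pointwise symbol and phase bounds, valid on a set of spatial variables. -/
structure HasBoundsOn (X : Set (Rn n)) (m ρ : ℝ) (a : Rn n → Rn n → ℂ) (φ : Rn n → Rn n → ℝ)
    (Ca Cφ : ℕ → ℝ) : Prop where
  amp : ∀ x ∈ X, ∀ (j : ℕ) (ξ : Rn n),
    bracket ξ ^ (-m + ρ * (j : ℝ)) * ‖iteratedFDeriv ℝ j (a x) ξ‖ ≤ Ca j
  phase : ∀ x ∈ X, ∀ j : ℕ, 2 ≤ j → ∀ ξ : Rn n, ξ ≠ 0 →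
    ‖ξ‖ ^ (-1 + (j : ℝ)) * ‖iteratedFDeriv ℝ j (φ x) ξ‖ ≤ Cφ j

theorem HasBoundsOn.mono {X Y : Set (Rn n)} {m ρ : ℝ} {a : Rn n → Rn n → ℂ}
    {φ : Rn n → Rn n → ℝ} {Ca Cφ : ℕ → ℝ} (h : HasBoundsOn X m ρ a φ Ca Cφ) (hY : Y ⊆ X) :
    HasBoundsOn Y m ρ a φ Ca Cφ :=
  ⟨fun x hx => h.amp x (hY hx), fun x hx => h.phase x (hY hx)⟩

/-- A smooth real cutoff supported in an annulus. -/
structure IsAnnularCutoff (κ : Rn n → ℝ) : Prop where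
  smooth : ContDiff ℝ ∞ κ
  half_le : ∀ η : Rn n, κ η ≠ 0 → 1 / 2 ≤ ‖η‖
  le_two : ∀ η : Rn n, κ η ≠ 0 → ‖η‖ ≤ 2

theorem bracket_pos (ξ : Rn n) : 0 < bracket ξ := Real.sqrt_pos.mpr (by positivity)

/-- On the annulus ⟨λη⟩ lies between λ/3 and 3λ; the exponent may have either sign. -/
theorem bracket_rpow_le {lam p : ℝ} (hlam : 1 ≤ lam) {η : Rn n} (h1 : 1 / 2 ≤ ‖η‖)
    (h2 : ‖η‖ ≤ 2) : bracket (lam • η) ^ p ≤ 3 ^ |p| * lam ^ p := by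
  have hl0 : 0 < lam := by linarith
  have hn : ‖lam • η‖ = lam * ‖η‖ := by rw [norm_smul, Real.norm_of_nonneg hl0.le]
  have hb1 : lam / 3 ≤ bracket (lam • η) := by
    refine Real.le_sqrt_of_sq_le ?_
    rw [hn]; nlinarith [mul_le_mul_of_nonneg_left h1 hl0.le]
  have hb2 : bracket (lam • η) ≤ 3 * lam := by
    refine Real.sqrt_le_iff.mpr ⟨by positivity, ?_⟩
    rw [hn]
    have h3 : (lam * ‖η‖) ^ 2 ≤ (lam * 2) ^ 2 :=
      pow_le_pow_left₀ (by positivity) (mul_le_mul_of_nonneg_left h2 hl0.le) 2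
    nlinarith
  have hb0 := bracket_pos (lam • η)
  set t : ℝ := bracket (lam • η) / lam with ht
  have ht0 : 0 < t := by positivity
  have hbt : bracket (lam • η) = t * lam := by rw [ht]; field_simp
  rw [hbt, Real.mul_rpow ht0.le hl0.le]
  refine mul_le_mul_of_nonneg_right ?_ (by positivity)
  have ht3 : t ≤ 3 := by rw [ht, div_le_iff₀ hl0]; exact hb2
  have ht3' : 3⁻¹ ≤ t := by rw [ht, le_div_iff₀ hl0]; linarith
  rcases le_total 0 p with hp | hp
  · rw [abs_of_nonneg hp]
    exact Real.rpow_le_rpow ht0.le ht3 hp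
  · rw [abs_of_nonpos hp]
    calc t ^ p ≤ (3⁻¹ : ℝ) ^ p := Real.rpow_le_rpow_of_nonpos (by norm_num) ht3' hp
      _ = 3 ^ (-p) := by rw [Real.inv_rpow (by norm_num), Real.rpow_neg (by norm_num)]

theorem IsAnnularCutoff.tsupport_subset {κ : Rn n → ℝ} (hκ : IsAnnularCutoff κ) :
    ∀ η ∈ tsupport κ, 1 / 2 ≤ ‖η‖ ∧ ‖η‖ ≤ 2 := by
  have h1 : tsupport κ ⊆ {η : Rn n | 1 / 2 ≤ ‖η‖} :=
    closure_minimal (fun w hw => hκ.half_le w hw) (isClosed_le continuous_const continuous_norm)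
  have h2 : tsupport κ ⊆ {η : Rn n | ‖η‖ ≤ 2} :=
    closure_minimal (fun w hw => hκ.le_two w hw) (isClosed_le continuous_norm continuous_const)
  exact fun η hη => ⟨h1 hη, h2 hη⟩

theorem IsAnnularCutoff.exists_bound {κ : Rn n → ℝ} (hκ : IsAnnularCutoff κ) :
    ∃ C : ℕ → ℝ, ∀ j η, ‖iteratedFDeriv ℝ j κ η‖ ≤ C j := by
  have hs : HasCompactSupport κ :=
    HasCompactSupport.of_support_subset_isCompact (isCompact_closedBall 0 2)
      fun η hη => by simpa using hκ.le_two η hη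
  have : ∀ j, ∃ C, ∀ η, ‖iteratedFDeriv ℝ j κ η‖ ≤ C := fun j =>
    (hs.iteratedFDeriv j).exists_bound_of_continuous
      (hκ.smooth.continuous_iteratedFDeriv (m := j) (by exact_mod_cast le_top))
  choose C hC using this
  exact ⟨C, hC⟩

/-- The rescaled frequency localised amplitude. -/
theorem exists_annularAmp_of_rough {m ρ : ℝ} (hρ₁ : ρ ≤ 1) {a : Rn n → Rn n → ℂ}
    (hs : ∀ x, ContDiff ℝ ∞ (a x)) (Ca : ℕ → ℝ) {κ : Rn n → ℝ} (hκ : IsAnnularCutoff κ) :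
    ∃ Cb : ℕ → ℝ, ∀ lam : ℝ, 1 ≤ lam → ∀ x : Rn n, (∀ (j : ℕ) (ξ : Rn n),
      bracket ξ ^ (-m + ρ * (j : ℝ)) * ‖iteratedFDeriv ℝ j (a x) ξ‖ ≤ Ca j) →
      IsAnnularAmp Cb (lam ^ (1 - ρ))
        (fun η => ((lam ^ (-m) : ℝ) : ℂ) * a x (lam • η) * (κ η : ℂ)) := by
  obtain ⟨K, hK⟩ := hκ.exists_bound
  choose P hP1 hP using fun q => exists_one_le_bound (fun i => Ca i * 3 ^ |m - ρ * i|) q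
  choose Q hQ1 hQ using fun q => exists_one_le_bound K q
  refine ⟨fun q => 2 ^ q * (P q * Q q), ?_⟩
  intro lam hlam x hx
  have hl0 : 0 < lam := by linarith
  set Λ : ℝ := lam ^ (1 - ρ) with hΛ
  have hΛ1 : 1 ≤ Λ := Real.one_le_rpow hlam (by linarith)
  have hκC : ContDiff ℝ ∞ (fun η => (κ η : ℂ)) := Complex.ofRealCLM.contDiff.comp hκ.smooth
  set g : Rn n →L[ℝ] Rn n := lam • ContinuousLinearMap.id ℝ (Rn n) with hg
  have hgη : ∀ η, 0 + g η = lam • η := fun η => by rw [zero_add]; rfl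
  have hgn : ‖g‖ ≤ lam := by
    refine (norm_smul_le lam (ContinuousLinearMap.id ℝ (Rn n))).trans ?_
    rw [Real.norm_of_nonneg hl0.le]
    exact mul_le_of_le_one_right hl0.le ContinuousLinearMap.norm_id_le
  have hag : ContDiff ℝ ∞ (fun η => a x (0 + g η)) :=
    (hs x).comp (contDiff_const.add g.contDiff)
  set A : Rn n → ℂ := fun η => ((lam ^ (-m) : ℝ) : ℂ) * a x (0 + g η) with hA
  have hAs : ContDiff ℝ ∞ A := contDiff_const.mul hag
  have heq : (fun η => ((lam ^ (-m) : ℝ) : ℂ) * a x (lam • η) * (κ η : ℂ))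
      = fun η => A η * (κ η : ℂ) := by
    funext η
    simp only [hA, hgη]
  rw [heq]
  refine ⟨hAs.mul hκC, fun η hη => hκ.half_le η fun h0 => hη (by simp [h0]),
    fun η hη => hκ.le_two η fun h0 => hη (by simp [h0]), fun q η => ?_⟩
  -- The bracket is comparable to λ only on the annulus, so the symbol bounds are used only on the
  -- support of the cutoff.
  by_cases hη : η ∈ tsupport κ
  swap
  · have : η ∉ tsupport (fun η => A η * (κ η : ℂ)) := by
      intro h
      refine hη (closure_mono (fun y hy => ?_) h)
      intro h0
      exact hy (by simp [h0])
    rw [iteratedFDeriv_eq_zero_of_notMem_tsupport this, norm_zero]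
    have := hP1 q
    have := hQ1 q
    positivity
  obtain ⟨hη1, hη2⟩ := hκ.tsupport_subset η hη
  refine norm_iteratedFDeriv_mul_le_scale isOpen_univ hAs.contDiffOn hκC.contDiffOn
    (Set.mem_univ η) (fun i hi => ?_) (fun i hi => ?_)
  · have h1 : iteratedFDeriv ℝ i A η
        = ((lam ^ (-m) : ℝ) : ℂ) • iteratedFDeriv ℝ i (fun η => a x (0 + g η)) η := by
      refine (((lam ^ (-m) : ℝ) : ℂ) • (1 : ℂ →L[ℝ] ℂ)).iteratedFDeriv_comp_left (n := ∞)
        hag.contDiffAt (by exact_mod_cast le_top)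
    have h2 := norm_iteratedFDeriv_comp_affine_le isOpen_univ (hs x).contDiffOn 0 g
      (Set.mem_univ (0 + g η)) i
    rw [h1, norm_smul, Complex.norm_real, Real.norm_of_nonneg (by positivity)]
    rw [hgη] at h2
    have h3 := hx i (lam • η)
    have hb0 := bracket_pos (lam • η)
    have h4 : ‖iteratedFDeriv ℝ i (a x) (lam • η)‖ ≤ Ca i * bracket (lam • η) ^ (m - ρ * i) := by
      have : bracket (lam • η) ^ (m - ρ * i) * bracket (lam • η) ^ (-m + ρ * (i : ℝ)) = 1 := by
        rw [← Real.rpow_add hb0]; simp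
      calc ‖iteratedFDeriv ℝ i (a x) (lam • η)‖
          = bracket (lam • η) ^ (m - ρ * i) * (bracket (lam • η) ^ (-m + ρ * (i : ℝ))
            * ‖iteratedFDeriv ℝ i (a x) (lam • η)‖) := by rw [← mul_assoc, this, one_mul]
        _ ≤ bracket (lam • η) ^ (m - ρ * i) * Ca i :=
            mul_le_mul_of_nonneg_left h3 (by positivity)
        _ = _ := mul_comm _ _
    have hCa0 : 0 ≤ Ca i := le_trans (by positivity) h3
    calc lam ^ (-m) * ‖iteratedFDeriv ℝ i (fun η => a x (0 + g η)) η‖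
        ≤ lam ^ (-m) * ((Ca i * (3 ^ |m - ρ * i| * lam ^ (m - ρ * i))) * lam ^ i) := by
          refine mul_le_mul_of_nonneg_left (h2.trans ?_) (by positivity)
          refine mul_le_mul (h4.trans ?_) (pow_le_pow_left₀ (norm_nonneg _) hgn i)
            (by positivity) (by positivity)
          exact mul_le_mul_of_nonneg_left (bracket_rpow_le hlam hη1 hη2) hCa0
      _ = (Ca i * 3 ^ |m - ρ * i|) * (lam ^ (-m) * lam ^ (m - ρ * i) * lam ^ (i : ℝ)) := by
          rw [Real.rpow_natCast]; ring
      -- The powers combine as λ^(−m) λ^(m−ρi) λ^i = λ^((1−ρ)i).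
      _ = (Ca i * 3 ^ |m - ρ * i|) * Λ ^ i := by
          rw [← Real.rpow_add hl0, ← Real.rpow_add hl0, hΛ, ← Real.rpow_natCast,
            ← Real.rpow_mul hl0.le]
          congr 2
          ring
      _ ≤ P q * Λ ^ i := mul_le_mul_of_nonneg_right (hP q i hi) (by positivity)
  · rw [iteratedFDeriv_ofReal_norm hκ.smooth]
    refine (hK i η).trans ((hQ q i hi).trans ?_)
    exact le_mul_of_one_le_right (by have := hQ1 q; linarith) (one_le_pow₀ hΛ1)

theorem IsAnnularAmp.mul_conj {Cb : ℕ → ℝ} {Λ : ℝ} (hΛ : 0 ≤ Λ) {b b' : Rn n → ℂ}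
    (hb : IsAnnularAmp Cb Λ b) (hb' : IsAnnularAmp Cb Λ b') {D : ℕ → ℝ}
    (hD : ∀ q, 1 ≤ D q ∧ ∀ i ≤ q, Cb i ≤ D q) :
    IsAnnularAmp (fun q => 2 ^ q * (D q * D q)) Λ (fun η => b η * conj (b' η)) := by
  have hc : ContDiff ℝ ∞ (fun η => conj (b' η)) := Complex.conjCLE.contDiff.comp hb'.smooth
  refine ⟨hb.smooth.mul hc, fun η hη => hb.half_le η (left_ne_zero_of_mul hη),
    fun η hη => hb.le_two η (left_ne_zero_of_mul hη), fun q η => ?_⟩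
  refine norm_iteratedFDeriv_mul_le_scale isOpen_univ hb.smooth.contDiffOn hc.contDiffOn
    (Set.mem_univ η) (fun i hi => ?_) (fun i hi => ?_)
  · exact (hb.bound i η).trans (mul_le_mul_of_nonneg_right ((hD q).2 i hi) (by positivity))
  · have : ‖iteratedFDeriv ℝ i (fun η => conj (b' η)) η‖ = ‖iteratedFDeriv ℝ i b' η‖ :=
      Complex.conjLIE.norm_iteratedFDeriv_comp_left b' η i
    rw [this]
    exact (hb'.bound i η).trans (mul_le_mul_of_nonneg_right ((hD q).2 i hi) (by positivity))

/-- Differences of rough phases are homogeneous phases. -/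
theorem isHomPhase_sub {φ : Rn n → Rn n → ℝ} {l : ℕ} (hφ : IsRoughPhase l φ) {Cφ : ℕ → ℝ}
    {x y : Rn n}
    (hx : ∀ j : ℕ, 2 ≤ j → ∀ ξ : Rn n, ξ ≠ 0 →
      ‖ξ‖ ^ (-1 + (j : ℝ)) * ‖iteratedFDeriv ℝ j (φ x) ξ‖ ≤ Cφ j)
    (hy : ∀ j : ℕ, 2 ≤ j → ∀ ξ : Rn n, ξ ≠ 0 →
      ‖ξ‖ ^ (-1 + (j : ℝ)) * ‖iteratedFDeriv ℝ j (φ y) ξ‖ ≤ Cφ j) :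
    IsHomPhase (fun j => 2 * (Cφ j * 8 ^ (j - 1))) (fun η => φ x η - φ y η) where
  smooth := (hφ.smooth x).sub (hφ.smooth y)
  homogeneous η hη t ht := by
    rw [hφ.homogeneous x η hη t ht, hφ.homogeneous y η hη t ht]; ring
  bound j hj η h1 _ := by
    have hη0 : η ≠ 0 := by
      intro h0
      rw [h0, norm_zero] at h1
      norm_num at h1
    have hpos : 0 < ‖η‖ := norm_pos_iff.mpr hη0
    have key : ∀ z : Rn n, ‖η‖ ^ (-1 + (j : ℝ)) * ‖iteratedFDeriv ℝ j (φ z) η‖ ≤ Cφ j →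
        ‖iteratedFDeriv ℝ j (φ z) η‖ ≤ Cφ j * 8 ^ (j - 1) := by
      intro z hz
      have h2 : ‖η‖ ^ (-1 + (j : ℝ)) = ‖η‖ ^ (j - 1) := by
        rw [← Real.rpow_natCast, Nat.cast_sub (by omega)]
        congr 1
        push_cast
        ring
      rw [h2] at hz
      have h3 : 1 ≤ (8 * ‖η‖) ^ (j - 1) := one_le_pow₀ (by linarith)
      calc ‖iteratedFDeriv ℝ j (φ z) η‖
          ≤ (8 * ‖η‖) ^ (j - 1) * ‖iteratedFDeriv ℝ j (φ z) η‖ :=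
            le_mul_of_one_le_left (norm_nonneg _) h3
        _ = (‖η‖ ^ (j - 1) * ‖iteratedFDeriv ℝ j (φ z) η‖) * 8 ^ (j - 1) := by
            rw [mul_pow]; ring
        _ ≤ _ := mul_le_mul_of_nonneg_right hz (by positivity)
    have hcd : ∀ z, ContDiffAt ℝ j (φ z) η := fun z =>
      ((hφ.smooth z).contDiffAt (isOpen_compl_singleton.mem_nhds hη0)).of_le
        (by exact_mod_cast le_top)
    rw [fun_iteratedFDeriv_sub_apply (hcd x) (hcd y)]
    refine (norm_sub_le _ _).trans ?_
    have h4 := key x (hx j hj η hη0)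
    have h5 := key y (hy j hj η hη0)
    linarith

/-- The kernel, in frequency variables, of a frequency localised piece of the operator. -/
def pieceKernel (X : Set (Rn n)) (a : Rn n → Rn n → ℂ) (φ : Rn n → Rn n → ℝ) (κ : Rn n → ℝ)
    (lam : ℝ) (x ξ : Rn n) : ℂ :=
  X.indicator (fun x => Complex.exp (Complex.I * (φ x ξ : ℂ)) * a x ξ) x * (κ (lam⁻¹ • ξ) : ℂ)

variable {W : Type*} [NormedAddCommGroup W] [InnerProductSpace ℝ W] [FiniteDimensional ℝ W]
  [MeasurableSpace W] [BorelSpace W]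

set_option maxHeartbeats 1000000 in
/-- The `L²` estimate on slices parallel to a subspace on which the gradient of the phase separates
points. -/
theorem exists_slice_bound [Nontrivial W] {m ρ : ℝ} (hρ₀ : 0 ≤ ρ) (hρ₁ : ρ ≤ 1)
    {a : Rn n → Rn n → ℂ} (hs : ∀ x, ContDiff ℝ ∞ (a x)) {φ : Rn n → Rn n → ℝ} {l : ℕ}
    (hφ : IsRoughPhase l φ) {X : Set (Rn n)} {Ca Cφ : ℕ → ℝ} (hX : HasBoundsOn X m ρ a φ Ca Cφ)
    {κ : Rn n → ℝ} (hκ : IsAnnularCutoff κ) (ι : W →ₗᵢ[ℝ] Rn n) {c₀ : ℝ} (hc₀ : 0 < c₀)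
    (hlow : ∀ x ∈ X, ∀ y ∈ X, a x ≠ 0 → a y ≠ 0 → x - y ∈ Set.range ι → ∀ η, κ η ≠ 0 →
      c₀ * ‖x - y‖ ≤ ‖fderiv ℝ (φ x) η - fderiv ℝ (φ y) η‖)
    (hmeas : ∀ lam : ℝ, StronglyMeasurable (Function.uncurry (pieceKernel X a φ κ lam)))
    {σ : ℝ} (hσ : 0 < σ) (r : ℝ) : ∃ C : ℝ, 0 ≤ C ∧ ∀ lam : ℝ, 1 ≤ lam →
    ∀ (x₀ : Rn n) (v : Rn n → ℂ), MemLp v 2 →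
    IntegrableOn (fun s => ‖∫ ξ, pieceKernel X a φ κ lam (x₀ + ι s) ξ * v ξ‖ ^ 2)
      (Metric.closedBall (0 : W) r) ∧
    ∫ s in Metric.closedBall (0 : W) r, ‖∫ ξ, pieceKernel X a φ κ lam (x₀ + ι s) ξ * v ξ‖ ^ 2
      ≤ C * lam ^ (n + 2 * m - (ρ + min ρ (1 / 2) * (Module.finrank ℝ W - 1)) + σ)
        * ∫ ξ, ‖v ξ‖ ^ 2 := by
  obtain ⟨Cb, hCb⟩ := exists_annularAmp_of_rough hρ₁ hs (m := m) (ρ := ρ) Ca hκ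
  choose D hD1 hD using fun q => exists_one_le_bound Cb q
  obtain ⟨C, hC0, hC⟩ := exists_kernel_integral_bound (V := Rn n) (W := W)
    (fun j => 2 * (Cφ j * 8 ^ (j - 1))) (fun q => 2 ^ q * (D q * D q)) r hρ₀ hρ₁ hσ hc₀
  -- Schur's test requires a strictly positive constant.
  refine ⟨C + 1, by positivity, ?_⟩
  intro lam hlam x₀ v hv
  have hl0 : 0 < lam := by linarith
  set Λ : ℝ := lam ^ (1 - ρ) with hΛ
  set e : ℝ := -(ρ + min ρ (1 / 2) * (Module.finrank ℝ W - 1)) + σ with he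
  set k := pieceKernel X a φ κ lam with hk
  set A : Rn n → Rn n → ℂ := fun x η => ((lam ^ (-m) : ℝ) : ℂ) * a x (lam • η) * (κ η : ℂ) with hA
  have hkA : ∀ x ∈ X, ∀ η, k x (lam • η)
      = Complex.exp (Complex.I * ((φ x (lam • η) : ℝ) : ℂ)) * (((lam ^ m : ℝ) : ℂ) * A x η) := by
    intro x hx η
    simp only [hk, pieceKernel, Set.indicator_of_mem hx, hA, inv_smul_smul₀ hl0.ne']
    have : ((lam ^ m : ℝ) : ℂ) * ((lam ^ (-m) : ℝ) : ℂ) = 1 := by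
      rw [← Complex.ofReal_mul, ← Real.rpow_add hl0]; simp
    linear_combination -(Complex.exp (Complex.I * ((φ x (lam • η) : ℝ) : ℂ)) * a x (lam • η)
      * (κ η : ℂ)) * this
  have hk0 : ∀ x ∉ X, ∀ ξ, k x ξ = 0 := by
    intro x hx ξ
    simp [hk, pieceKernel, Set.indicator_of_notMem hx]
  have hkb : ∀ x ξ, ‖k x ξ‖ ≤ lam ^ m * D 0 := by
    intro x ξ
    by_cases hx : x ∈ X
    · have h1 := hkA x hx (lam⁻¹ • ξ)
      rw [smul_inv_smul₀ hl0.ne'] at h1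
      rw [h1, norm_mul, norm_cexp_I_mul_ofReal, one_mul, norm_mul, Complex.norm_real,
        Real.norm_of_nonneg (by positivity)]
      refine mul_le_mul_of_nonneg_left ?_ (by positivity)
      have h2 := (hCb lam hlam x (hX.amp x hx)).bound 0 (lam⁻¹ • ξ)
      rw [norm_iteratedFDeriv_zero, pow_zero, mul_one] at h2
      exact h2.trans (hD 0 0 le_rfl)
    · rw [hk0 x hx, norm_zero]
      have := hD1 0
      positivity
  set Y : Set (Rn n) := Metric.closedBall 0 (2 * lam) with hY
  have hkY : ∀ x ξ, ξ ∉ Y → k x ξ = 0 := by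
    intro x ξ hξ
    have : κ (lam⁻¹ • ξ) = 0 := by
      by_contra hne
      have h1 := hκ.le_two _ hne
      rw [norm_smul, norm_inv, Real.norm_of_nonneg hl0.le, inv_mul_le_iff₀ hl0] at h1
      exact hξ (by rw [hY, mem_closedBall_zero_iff]; linarith)
    simp [hk, pieceKernel, this]
  have : IsFiniteMeasure (volume.restrict Y) :=
    ⟨by rw [Measure.restrict_apply_univ]; exact measure_closedBall_lt_top⟩
  have : IsFiniteMeasure (volume.restrict (Metric.closedBall (0 : W) r)) :=
    ⟨by rw [Measure.restrict_apply_univ]; exact measure_closedBall_lt_top⟩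
  have hrestr : ∀ f : Rn n → ℂ, (∀ ξ, ξ ∉ Y → f ξ = 0) → ∫ ξ in Y, f ξ = ∫ ξ, f ξ :=
    fun f hf => setIntegral_eq_integral_of_forall_compl_eq_zero hf
  -- the kernel of `T T*`
  have hGK : ∀ x y, x ∈ X → y ∈ X → ∫ ξ, k x ξ * conj (k y ξ)
      = ((lam ^ (n + 2 * m) : ℝ) : ℂ) * ∫ η, Complex.exp
        (Complex.I * ((lam * (φ x η - φ y η) : ℝ) : ℂ)) * (A x η * conj (A y η)) := by
    intro x y hx hy
    have h1 := Measure.integral_comp_smul (volume : Measure (Rn n))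
      (fun ξ => k x ξ * conj (k y ξ)) lam
    rw [finrank_euclideanSpace_fin, abs_of_nonneg (by positivity), eq_inv_smul_iff₀
      (by positivity)] at h1
    rw [← h1, Complex.real_smul, ← integral_const_mul, ← integral_const_mul]
    refine integral_congr_ae (Eventually.of_forall fun η => ?_)
    simp only
    by_cases hη : κ η = 0
    · have : A x η = 0 := by simp [hA, hη]
      rw [hkA x hx, this]
      simp
    have hη0 : η ≠ 0 := by
      intro h0
      have := hκ.half_le η hη
      rw [h0, norm_zero] at this
      norm_num at this
    rw [hkA x hx, hkA y hy, hφ.homogeneous x η hη0 lam hl0, hφ.homogeneous y η hη0 lam hl0]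
    have hexp : Complex.exp (Complex.I * ((lam * φ x η : ℝ) : ℂ))
        * conj (Complex.exp (Complex.I * ((lam * φ y η : ℝ) : ℂ)))
        = Complex.exp (Complex.I * ((lam * (φ x η - φ y η) : ℝ) : ℂ)) := by
      rw [← Complex.exp_conj, ← Complex.exp_add]
      congr 1
      simp only [map_mul, Complex.conj_I, Complex.conj_ofReal]
      push_cast
      ring
    have hpow : ((lam ^ (n + 2 * m) : ℝ) : ℂ)
        = ((lam ^ n : ℝ) : ℂ) * (((lam ^ m : ℝ) : ℂ) * ((lam ^ m : ℝ) : ℂ)) := by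
      rw [← Complex.ofReal_mul, ← Complex.ofReal_mul, ← Real.rpow_natCast, ← Real.rpow_add hl0,
        ← Real.rpow_add hl0]
      congr 2
      ring
    rw [← hexp, hpow]
    simp only [map_mul, Complex.conj_ofReal]
    ring
  have hG : ∀ s : W, ∫ s' in Metric.closedBall (0 : W) r,
      ‖∫ ξ in Y, k (x₀ + ι s) ξ * conj (k (x₀ + ι s') ξ)‖ ≤ (C + 1) * lam ^ (n + 2 * m + e) := by
    intro s
    set K : W → ℂ := fun s' => ((lam ^ (-(n + 2 * m)) : ℝ) : ℂ)
      * ∫ ξ, k (x₀ + ι s) ξ * conj (k (x₀ + ι s') ξ) with hKdef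
    have hKb := hC lam hlam s K (fun s' _ _ => by
      -- A nonzero kernel value forces both points into `X` with nonvanishing amplitude, which is
      -- what the gradient separation `hlow` requires.
      by_cases hzero : (∫ ξ, k (x₀ + ι s) ξ * conj (k (x₀ + ι s') ξ)) = 0
      · exact Or.inl (by rw [hKdef]; simp only [hzero, mul_zero])
      right
      have hxX : x₀ + ι s ∈ X := by
        by_contra hx
        exact hzero (by simp [hk0 _ hx])
      have hyX : x₀ + ι s' ∈ X := by
        by_contra hx
        exact hzero (by simp [hk0 _ hx])
      have hxa : a (x₀ + ι s) ≠ 0 := by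
        intro h0
        refine hzero ?_
        have : ∀ ξ, k (x₀ + ι s) ξ = 0 := fun ξ => by
          simp [hk, pieceKernel, Set.indicator_of_mem hxX, h0]
        simp [this]
      have hya : a (x₀ + ι s') ≠ 0 := by
        intro h0
        refine hzero ?_
        have : ∀ ξ, k (x₀ + ι s') ξ = 0 := fun ξ => by
          simp [hk, pieceKernel, Set.indicator_of_mem hyX, h0]
        simp [this]
      refine ⟨fun η => φ (x₀ + ι s) η - φ (x₀ + ι s') η,
        fun η => A (x₀ + ι s) η * conj (A (x₀ + ι s') η),
        isHomPhase_sub hφ (hX.phase _ hxX) (hX.phase _ hyX),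
        (hCb lam hlam _ (hX.amp _ hxX)).mul_conj (by positivity) (hCb lam hlam _ (hX.amp _ hyX))
          (fun q => ⟨hD1 q, hD q⟩), fun η hη => ?_, ?_⟩
      · have hκη : κ η ≠ 0 := fun h0 => hη (by simp [hA, h0])
        have hη0 : η ≠ 0 := by
          intro h0
          have := hκ.half_le η hκη
          rw [h0, norm_zero] at this
          norm_num at this
        have hd : ∀ z, DifferentiableAt ℝ (φ z) η := fun z =>
          ((hφ.smooth z).contDiffAt (isOpen_compl_singleton.mem_nhds hη0)).differentiableAt
            (by simp)
        have hdiff : x₀ + ι s - (x₀ + ι s') = ι (s - s') := by rw [map_sub]; abel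
        have := hlow _ hxX _ hyX hxa hya ⟨s - s', hdiff.symm⟩ η hκη
        rw [hdiff, ι.norm_map] at this
        rw [fderiv_fun_sub (hd _) (hd _)]
        exact this
      · rw [hKdef]
        simp only
        rw [hGK _ _ hxX hyX, ← mul_assoc, ← Complex.ofReal_mul, ← Real.rpow_add hl0]
        simp)
    have hnorm : ∀ s', ‖∫ ξ in Y, k (x₀ + ι s) ξ * conj (k (x₀ + ι s') ξ)‖
        = lam ^ (n + 2 * m) * ‖K s'‖ := by
      intro s'
      rw [hrestr _ (fun ξ hξ => by rw [hkY _ ξ hξ, zero_mul]), hKdef]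
      simp only
      rw [norm_mul, Complex.norm_real, Real.norm_of_nonneg (by positivity), ← mul_assoc,
        ← Real.rpow_add hl0]
      simp
    simp_rw [hnorm]
    rw [integral_const_mul, Real.rpow_add hl0 _ e]
    calc lam ^ (n + 2 * m) * ∫ s' in Metric.closedBall (0 : W) r, ‖K s'‖
        ≤ lam ^ (n + 2 * m) * (C * lam ^ e) := mul_le_mul_of_nonneg_left hKb (by positivity)
      _ ≤ (C + 1) * (lam ^ (n + 2 * m) * lam ^ e) := by
          have : 0 < lam ^ (n + 2 * m) * lam ^ e := by positivity
          nlinarith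
  have hkι : StronglyMeasurable (Function.uncurry fun (s : W) ξ => k (x₀ + ι s) ξ) := by
    have h1 : Measurable fun p : W × Rn n => (x₀ + ι p.1, p.2) :=
      ((ι.continuous.measurable.comp measurable_fst).const_add x₀).prodMk measurable_snd
    have h2 : StronglyMeasurable fun p : Rn n × Rn n => k p.1 p.2 := hmeas lam
    exact h2.comp_measurable (g := fun p : W × Rn n => (x₀ + ι p.1, p.2)) h1
  have key := integral_norm_sq_le_of_schur (volume.restrict (Metric.closedBall (0 : W) r))
    (volume.restrict Y) hkι (fun s ξ => hkb _ ξ)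
    (B := (C + 1) * lam ^ (n + 2 * m + e)) (by positivity) hG (hv.restrict Y)
  have hT : ∀ s : W, ∫ ξ in Y, k (x₀ + ι s) ξ * v ξ = ∫ ξ, k (x₀ + ι s) ξ * v ξ := fun s =>
    hrestr _ fun ξ hξ => by rw [hkY _ ξ hξ, zero_mul]
  simp_rw [hT] at key
  refine ⟨key.1, key.2.trans ?_⟩
  rw [show (n : ℝ) + 2 * m - (ρ + min ρ (1 / 2) * (Module.finrank ℝ W - 1)) + σ
    = n + 2 * m + e by rw [he]; ring]
  refine mul_le_mul_of_nonneg_left ?_ (by positivity)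
  exact setIntegral_le_integral hv.norm.integrable_sq (Eventually.of_forall fun ξ => by positivity)

end Slice

/-! ### Removing null sets and joint measurability. -/

section GoodSet

variable {n : ℕ}

/-- A measurable set of spatial variables on which all bounds hold and on which the amplitude and
the phase are measurable. -/
structure IsGoodSet (G : Set (Rn n)) (m ρ : ℝ) (a : Rn n → Rn n → ℂ) (φ : Rn n → Rn n → ℝ)
    (Ca Cφ : ℕ → ℝ) : Prop where
  measurableSet : MeasurableSet G
  conull : ∀ᵐ x, x ∈ G
  bounds : HasBoundsOn G m ρ a φ Ca Cφ
  measurable_amp : ∀ ξ, Measurable (G.indicator fun x => a x ξ)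
  measurable_phase : ∀ ξ, ξ ≠ 0 → Measurable (G.indicator fun x => φ x ξ)

theorem le_of_dense_of_continuousAt {f : Rn n → ℝ} {C : ℝ} {q : ℕ → Rn n} (hq : DenseRange q)
    {s : Set (Rn n)} (hs : IsOpen s) (hf : ∀ ξ ∈ s, ContinuousAt f ξ)
    (h : ∀ i, q i ∈ s → f (q i) ≤ C) : ∀ ξ ∈ s, f ξ ≤ C := by
  intro ξ hξ
  by_contra hcon
  push Not at hcon
  have h1 : ∀ᶠ y in nhds ξ, C < f y ∧ y ∈ s :=
    ((hf ξ hξ).eventually (lt_mem_nhds hcon)).and (hs.mem_nhds hξ)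
  obtain ⟨i, hi⟩ := hq.exists_mem_open (isOpen_interior (s := {y | C < f y ∧ y ∈ s}))
    ⟨ξ, mem_interior_iff_mem_nhds.mpr h1⟩
  have h2 := interior_subset hi
  exact absurd (h i h2.2) (not_le.mpr h2.1)

theorem continuous_bracket : Continuous (bracket (n := n)) :=
  Real.continuous_sqrt.comp (by fun_prop)

/-- The exceptional null sets in the hypotheses depend on ξ. Imposing the countably many conditions
at a dense sequence of ξ loses only one null set; smoothness in ξ extends the bounds to all ξ, and
limits along the sequence give measurability in x. -/
theorem exists_isGoodSet {m ρ : ℝ} {a : Rn n → Rn n → ℂ} (ha : IsRoughAmplitude m ρ a)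
    {φ : Rn n → Rn n → ℝ} (hφ : IsRoughPhase 2 φ) :
    ∃ (G : Set (Rn n)) (Ca Cφ : ℕ → ℝ), IsGoodSet G m ρ a φ Ca Cφ := by
  choose Ca hCa using ha.bound
  have hφb : ∀ j : ℕ, ∃ C : ℝ, 2 ≤ j → ∀ ξ : Rn n, ξ ≠ 0 → ∀ᵐ x : Rn n,
      ‖ξ‖ ^ (-1 + (j : ℝ)) * ‖iteratedFDeriv ℝ j (φ x) ξ‖ ≤ C := by
    intro j
    by_cases hj : 2 ≤ j
    · obtain ⟨C, hC⟩ := hφ.bound j hj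
      exact ⟨C, fun _ => hC⟩
    · exact ⟨0, fun h => absurd h hj⟩
  choose Cφ hCφ using hφb
  set q : ℕ → Rn n := TopologicalSpace.denseSeq (Rn n) with hq
  have hqd : DenseRange q := TopologicalSpace.denseRange_denseSeq (Rn n)
  set P : Rn n → Prop := fun x =>
    (∀ (j i : ℕ), bracket (q i) ^ (-m + ρ * (j : ℝ)) * ‖iteratedFDeriv ℝ j (a x) (q i)‖ ≤ Ca j) ∧
    (∀ (j i : ℕ), 2 ≤ j → q i ≠ 0 →
      ‖q i‖ ^ (-1 + (j : ℝ)) * ‖iteratedFDeriv ℝ j (φ x) (q i)‖ ≤ Cφ j) ∧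
    (∀ i, a x (q i) = (ha.measurable (q i)).mk _ x) ∧
    (∀ i (hi : q i ≠ 0), φ x (q i) = (hφ.measurable (q i) hi).mk _ x) with hP
  have hPae : ∀ᵐ x, P x := by
    refine Eventually.and ?_ (Eventually.and ?_ (Eventually.and ?_ ?_))
    · rw [ae_all_iff]; intro j; rw [ae_all_iff]; intro i
      exact hCa j (q i)
    · rw [ae_all_iff]; intro j; rw [ae_all_iff]; intro i
      by_cases hj : 2 ≤ j
      · by_cases hi : q i ≠ 0
        · filter_upwards [hCφ j hj (q i) hi] with x hx _ _ using hx
        · exact Eventually.of_forall fun x _ h => absurd h hi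
      · exact Eventually.of_forall fun x h => absurd h hj
    · rw [ae_all_iff]; intro i
      exact (ha.measurable (q i)).ae_eq_mk
    · rw [ae_all_iff]; intro i
      by_cases hi : q i ≠ 0
      · filter_upwards [(hφ.measurable (q i) hi).ae_eq_mk] with x hx _ using hx
      · exact Eventually.of_forall fun x h => absurd h hi
  obtain ⟨t, htP, htm, ht0⟩ := exists_measurable_superset_of_null (ae_iff.mp hPae)
  have hGP : ∀ x ∈ tᶜ, P x := fun x hx => by
    by_contra h
    exact hx (htP h)
  have hlim : ∀ ξ : Rn n, ∃ u : ℕ → ℕ, Tendsto (fun k => q (u k)) atTop (nhds ξ) := by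
    intro ξ
    obtain ⟨x, hx, hlim⟩ := mem_closure_iff_seq_limit.mp (hqd ξ)
    choose u hu using hx
    exact ⟨u, by simpa [hu] using hlim⟩
  refine ⟨tᶜ, Ca, Cφ, htm.compl, ?_, ⟨?_, ?_⟩, ?_, ?_⟩
  · rw [ae_iff]; simpa using ht0
  · intro x hx j ξ
    refine le_of_dense_of_continuousAt (f := fun ξ => bracket ξ ^ (-m + ρ * (j : ℝ))
      * ‖iteratedFDeriv ℝ j (a x) ξ‖) hqd isOpen_univ (fun ξ _ => ?_)
      (fun i _ => (hGP x hx).1 j i) ξ (Set.mem_univ _)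
    have h1 : Continuous (iteratedFDeriv ℝ j (a x)) :=
      (ha.smooth x).continuous_iteratedFDeriv (by exact_mod_cast le_top)
    exact (continuous_bracket.continuousAt.rpow_const (Or.inl (bracket_pos ξ).ne')).mul
      h1.norm.continuousAt
  · intro x hx j hj ξ hξ
    refine le_of_dense_of_continuousAt (f := fun ξ => ‖ξ‖ ^ (-1 + (j : ℝ))
      * ‖iteratedFDeriv ℝ j (φ x) ξ‖) hqd isOpen_compl_singleton (fun ξ hξ => ?_)
      (fun i hi => (hGP x hx).2.1 j i hj hi) ξ hξ
    have h1 : ContDiffAt ℝ ∞ (φ x) ξ :=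
      (hφ.smooth x).contDiffAt (isOpen_compl_singleton.mem_nhds hξ)
    have h2 : ContinuousAt (iteratedFDeriv ℝ j (φ x)) ξ :=
      (h1.differentiableAt_iteratedFDeriv (by exact_mod_cast ENat.natCast_lt_top j)).continuousAt
    exact (continuous_norm.continuousAt.rpow_const (Or.inl (norm_ne_zero_iff.mpr hξ))).mul h2.norm
  · have hqm : ∀ i, Measurable (tᶜ.indicator fun x => a x (q i)) := by
      intro i
      have : tᶜ.indicator (fun x => a x (q i)) = tᶜ.indicator ((ha.measurable (q i)).mk _) :=
        Set.indicator_congr fun x hx => (hGP x hx).2.2.1 i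
      rw [this]
      exact (ha.measurable (q i)).measurable_mk.indicator htm.compl
    intro ξ
    obtain ⟨u, hu⟩ := hlim ξ
    refine measurable_of_tendsto_metrizable (fun k => hqm (u k)) (tendsto_pi_nhds.mpr fun x => ?_)
    by_cases hx : x ∈ tᶜ
    · simp only [Set.indicator_of_mem hx]
      exact ((ha.smooth x).continuous.tendsto ξ).comp hu
    · simp only [Set.indicator_of_notMem hx]
      exact tendsto_const_nhds
  · intro ξ hξ
    obtain ⟨u, hu⟩ := hlim ξ
    -- The phase is measurable only at nonzero frequencies, so the approximating sequence is shifted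
    -- past its possible zeros.
    have hne : ∀ᶠ k in atTop, q (u k) ≠ 0 := hu.eventually (isOpen_ne.mem_nhds hξ)
    obtain ⟨k₀, hk₀⟩ := eventually_atTop.mp hne
    have hqm : ∀ k, Measurable (tᶜ.indicator fun x => φ x (q (u (k + k₀)))) := by
      intro k
      have hk := hk₀ (k + k₀) (by omega)
      have : tᶜ.indicator (fun x => φ x (q (u (k + k₀))))
          = tᶜ.indicator ((hφ.measurable _ hk).mk _) :=
        Set.indicator_congr fun x hx => (hGP x hx).2.2.2 _ hk
      rw [this]
      exact (hφ.measurable _ hk).measurable_mk.indicator htm.compl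
    refine measurable_of_tendsto_metrizable hqm (tendsto_pi_nhds.mpr fun x => ?_)
    by_cases hx : x ∈ tᶜ
    · simp only [Set.indicator_of_mem hx]
      have h1 : ContinuousAt (φ x) ξ :=
        ((hφ.smooth x).contDiffAt (isOpen_compl_singleton.mem_nhds hξ)).continuousAt
      exact h1.tendsto.comp (hu.comp (tendsto_add_atTop_nat k₀))
    · simp only [Set.indicator_of_notMem hx]
      exact tendsto_const_nhds

/-- The phase may be singular at ξ = 0, but the support of the annular cutoff avoids the origin. -/
theorem continuous_pieceKernel {a : Rn n → Rn n → ℂ} (ha : ∀ x, ContDiff ℝ ∞ (a x))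
    {φ : Rn n → Rn n → ℝ} (hφ : ∀ x, ContDiffOn ℝ ∞ (φ x) {0}ᶜ) (X : Set (Rn n))
    {κ : Rn n → ℝ} (hκ : IsAnnularCutoff κ) (lam : ℝ) (x : Rn n) :
    Continuous (pieceKernel X a φ κ lam x) := by
  unfold pieceKernel
  by_cases hx : x ∈ X
  swap
  · simp only [Set.indicator_of_notMem hx, zero_mul]
    exact continuous_const
  simp only [Set.indicator_of_mem hx]
  have hκs : ContDiff ℝ ∞ (fun ξ : Rn n => (κ (lam⁻¹ • ξ) : ℂ)) :=
    Complex.ofRealCLM.contDiff.comp (hκ.smooth.comp (contDiff_const_smul _))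
  refine (contDiff_mul_of_tsupport_subset (s := {0}ᶜ) isOpen_compl_singleton ?_ hκs ?_).continuous
  · have := contDiffOn_cexp_mul (hφ x) 1
    simp only [one_mul] at this
    exact this.mul (ha x).contDiffOn
  · have hcl : tsupport (fun ξ : Rn n => (κ (lam⁻¹ • ξ) : ℂ))
        ⊆ {ξ : Rn n | 1 / 2 ≤ ‖lam⁻¹ • ξ‖} := by
      refine closure_minimal (fun ξ hξ => hκ.half_le _ fun h0 => hξ (by simp [h0])) ?_
      exact isClosed_le continuous_const (continuous_const_smul _).norm
    intro ξ hξ h0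
    have : (1 : ℝ) / 2 ≤ ‖lam⁻¹ • ξ‖ := hcl hξ
    rw [Set.mem_singleton_iff.mp h0, smul_zero, norm_zero] at this
    norm_num at this

/-- A Carathéodory function, continuous in ξ and measurable in x, is jointly measurable. -/
theorem stronglyMeasurable_pieceKernel {m ρ : ℝ} {a : Rn n → Rn n → ℂ}
    (ha : ∀ x, ContDiff ℝ ∞ (a x)) {φ : Rn n → Rn n → ℝ} (hφ : ∀ x, ContDiffOn ℝ ∞ (φ x) {0}ᶜ)
    {G : Set (Rn n)} {Ca Cφ : ℕ → ℝ} (hG : IsGoodSet G m ρ a φ Ca Cφ) {X : Set (Rn n)}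
    (hX : MeasurableSet X) (hXG : X ⊆ G) {κ : Rn n → ℝ} (hκ : IsAnnularCutoff κ) (lam : ℝ) :
    StronglyMeasurable (Function.uncurry (pieceKernel X a φ κ lam)) := by
  have hzero : ∀ ξ : Rn n, κ (lam⁻¹ • ξ) ≠ 0 → ξ ≠ 0 := by
    intro ξ hξ h0
    have := hκ.half_le _ hξ
    rw [h0, smul_zero, norm_zero] at this
    norm_num at this
  have h1 : StronglyMeasurable (Function.uncurry fun ξ x => pieceKernel X a φ κ lam x ξ) := by
    refine stronglyMeasurable_uncurry_of_continuous_of_stronglyMeasurable (fun x => ?_) fun ξ => ?_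
    · exact continuous_pieceKernel ha hφ X hκ lam x
    · by_cases hκξ : κ (lam⁻¹ • ξ) = 0
      · simp only [pieceKernel, hκξ, Complex.ofReal_zero, mul_zero]
        exact stronglyMeasurable_const
      have hm : Measurable fun x => X.indicator (fun x => Complex.exp (Complex.I *
          ((G.indicator (fun x => φ x ξ) x : ℝ) : ℂ)) * G.indicator (fun x => a x ξ) x) x := by
        refine Measurable.indicator ?_ hX
        have h2 := hG.measurable_phase ξ (hzero ξ hκξ)
        exact (Complex.measurable_exp.comp ((Complex.measurable_ofReal.comp h2).const_mul _)).mul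
          (hG.measurable_amp ξ)
      have heq : (fun x => pieceKernel X a φ κ lam x ξ) = fun x =>
          X.indicator (fun x => Complex.exp (Complex.I *
          ((G.indicator (fun x => φ x ξ) x : ℝ) : ℂ)) * G.indicator (fun x => a x ξ) x) x
          * (κ (lam⁻¹ • ξ) : ℂ) := by
        funext x
        simp only [pieceKernel]
        congr 1
        refine congrFun (Set.indicator_congr fun x hx => ?_) x
        simp only [Set.indicator_of_mem (hXG hx)]
      rw [heq]
      exact (hm.mul_const (κ (lam⁻¹ • ξ) : ℂ)).stronglyMeasurable
  have h2 : StronglyMeasurable fun p : Rn n × Rn n => pieceKernel X a φ κ lam p.2 p.1 := h1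
  have h3 : StronglyMeasurable fun p : Rn n × Rn n => pieceKernel X a φ κ lam p.1 p.2 :=
    h2.comp_measurable (g := fun p : Rn n × Rn n => (p.2, p.1)) measurable_swap
  exact h3

end GoodSet

/-! ### From slices to balls in space. -/

section Local

variable {n : ℕ}

theorem hasCompactSupport_pieceKernel (X : Set (Rn n)) (a : Rn n → Rn n → ℂ)
    (φ : Rn n → Rn n → ℝ) {κ : Rn n → ℝ} (hκ : IsAnnularCutoff κ) {lam : ℝ} (hlam : 0 < lam)
    (x : Rn n) : HasCompactSupport (pieceKernel X a φ κ lam x) := by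
  refine HasCompactSupport.of_support_subset_isCompact (isCompact_closedBall 0 (2 * lam))
    fun ξ hξ => ?_
  have h0 : κ (lam⁻¹ • ξ) ≠ 0 := fun h0 => hξ (by simp [pieceKernel, h0])
  have h1 := hκ.le_two _ h0
  rw [norm_smul, norm_inv, Real.norm_of_nonneg hlam.le, inv_mul_le_iff₀ hlam] at h1
  rw [mem_closedBall_zero_iff]
  linarith

theorem integrable_pieceKernel_mul {a : Rn n → Rn n → ℂ} (ha : ∀ x, ContDiff ℝ ∞ (a x))
    {φ : Rn n → Rn n → ℝ} (hφ : ∀ x, ContDiffOn ℝ ∞ (φ x) {0}ᶜ) (X : Set (Rn n))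
    {κ : Rn n → ℝ} (hκ : IsAnnularCutoff κ) {lam : ℝ} (hlam : 0 < lam) (x : Rn n)
    {v : Rn n → ℂ} (hv : MemLp v 2) :
    Integrable fun ξ => pieceKernel X a φ κ lam x ξ * v ξ := by
  have h1 : MemLp (pieceKernel X a φ κ lam x) 2 volume :=
    (continuous_pieceKernel ha hφ X hκ lam x).memLp_of_hasCompactSupport
      (hasCompactSupport_pieceKernel X a φ hκ hlam x)
  exact h1.integrable_mul hv

/-- Averaging over translations along a subspace: an estimate on slices implies a local
estimate. -/
theorem lintegral_le_of_slices {W : Type*} [NormedAddCommGroup W] [InnerProductSpace ℝ W]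
    [FiniteDimensional ℝ W] [MeasurableSpace W] [BorelSpace W] (ι : W →ₗᵢ[ℝ] Rn n)
    {h : Rn n → ℝ≥0∞} (hm : Measurable h) {p : Rn n} {R : ℝ}
    (hsupp : ∀ x, x ∉ Metric.closedBall p R → h x = 0) {B : ℝ≥0∞}
    (hB : ∀ x, ∫⁻ s in Metric.closedBall (0 : W) 1, h (x + ι s) ≤ B) :
    ∫⁻ x, h x ≤ (volume (Metric.closedBall (0 : W) 1))⁻¹
      * (B * volume (Metric.closedBall p (R + 1))) := by
  set U := volume (Metric.closedBall (0 : W) 1) with hU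
  have hU0 : U ≠ 0 := (Metric.measure_closedBall_pos _ _ (by norm_num)).ne'
  have hUt : U ≠ ⊤ := measure_closedBall_lt_top.ne
  have hι : Measurable ι := ι.continuous.measurable
  -- By translation invariance each shift along the subspace gives the same integral. After
  -- interchanging, only base points `x` within R + 1 of `p` matter, and each contributes at most
  -- `B`.
  have h1 : ∫⁻ s in Metric.closedBall (0 : W) 1, ∫⁻ x, h (x + ι s) = U * ∫⁻ x, h x := by
    have : ∀ s, ∫⁻ x, h (x + ι s) = ∫⁻ x, h x := fun s => lintegral_add_right_eq_self h _
    simp_rw [this]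
    rw [lintegral_const, Measure.restrict_apply_univ, mul_comm]
  have h2 : ∫⁻ s in Metric.closedBall (0 : W) 1, ∫⁻ x, h (x + ι s)
      = ∫⁻ x, ∫⁻ s in Metric.closedBall (0 : W) 1, h (x + ι s) := by
    refine lintegral_lintegral_swap (f := fun s x => h (x + ι s)) ?_
    have : Measurable fun q : W × Rn n => h (q.2 + ι q.1) := by fun_prop
    exact this.aemeasurable
  have h3 : ∀ x, ∫⁻ s in Metric.closedBall (0 : W) 1, h (x + ι s)
      ≤ (Metric.closedBall p (R + 1)).indicator (fun _ => B) x := by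
    intro x
    by_cases hx : x ∈ Metric.closedBall p (R + 1)
    · rw [Set.indicator_of_mem hx]; exact hB x
    · rw [Set.indicator_of_notMem hx]
      refine le_of_eq ((lintegral_congr_ae ?_).trans lintegral_zero)
      filter_upwards [ae_restrict_mem Metric.isClosed_closedBall.measurableSet] with s hs
      refine hsupp _ fun hmem => hx ?_
      rw [Metric.mem_closedBall, dist_eq_norm] at hmem ⊢
      have h4 : ‖ι s‖ ≤ 1 := by rw [ι.norm_map]; simpa using hs
      have h5 := norm_sub_le (x + ι s - p) (ι s)
      rw [show x + ι s - p - ι s = x - p by abel] at h5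
      linarith
  have h4 : U * ∫⁻ x, h x ≤ B * volume (Metric.closedBall p (R + 1)) := by
    rw [← h1, h2]
    refine (lintegral_mono h3).trans ?_
    rw [lintegral_indicator_const Metric.isClosed_closedBall.measurableSet]
  calc ∫⁻ x, h x = U⁻¹ * (U * ∫⁻ x, h x) := by
        rw [← mul_assoc, ENNReal.inv_mul_cancel hU0 hUt, one_mul]
    _ ≤ _ := by gcongr

theorem stronglyMeasurable_integral_pieceKernel {X : Set (Rn n)} {a : Rn n → Rn n → ℂ}
    {φ : Rn n → Rn n → ℝ} {κ : Rn n → ℝ} {lam : ℝ}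
    (hk : StronglyMeasurable (Function.uncurry (pieceKernel X a φ κ lam))) {v : Rn n → ℂ}
    (hv : AEStronglyMeasurable v) :
    StronglyMeasurable fun x => ∫ ξ, pieceKernel X a φ κ lam x ξ * v ξ := by
  have h1 : ∀ x, ∫ ξ, pieceKernel X a φ κ lam x ξ * v ξ
      = ∫ ξ, pieceKernel X a φ κ lam x ξ * hv.mk v ξ := by
    intro x
    refine integral_congr_ae ?_
    filter_upwards [hv.ae_eq_mk] with ξ hξ
    rw [← hξ]
  simp_rw [h1]
  have h2 : StronglyMeasurable fun p : Rn n × Rn n => pieceKernel X a φ κ lam p.1 p.2 * hv.mk v p.2 := by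
    have h3 : StronglyMeasurable fun p : Rn n × Rn n => pieceKernel X a φ κ lam p.1 p.2 := hk
    exact h3.mul (hv.stronglyMeasurable_mk.comp_measurable measurable_snd)
  exact h2.integral_prod_right'

/-- The local estimate near a point, on a set of directions on which the subspace may be frozen. -/
theorem exists_local_bound {m ρ : ℝ} (hρ₀ : 0 ≤ ρ) (hρ₁ : ρ ≤ 1)
    {a : Rn n → Rn n → ℂ} (hs : ∀ x, ContDiff ℝ ∞ (a x)) {φ : Rn n → Rn n → ℝ} {l : ℕ}
    (hφ : IsRoughPhase l φ) {G : Set (Rn n)} {Ca Cφ : ℕ → ℝ} (hG : IsGoodSet G m ρ a φ Ca Cφ)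
    {X : Set (Rn n)} (hXm : MeasurableSet X) (hXG : X ⊆ G) {p : Rn n} {R : ℝ}
    (hXb : X ⊆ Metric.closedBall p R)
    {κ : Rn n → ℝ} (hκ : IsAnnularCutoff κ) (V₀ : Submodule ℝ (Rn n))
    (hV₀ : 0 < Module.finrank ℝ V₀) {c₀ : ℝ} (hc₀ : 0 < c₀)
    (hlow : ∀ x ∈ X, ∀ y ∈ X, a x ≠ 0 → a y ≠ 0 → x - y ∈ V₀ → ∀ η, κ η ≠ 0 →
      c₀ * ‖x - y‖ ≤ ‖fderiv ℝ (φ x) η - fderiv ℝ (φ y) η‖)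
    {σ : ℝ} (hσ : 0 < σ) : ∃ C : ℝ, 0 ≤ C ∧ ∀ lam : ℝ, 1 ≤ lam →
    ∀ v : Rn n → ℂ, MemLp v 2 →
    ∫⁻ x, ‖∫ ξ, pieceKernel X a φ κ lam x ξ * v ξ‖ₑ ^ 2 ≤ ENNReal.ofReal
      (C * lam ^ (n + 2 * m - (ρ + min ρ (1 / 2) * (Module.finrank ℝ V₀ - 1)) + σ)
        * ∫ ξ, ‖v ξ‖ ^ 2) := by
  set d := Module.finrank ℝ V₀ with hd
  have hW : Module.finrank ℝ (EuclideanSpace ℝ (Fin d)) = d := finrank_euclideanSpace_fin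
  have : Nontrivial (EuclideanSpace ℝ (Fin d)) :=
    Module.nontrivial_of_finrank_pos (R := ℝ) (by rw [hW]; exact hV₀)
  set ι : EuclideanSpace ℝ (Fin d) →ₗᵢ[ℝ] Rn n :=
    V₀.subtypeₗᵢ.comp (stdOrthonormalBasis ℝ V₀).repr.symm.toLinearIsometry with hι
  have hιV : ∀ y ∈ Set.range ι, y ∈ V₀ := by
    rintro _ ⟨s, rfl⟩
    exact ((stdOrthonormalBasis ℝ V₀).repr.symm s).2
  have hmeas := stronglyMeasurable_pieceKernel hs hφ.smooth hG hXm hXG hκ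
  obtain ⟨C, hC0, hC⟩ := exists_slice_bound hρ₀ hρ₁ hs hφ (hG.bounds.mono hXG) hκ ι hc₀
    (fun x hx y hy hax hay hxy η hη => hlow x hx y hy hax hay (hιV _ hxy) η hη) hmeas hσ 1
  rw [hW] at hC
  set U := volume (Metric.closedBall (0 : EuclideanSpace ℝ (Fin d)) 1) with hU
  have hU0 : U ≠ 0 := (Metric.measure_closedBall_pos _ _ (by norm_num)).ne'
  set Z := volume (Metric.closedBall p (R + 1)) with hZ
  have hZt : Z ≠ ⊤ := measure_closedBall_lt_top.ne
  refine ⟨(U⁻¹ * Z).toReal * C, by positivity, ?_⟩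
  intro lam hlam v hv
  have key := lintegral_le_of_slices ι
    (h := fun x => ‖∫ ξ, pieceKernel X a φ κ lam x ξ * v ξ‖ₑ ^ 2)
    ((stronglyMeasurable_integral_pieceKernel (hmeas lam) hv.1).measurable.enorm.pow_const 2)
    (p := p) (R := R) (fun x hx => by
      have : ∀ ξ, pieceKernel X a φ κ lam x ξ = 0 := fun ξ => by
        rw [pieceKernel, Set.indicator_of_notMem (fun h => hx (hXb h)), zero_mul]
      simp [this])
    (B := ENNReal.ofReal (C * lam ^ (n + 2 * m - (ρ + min ρ (1 / 2) * (d - 1)) + σ)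
        * ∫ ξ, ‖v ξ‖ ^ 2))
    (fun x => by
      obtain ⟨hi, hle⟩ := hC lam hlam x v hv
      refine le_trans (le_of_eq ?_) (ENNReal.ofReal_le_ofReal hle)
      rw [ofReal_integral_eq_lintegral_ofReal hi (Eventually.of_forall fun s => by positivity)]
      refine lintegral_congr fun s => ?_
      rw [ENNReal.ofReal_pow (norm_nonneg _), ofReal_norm])
  refine key.trans (le_of_eq ?_)
  have hassoc : ∀ x y z w : ℝ, x * y * z * w = x * (y * z * w) := fun x y z w => by ring
  rw [hassoc, ENNReal.ofReal_mul (by positivity : 0 ≤ (U⁻¹ * Z).toReal),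
    ENNReal.ofReal_toReal (ENNReal.mul_ne_top (ENNReal.inv_ne_top.mpr hU0) hZt)]
  ring

end Local

/-! ### Freezing the subspaces, covering, and the bound for one dyadic piece. -/

section Covering

variable {n : ℕ}

open scoped Manifold in
-- A cover of the sphere pulls back under η ↦ η/|η| to a cover of the annulus by cones; a
-- subordinate smooth partition of unity is multiplied by χ.
theorem exists_annular_partition {χ : Rn n → ℝ} (hχ : IsAnnularCutoff χ) {t : Set (Rn n)}
    (ht : t.Finite) {δ : ℝ} (hcov : Metric.sphere (0 : Rn n) 1 ⊆ ⋃ w ∈ t, Metric.ball w δ) :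
    ∃ κ : t → Rn n → ℝ, (∀ w, IsAnnularCutoff (κ w)) ∧
      (∀ (w : t) (η : Rn n), κ w η ≠ 0 → dist (‖η‖⁻¹ • η) w < δ) ∧
      ∀ η, ∑ᶠ w, κ w η = χ η := by
  have : Finite t := ht
  set s : Set (Rn n) := {η | 1 / 2 ≤ ‖η‖ ∧ ‖η‖ ≤ 2} with hs
  have hsc : IsClosed s := (isClosed_le continuous_const continuous_norm).inter
    (isClosed_le continuous_norm continuous_const)
  have hcont : ContinuousOn (fun η : Rn n => ‖η‖⁻¹ • η) {0}ᶜ :=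
    (continuousOn_id.norm.inv₀ fun η hη => norm_ne_zero_iff.mpr hη).smul continuousOn_id
  set U : t → Set (Rn n) := fun w => {0}ᶜ ∩ (fun η : Rn n => ‖η‖⁻¹ • η) ⁻¹' Metric.ball w δ with hU
  have hUo : ∀ w, IsOpen (U w) := fun w =>
    hcont.isOpen_inter_preimage isOpen_compl_singleton Metric.isOpen_ball
  have hsU : s ⊆ ⋃ w, U w := by
    intro η hη
    have h0 : η ≠ 0 := fun h => by
      have := hη.1
      rw [h, norm_zero] at this
      norm_num at this
    have h1 : ‖η‖⁻¹ • η ∈ Metric.sphere (0 : Rn n) 1 := by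
      rw [mem_sphere_zero_iff_norm, norm_smul, norm_inv, norm_norm,
        inv_mul_cancel₀ (norm_ne_zero_iff.mpr h0)]
    obtain ⟨w, hw, h2⟩ := Set.mem_iUnion₂.mp (hcov h1)
    exact Set.mem_iUnion.mpr ⟨⟨w, hw⟩, h0, h2⟩
  obtain ⟨f, hf⟩ := SmoothPartitionOfUnity.exists_isSubordinate 𝓘(ℝ, Rn n) hsc U hUo hsU
  refine ⟨fun w η => f w η * χ η, fun w => ⟨?_, ?_, ?_⟩, ?_, ?_⟩
  · exact (f w).contMDiff.contDiff.mul hχ.smooth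
  · exact fun η hη => hχ.half_le η (right_ne_zero_of_mul hη)
  · exact fun η hη => hχ.le_two η (right_ne_zero_of_mul hη)
  · exact fun w η hη => (hf w (subset_tsupport _ (left_ne_zero_of_mul hη))).2
  · intro η
    by_cases h : χ η = 0
    · simp [h]
    · rw [← finsum_mul, f.sum_eq_one (show η ∈ s from ⟨hχ.half_le η h, hχ.le_two η h⟩), one_mul]

theorem gradient_sub_norm_eq (f g : Rn n → ℝ) (ξ : Rn n) :
    ‖gradient f ξ - gradient g ξ‖ = ‖fderiv ℝ f ξ - fderiv ℝ g ξ‖ := by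
  rw [gradient, gradient, ← map_sub, LinearIsometryEquiv.norm_map]

theorem mem_spatialSupport_of_ne_zero {a : Rn n → Rn n → ℂ} {x : Rn n} (h : a x ≠ 0) :
    x ∈ spatialSupport a := by
  obtain ⟨ξ, hξ⟩ := Function.ne_iff.mp h
  exact ⟨(x, ξ), subset_tsupport _ hξ, rfl⟩

/-- Used with `Q` the projection onto the frozen subspace and `P` a nearby projection: vectors fixed
by `Q` keep at least half their length under `P`. -/
theorem half_norm_le_of_near {E : Type*} [NormedAddCommGroup E] [NormedSpace ℝ E] {P Q : E →L[ℝ] E}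
    (h : dist P Q < 1 / 2) {z : E} (hz : Q z = z) : ‖z‖ / 2 ≤ ‖P z‖ := by
  have h1 : ‖(Q - P) z‖ ≤ 1 / 2 * ‖z‖ := by
    refine ((Q - P).le_opNorm z).trans (mul_le_mul_of_nonneg_right ?_ (norm_nonneg _))
    rw [← dist_eq_norm, dist_comm]
    exact h.le
  rw [sub_apply, hz] at h1
  have := norm_sub_norm_le z (P z)
  linarith

/-- Locally in space and in direction, the rough corank condition bounds the increments of the
gradient from below on a frozen subspace. -/
theorem exists_frozen_subspace {k : ℕ} {a : Rn n → Rn n → ℂ} {φ : Rn n → Rn n → ℝ} {l : ℕ}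
    (hφ : IsRoughPhase l φ) (hc : RoughCorank k a φ) {K : Set (Rn n)} (hK : IsCompact K) :
    ∃ V : Rn n → Rn n → Submodule ℝ (Rn n), ∃ δ > 0, ∃ c₀ > 0,
      ∀ p ∈ K ∩ closure (spatialSupport a), ∀ w ∈ Metric.sphere (0 : Rn n) 1,
        Module.finrank ℝ (V p w) + k = n ∧
        ∀ x ∈ K ∩ Metric.ball p δ, ∀ y ∈ K ∩ Metric.ball p δ, a x ≠ 0 → a y ≠ 0 →
          x - y ∈ V p w → ∀ η : Rn n, η ≠ 0 → dist (‖η‖⁻¹ • η) w < δ →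
          c₀ * ‖x - y‖ ≤ ‖fderiv ℝ (φ x) η - fderiv ℝ (φ y) η‖ := by
  obtain ⟨V, hdim, hcont, c₁, c₂, hc₁, hc₂, hlow⟩ := hc
  -- Continuity up to the closure of the spatial support is what makes this set compact, hence the
  -- dependence of the projections uniform.
  have hS : IsCompact ((K ∩ closure (spatialSupport a)) ×ˢ Metric.sphere (0 : Rn n) 1) :=
    (hK.inter_right isClosed_closure).prod (isCompact_sphere _ _)
  have huc := hS.uniformContinuousOn_of_continuous
    (hcont.mono (Set.prod_mono_left Set.inter_subset_right))
  obtain ⟨δ₀, hδ₀, huc⟩ := Metric.uniformContinuousOn_iff.mp huc (1 / 2) (by norm_num)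
  -- The first entry keeps projections within 1/2 of the frozen one, leaving c₂/2 of the lower
  -- bound. The second makes c₁|x − y|² at most (c₂/4)|x − y|, so c₂/4 survives.
  set δ := min δ₀ (c₂ / (8 * c₁)) with hδ
  refine ⟨V, δ, by positivity, c₂ / 4, by positivity, fun p hp w hw => ⟨hdim p hp.2 w hw, ?_⟩⟩
  intro x hx y hy hax hay hxy η hη hηw
  have hxE := mem_spatialSupport_of_ne_zero hax
  have hyE := mem_spatialSupport_of_ne_zero hay
  set θ := ‖η‖⁻¹ • η with hθ
  have hη0 := norm_pos_iff.mpr hη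
  have hθs : θ ∈ Metric.sphere (0 : Rn n) 1 := by
    rw [mem_sphere_zero_iff_norm, norm_smul, norm_inv, norm_norm, inv_mul_cancel₀ hη0.ne']
  have hnear := huc (x, θ) ⟨⟨hx.1, subset_closure hxE⟩, hθs⟩ (p, w) ⟨hp, hw⟩ (by
    rw [Prod.dist_eq]
    exact max_lt (lt_of_lt_of_le hx.2 (min_le_left _ _)) (hηw.trans_le (min_le_left _ _)))
  have h1 := half_norm_le_of_near hnear (z := x - y)
    (Submodule.starProjection_eq_self_iff.mpr hxy)
  have h2 := hlow x hxE y hyE θ hθs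
  have hfd : ∀ x, fderiv ℝ (φ x) θ = fderiv ℝ (φ x) η := fun x =>
    fderiv_smul_of_homogeneous (hφ.smooth x) (hφ.homogeneous x) hη (inv_pos.mpr hη0)
  rw [gradient_sub_norm_eq, hfd, hfd] at h2
  have h3 : ‖x - y‖ ≤ 2 * (c₂ / (8 * c₁)) := by
    have := dist_triangle_right x y p
    have h4 := (Metric.mem_ball.mp hx.2).trans_le (min_le_right δ₀ (c₂ / (8 * c₁)))
    have h5 := (Metric.mem_ball.mp hy.2).trans_le (min_le_right δ₀ (c₂ / (8 * c₁)))
    rw [← dist_eq_norm]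
    linarith
  have h4 : c₁ * ‖x - y‖ ^ 2 ≤ c₂ / 4 * ‖x - y‖ := by
    calc c₁ * ‖x - y‖ ^ 2 = c₁ * ‖x - y‖ * ‖x - y‖ := by ring
      _ ≤ c₁ * (2 * (c₂ / (8 * c₁))) * ‖x - y‖ := by gcongr
      _ = c₂ / 4 * ‖x - y‖ := by field_simp; ring
  have h5 : c₂ * (‖x - y‖ / 2) ≤ c₂ * ‖(V x θ).starProjection (x - y)‖ := by gcongr
  linarith

theorem enorm_sum_sq_le {ι : Type*} (s : Finset ι) (f : ι → ℂ) :
    ‖∑ i ∈ s, f i‖ₑ ^ 2 ≤ (s.card : ℝ≥0∞) * ∑ i ∈ s, ‖f i‖ₑ ^ 2 := by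
  have h1 : ‖∑ i ∈ s, f i‖₊ ^ 2 ≤ (s.card : ℝ≥0) * ∑ i ∈ s, ‖f i‖₊ ^ 2 :=
    (pow_le_pow_left₀ (by positivity) (nnnorm_sum_le s f) 2).trans sq_sum_le_card_mul_sum_sq
  simp only [enorm_eq_nnnorm]
  exact_mod_cast h1

/-- With n = d + k the hypothesis reads n + 2m < ρ + (d − 1)(ρ − 1/2), and ρ − 1/2 ≤ min(ρ, 1/2)
because ρ ≤ 1. -/
theorem exponent_neg {k : ℕ} (hk : k < n) {m ρ : ℝ} (hρ₁ : ρ ≤ 1)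
    (hm : m < -(((n : ℝ) + (k : ℝ) - 1) / 4) + ((n : ℝ) - (k : ℝ)) * (ρ - 1) / 2) {d : ℕ}
    (hd : d + k = n) : n + 2 * m - (ρ + min ρ (1 / 2) * ((d : ℝ) - 1)) < 0 := by
  have hd' : (n : ℝ) = d + k := by exact_mod_cast hd.symm
  have hd1 : (1 : ℝ) ≤ d := by exact_mod_cast (by omega : 1 ≤ d)
  have h0 : 0 ≤ min ρ (1 / 2) + 1 / 2 - ρ := by
    rcases min_cases ρ (1 / 2 : ℝ) with h | h <;> linarith
  have h1 := mul_nonneg (sub_nonneg.mpr hd1) h0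
  rw [hd'] at hm ⊢
  nlinarith

theorem le_sum_of_eq {ι : Type*} [Fintype ι] {f : ι → ℝ≥0∞} {b : ℝ≥0∞} (i : ι) (h : b = f i) :
    b ≤ ∑ i, f i := h.trans_le (Finset.single_le_sum (fun _ _ => zero_le) (Finset.mem_univ i))

theorem setLIntegral_le_of_le_sum {α ι ι' : Type*} [MeasurableSpace α] {μ : Measure α} [Fintype ι]
    [Fintype ι'] {K : Set α} (hK : MeasurableSet K) {N : ℕ} {h : α → ℝ≥0∞}
    {F : ι → ι' → α → ℝ≥0∞} (hF : ∀ i j, Measurable (F i j))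
    (hpt : ∀ x ∈ K, h x ≤ (N : ℝ≥0∞) * ∑ i, ∑ j, F i j x) {B : ι → ι' → ℝ}
    (hB0 : ∀ i j, 0 ≤ B i j) (hB : ∀ i j, ∫⁻ x, F i j x ∂μ ≤ ENNReal.ofReal (B i j)) :
    ∫⁻ x in K, h x ∂μ ≤ ENNReal.ofReal (N * ∑ i, ∑ j, B i j) := by
  calc ∫⁻ x in K, h x ∂μ ≤ ∫⁻ x in K, (N : ℝ≥0∞) * ∑ i, ∑ j, F i j x ∂μ :=
        setLIntegral_mono' hK hpt
    _ ≤ ∫⁻ x, (N : ℝ≥0∞) * ∑ i, ∑ j, F i j x ∂μ := setLIntegral_le_lintegral _ _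
    _ = (N : ℝ≥0∞) * ∑ i, ∑ j, ∫⁻ x, F i j x ∂μ := by
        rw [lintegral_const_mul' _ _ (by simp), lintegral_finsetSum _ fun i _ =>
          Finset.measurable_fun_sum _ fun j _ => hF i j]
        congr 1
        exact Finset.sum_congr rfl fun i _ => lintegral_finsetSum _ fun j _ => hF i j
    _ ≤ (N : ℝ≥0∞) * ∑ i, ∑ j, ENNReal.ofReal (B i j) := by
        gcongr with i _ j
        exact hB i j
    _ = _ := by
        rw [ENNReal.ofReal_mul (by positivity), ENNReal.ofReal_natCast,
          ENNReal.ofReal_sum_of_nonneg fun i _ => Finset.sum_nonneg fun j _ => hB0 i j]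
        congr 1
        exact Finset.sum_congr rfl fun i _ =>
          (ENNReal.ofReal_sum_of_nonneg fun j _ => hB0 i j).symm

theorem enorm_integral_pieceKernel_sq_le {a : Rn n → Rn n → ℂ} (hs : ∀ x, ContDiff ℝ ∞ (a x))
    {φ : Rn n → Rn n → ℝ} (hφ : ∀ x, ContDiffOn ℝ ∞ (φ x) {0}ᶜ) (G : Set (Rn n)) {ι : Type*}
    [Fintype ι] {χ : Rn n → ℝ} {κ : ι → Rn n → ℝ} (hκ : ∀ i, IsAnnularCutoff (κ i))
    (hκs : ∀ η, ∑ᶠ i, κ i η = χ η) {lam : ℝ} (hlam : 0 < lam) (x : Rn n) {v : Rn n → ℂ}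
    (hv : MemLp v 2) : ‖∫ ξ, pieceKernel G a φ χ lam x ξ * v ξ‖ₑ ^ 2
      ≤ (Fintype.card ι : ℝ≥0∞) * ∑ i, ‖∫ ξ, pieceKernel G a φ (κ i) lam x ξ * v ξ‖ₑ ^ 2 := by
  have h1 : ∀ ξ, pieceKernel G a φ χ lam x ξ * v ξ
      = ∑ i, pieceKernel G a φ (κ i) lam x ξ * v ξ := by
    intro ξ
    rw [← Finset.sum_mul]
    simp only [pieceKernel]
    rw [← Finset.mul_sum, ← hκs, finsum_eq_sum_of_fintype, Complex.ofReal_sum]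
  simp_rw [h1]
  rw [integral_finsetSum _ fun i _ => integrable_pieceKernel_mul hs hφ G (hκ i) hlam x hv]
  exact enorm_sum_sq_le _ _

/-- Decay of the dyadic pieces of the operator, locally in `L²`. -/
theorem exists_piece_bound {k : ℕ} (hk : k < n) {m ρ : ℝ} (hρ₀ : 0 ≤ ρ) (hρ₁ : ρ ≤ 1)
    {a : Rn n → Rn n → ℂ} (hs : ∀ x, ContDiff ℝ ∞ (a x)) {φ : Rn n → Rn n → ℝ} {l : ℕ}
    (hφ : IsRoughPhase l φ) {G : Set (Rn n)} {Ca Cφ : ℕ → ℝ} (hG : IsGoodSet G m ρ a φ Ca Cφ)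
    (hc : RoughCorank k a φ)
    (hm : m < -(((n : ℝ) + (k : ℝ) - 1) / 4) + ((n : ℝ) - (k : ℝ)) * (ρ - 1) / 2)
    {χ : Rn n → ℝ} (hχ : IsAnnularCutoff χ) : ∃ γ : ℝ, 0 < γ ∧ ∀ K : Set (Rn n), IsCompact K →
    ∃ C : ℝ, 0 ≤ C ∧ ∀ lam : ℝ, 1 ≤ lam → ∀ v : Rn n → ℂ, MemLp v 2 →
    ∫⁻ x in K, ‖∫ ξ, pieceKernel G a φ χ lam x ξ * v ξ‖ₑ ^ 2 ≤ ENNReal.ofReal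
      (C * lam ^ (-γ) * ∫ ξ, ‖v ξ‖ ^ 2) := by
  have hexp := exponent_neg hk hρ₁ hm (Nat.sub_add_cancel hk.le)
  set e := n + 2 * m - (ρ + min ρ (1 / 2) * (((n - k : ℕ) : ℝ) - 1)) with he
  -- Half of the negative exponent `e` is spent on the loss σ = −e/2; the other half is the decay
  -- rate.
  refine ⟨-e / 2, by linarith, fun K hK => ?_⟩
  obtain ⟨V, δ, hδ, c₀, hc₀, hV⟩ := exists_frozen_subspace hφ hc hK
  obtain ⟨tp, htp, htpf, hcovp⟩ := (hK.inter_right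
    (isClosed_closure (s := spatialSupport a))).finite_cover_balls hδ
  obtain ⟨tw, htw, htwf, hcovw⟩ := (isCompact_sphere (0 : Rn n) 1).finite_cover_balls hδ
  obtain ⟨κ, hκ, hκd, hκs⟩ := exists_annular_partition hχ htwf hcovw
  have : Fintype tp := htpf.fintype
  have : Fintype tw := htwf.fintype
  -- Space is localised by sharp cutoffs, which is harmless because no regularity in x is ever used;
  -- only the frequency cutoffs must be smooth.
  have hloc : ∀ (p : tp) (w : tw), ∃ C : ℝ, 0 ≤ C ∧ ∀ lam : ℝ, 1 ≤ lam →
      ∀ v : Rn n → ℂ, MemLp v 2 →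
      ∫⁻ x, ‖∫ ξ, pieceKernel (G ∩ (K ∩ Metric.ball p δ)) a φ (κ w) lam x ξ * v ξ‖ₑ ^ 2
        ≤ ENNReal.ofReal (C * lam ^ (e / 2) * ∫ ξ, ‖v ξ‖ ^ 2) := by
    intro p w
    obtain ⟨hdim, hlow⟩ := hV p (htp p.2) w (htw w.2)
    have hd : Module.finrank ℝ (V p w) = n - k := by omega
    obtain ⟨C, hC0, hC⟩ := exists_local_bound hρ₀ hρ₁ hs hφ hG
      (hG.measurableSet.inter (hK.measurableSet.inter Metric.isOpen_ball.measurableSet))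
      Set.inter_subset_left
      ((Set.inter_subset_right.trans Set.inter_subset_right).trans Metric.ball_subset_closedBall)
      (hκ w) (V p w) (by omega) hc₀
      (fun x hx y hy hax hay hxy η hη => hlow x hx.2 y hy.2 hax hay hxy η
        (fun h => by
          have := (hκ w).half_le η hη
          rw [h, norm_zero] at this
          norm_num at this) (hκd w η hη)) (σ := -e / 2) (by linarith)
    rw [hd] at hC
    have hee : e + -e / 2 = e / 2 := by ring
    rw [← he, hee] at hC
    exact ⟨C, hC0, hC⟩
  choose C hC0 hC using hloc
  refine ⟨(Fintype.card tw : ℝ) * ∑ w, ∑ p, C p w, ?_, ?_⟩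
  · exact mul_nonneg (by positivity)
      (Finset.sum_nonneg fun w _ => Finset.sum_nonneg fun p _ => hC0 p w)
  intro lam hlam v hv
  have hlam0 : 0 < lam := by linarith
  have hI0 : 0 ≤ ∫ ξ, ‖v ξ‖ ^ 2 := integral_nonneg fun ξ => by positivity
  have hsub : ∀ p : Rn n, MeasurableSet (G ∩ (K ∩ Metric.ball p δ)) := fun p =>
    hG.measurableSet.inter (hK.measurableSet.inter Metric.isOpen_ball.measurableSet)
  have key := setLIntegral_le_of_le_sum (μ := volume) hK.measurableSet (N := Fintype.card tw)
    (h := fun x => ‖∫ ξ, pieceKernel G a φ χ lam x ξ * v ξ‖ₑ ^ 2)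
    (F := fun (w : tw) (p : tp) x =>
      ‖∫ ξ, pieceKernel (G ∩ (K ∩ Metric.ball p δ)) a φ (κ w) lam x ξ * v ξ‖ₑ ^ 2)
    (fun w p => (stronglyMeasurable_integral_pieceKernel (stronglyMeasurable_pieceKernel hs
      hφ.smooth hG (hsub p) Set.inter_subset_left (hκ w) lam) hv.1).measurable.enorm.pow_const 2)
    (fun x hx => by
      refine (enorm_integral_pieceKernel_sq_le hs hφ.smooth G hκ hκs hlam0 x hv).trans ?_
      gcongr with w
      -- The balls cover only `K` intersected with the closure of the spatial support; at all other
      -- points of `K` the piece vanishes.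
      by_cases hax : x ∈ G ∧ a x ≠ 0
      · obtain ⟨p, hp, hxp⟩ := Set.mem_iUnion₂.mp
          (hcovp ⟨hx, subset_closure (mem_spatialSupport_of_ne_zero hax.2)⟩)
        have : pieceKernel G a φ (κ w) lam x
            = pieceKernel (G ∩ (K ∩ Metric.ball p δ)) a φ (κ w) lam x := funext fun ξ => by
          rw [pieceKernel, pieceKernel, Set.indicator_of_mem hax.1,
            Set.indicator_of_mem (show x ∈ G ∩ (K ∩ Metric.ball p δ) from ⟨hax.1, hx, hxp⟩)]
        rw [this]
        exact le_sum_of_eq ⟨p, hp⟩ rfl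
      · have : pieceKernel G a φ (κ w) lam x = 0 := funext fun ξ => by
          by_cases hxG : x ∈ G
          · have : a x = 0 := by simpa [hxG] using hax
            simp [pieceKernel, this]
          · simp [pieceKernel, hxG]
        simp [this])
    (fun w p => mul_nonneg (mul_nonneg (hC0 p w) (by positivity)) hI0)
    (fun w p => hC p w lam hlam v hv)
  refine key.trans (le_of_eq ?_)
  have : -(-e / 2) = e / 2 := by ring
  rw [this]
  simp_rw [← Finset.sum_mul]
  congr 1
  ring

end Covering

/-! ### Plancherel's formula in the normalisation of the theorem. -/

section Plancherel

variable {n : ℕ}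

open scoped FourierTransform SchwartzMap

theorem fourierHat_eq (u : Rn n → ℂ) (ξ : Rn n) :
    fourierHat u ξ = 𝓕 u ((2 * Real.pi)⁻¹ • ξ) := by
  rw [fourierHat, Real.fourier_eq]
  refine integral_congr_ae (Eventually.of_forall fun y => ?_)
  simp only [Circle.smul_def, Real.fourierChar_apply, smul_eq_mul, inner_smul_right]
  congr 2
  push_cast
  have : (Real.pi : ℂ) ≠ 0 := by exact_mod_cast Real.pi_ne_zero
  field_simp

theorem integral_mul_fourier_eq {f g : Rn n → ℂ} (hf : Integrable f) (hg : Integrable g) :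
    ∫ x, g x * 𝓕 f x = ∫ x, 𝓕 g x * f x := by
  have h := VectorFourier.integral_fourierIntegral_smul_eq_flip (L := innerₗ (Rn n))
    (e := Real.fourierChar) (μ := volume) (ν := volume) Real.continuous_fourierChar
    continuous_inner hg hf
  simp only [flip_innerₗ, smul_eq_mul] at h
  exact h.symm

/-- The Fourier integral of an integrable square integrable function is its `L²` Fourier
transform. -/
theorem fourier_ae_eq_toLp {u : Rn n → ℂ} (h1 : Integrable u) (h2 : MemLp u 2) :
    𝓕 u =ᵐ[volume] (𝓕 h2.toLp : Lp ℂ 2 (volume : Measure (Rn n))) := by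
  refine ae_eq_of_integral_contDiff_smul_eq ?_ ?_ ?_
  · exact (VectorFourier.fourierIntegral_continuous Real.continuous_fourierChar continuous_inner
      h1).locallyIntegrable
  · exact (Lp.memLp _).locallyIntegrable (by norm_num)
  -- Both functions are locally integrable, so it suffices to pair them with test functions; the
  -- multiplication formula and the distributional definition of the `L²` transform give the same
  -- value ∫ ĝ u.
  intro g hg hgc
  have hg1 : HasCompactSupport (Complex.ofRealCLM ∘ g) := hgc.comp_left rfl
  have hg2 : ContDiff ℝ ∞ (Complex.ofRealCLM ∘ g) := by fun_prop
  set G : 𝓢(Rn n, ℂ) := hg1.toSchwartzMap hg2 with hG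
  have hGg : ∀ x, G x = (g x : ℂ) := fun x => rfl
  have h3 := congrArg (fun T => T G) (Lp.fourier_toTemperedDistribution_eq h2.toLp)
  simp only [TemperedDistribution.fourier_apply, Lp.toTemperedDistribution_apply, hGg,
    smul_eq_mul] at h3
  simp only [Complex.real_smul]
  rw [← h3]
  have h4 := integral_mul_fourier_eq h1 (G.integrable (μ := volume))
  simp only [hGg] at h4
  rw [h4]
  refine integral_congr_ae ?_
  filter_upwards [h2.coeFn_toLp] with x hx
  rw [hx, SchwartzMap.fourier_coe]

theorem continuous_fourierHat {u : Rn n → ℂ} (h1 : Integrable u) : Continuous (fourierHat u) := by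
  have h : Continuous (𝓕 u) :=
    VectorFourier.fourierIntegral_continuous Real.continuous_fourierChar continuous_inner h1
  rw [funext (fourierHat_eq u)]
  fun_prop

theorem memLp_fourierHat {u : Rn n → ℂ} (h1 : Integrable u) (h2 : MemLp u 2) :
    MemLp (fourierHat u) 2 := by
  rw [memLp_two_iff_integrable_sq_norm (continuous_fourierHat h1).aestronglyMeasurable]
  have h : MemLp (𝓕 u) 2 := (memLp_congr_ae (fourier_ae_eq_toLp h1 h2)).mpr (Lp.memLp _)
  have h3 := ((memLp_two_iff_integrable_sq_norm h.1).mp h).comp_smul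
    (R := (2 * Real.pi)⁻¹) (by positivity)
  simpa only [fourierHat_eq] using h3

theorem integral_norm_sq_eq_norm_toLp {u : Rn n → ℂ} (h : MemLp u 2) :
    ∫ y, ‖u y‖ ^ 2 = ‖h.toLp‖ ^ 2 := by
  rw [Lp.norm_toLp, MemLp.eLpNorm_eq_integral_rpow_norm (by norm_num) (by norm_num) h,
    ENNReal.toReal_ofReal (by positivity)]
  simp only [ENNReal.toReal_ofNat, Real.rpow_ofNat]
  rw [← Real.rpow_natCast, ← Real.rpow_mul (by positivity)]
  norm_num

/-- Plancherel's formula. -/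
theorem integral_norm_fourierHat_sq {u : Rn n → ℂ} (h1 : Integrable u) (h2 : MemLp u 2) :
    ∫ ξ, ‖fourierHat u ξ‖ ^ 2 = (2 * Real.pi) ^ n * ∫ y, ‖u y‖ ^ 2 := by
  simp_rw [fourierHat_eq]
  rw [Measure.integral_comp_smul volume (fun ξ => ‖𝓕 u ξ‖ ^ 2), finrank_euclideanSpace_fin,
    integral_congr_ae (g := fun ξ => ‖(𝓕 h2.toLp : Lp ℂ 2 (volume : Measure (Rn n))) ξ‖ ^ 2)
      (by filter_upwards [fourier_ae_eq_toLp h1 h2] with ξ hξ; rw [hξ]),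
    integral_norm_sq_eq_norm_toLp (Lp.memLp _), integral_norm_sq_eq_norm_toLp h2,
    Lp.toLp_coeFn, Lp.norm_fourier_eq, smul_eq_mul, inv_pow, inv_inv, abs_of_pos (by positivity)]

theorem one_le_bracket (ξ : Rn n) : 1 ≤ bracket ξ :=
  Real.one_le_sqrt.mpr (by nlinarith [sq_nonneg ‖ξ‖])

/-- The transform of a test function is Schwartz, so it beats any power of the bracket. This is the
dominating function showing that the integral defining `fio` is absolutely convergent. -/
theorem integrable_bracket_rpow_mul_fourierHat {u : Rn n → ℂ} (hu : ContDiff ℝ ∞ u)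
    (hc : HasCompactSupport u) (r : ℝ) :
    Integrable fun ξ => bracket ξ ^ r * ‖fourierHat u ξ‖ := by
  set U : 𝓢(Rn n, ℂ) := hc.toSchwartzMap hu with hU
  obtain ⟨N, hN⟩ := exists_nat_ge r
  have hpos : (0 : ℝ) < (2 * Real.pi)⁻¹ := by positivity
  have hF : ∀ ξ, fourierHat u ξ = (𝓕 U : 𝓢(Rn n, ℂ)) ((2 * Real.pi)⁻¹ • ξ) := fun ξ => by
    rw [fourierHat_eq, SchwartzMap.fourier_coe]
    rfl
  have h1 : ∀ k : ℕ, Integrable fun ξ => ‖ξ‖ ^ k * ‖fourierHat u ξ‖ := by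
    intro k
    have h2 := (((𝓕 U : 𝓢(Rn n, ℂ)).integrable_pow_mul volume k).comp_smul hpos.ne').const_mul
      ((2 * Real.pi) ^ k)
    refine h2.congr (Eventually.of_forall fun ξ => ?_)
    simp only [norm_smul, Real.norm_of_nonneg hpos.le, hF]
    have : (2 * Real.pi) ^ k * ((2 * Real.pi)⁻¹) ^ k = 1 := by
      rw [← mul_pow, mul_inv_cancel₀ (by positivity), one_pow]
    rw [mul_pow ((2 * Real.pi)⁻¹), mul_assoc, ← mul_assoc, this, one_mul]
  have h2 := (((h1 0).add (h1 N)).const_mul (2 ^ (N - 1)))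
  have hcont : Continuous fun ξ => bracket ξ ^ r * ‖fourierHat u ξ‖ :=
    (continuous_bracket.rpow_const fun ξ => Or.inl (bracket_pos ξ).ne').mul
      (continuous_fourierHat (hu.continuous.integrable_of_hasCompactSupport hc)).norm
  refine h2.mono' hcont.aestronglyMeasurable (Eventually.of_forall fun ξ => ?_)
  rw [Real.norm_of_nonneg (by have := bracket_pos ξ; positivity)]
  have h3 : bracket ξ ^ r ≤ 2 ^ (N - 1) * (1 + ‖ξ‖ ^ N) := by
    calc bracket ξ ^ r ≤ bracket ξ ^ (N : ℝ) :=
          Real.rpow_le_rpow_of_exponent_le (one_le_bracket ξ) hN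
      _ = bracket ξ ^ N := Real.rpow_natCast _ _
      _ ≤ (1 + ‖ξ‖) ^ N := pow_le_pow_left₀ (bracket_pos ξ).le (sqrt_one_add_norm_sq_le ξ) N
      _ ≤ 2 ^ (N - 1) * (1 ^ N + ‖ξ‖ ^ N) := add_pow_le zero_le_one (norm_nonneg _) N
      _ = _ := by rw [one_pow]
  calc bracket ξ ^ r * ‖fourierHat u ξ‖
      ≤ 2 ^ (N - 1) * (1 + ‖ξ‖ ^ N) * ‖fourierHat u ξ‖ := by gcongr
    _ = _ := by simp only [Pi.add_apply, pow_zero]; ring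

end Plancherel

/-! ### Dyadic decomposition of frequency space. -/

section Dyadic

variable {n : ℕ}

/-- A smooth radial bump equal to one on the unit ball. -/
def unitBump (n : ℕ) : ContDiffBump (0 : Rn n) := ⟨1, 2, one_pos, one_lt_two⟩

theorem unitBump_eq_one {η : Rn n} (h : ‖η‖ ≤ 1) : unitBump n η = 1 :=
  (unitBump n).one_of_mem_closedBall (mem_closedBall_zero_iff.mpr h)

theorem unitBump_eq_zero {η : Rn n} (h : 2 ≤ ‖η‖) : unitBump n η = 0 :=
  (unitBump n).zero_of_le_dist (by rw [dist_zero_right]; exact h)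

/-- The difference of two dilated bumps. -/
def annularBump (n : ℕ) (η : Rn n) : ℝ := unitBump n η - unitBump n ((2 : ℝ) • η)

theorem isAnnularCutoff_annularBump : IsAnnularCutoff (annularBump n) where
  smooth := (unitBump n).contDiff.sub ((unitBump n).contDiff.comp (contDiff_const_smul _))
  half_le η hη := by
    by_contra! h
    refine hη ?_
    rw [annularBump, unitBump_eq_one (by linarith), unitBump_eq_one, sub_self]
    rw [norm_smul, Real.norm_two]
    linarith
  le_two η hη := by
    by_contra! h
    refine hη ?_
    rw [annularBump, unitBump_eq_zero h.le, unitBump_eq_zero, sub_self]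
    rw [norm_smul, Real.norm_two]
    linarith [norm_nonneg η]

/-- A dyadic partition of unity of the frequency space. -/
def dyadicCutoff (n : ℕ) : ℕ → Rn n → ℝ
  | 0 => unitBump n
  | j + 1 => fun ξ => annularBump n (((2 : ℝ) ^ (j + 1))⁻¹ • ξ)

/-- Telescoping: each annular bump is a difference of two consecutive dilates of the unit bump. -/
theorem sum_dyadicCutoff (J : ℕ) (ξ : Rn n) :
    ∑ j ∈ Finset.range (J + 1), dyadicCutoff n j ξ = unitBump n (((2 : ℝ) ^ J)⁻¹ • ξ) := by
  induction J with
  | zero => simp [dyadicCutoff]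
  | succ J ih =>
    rw [Finset.sum_range_succ, ih]
    simp only [dyadicCutoff, annularBump]
    rw [smul_smul]
    have : (2 : ℝ) * (2 ^ (J + 1))⁻¹ = (2 ^ J)⁻¹ := by
      rw [pow_succ]
      field_simp
    rw [this]
    ring

theorem continuous_dyadicCutoff (j : ℕ) : Continuous (dyadicCutoff n j) := by
  cases j with
  | zero => exact (unitBump n).continuous
  | succ j => exact isAnnularCutoff_annularBump.smooth.continuous.comp (continuous_const_smul _)

theorem hasCompactSupport_dyadicCutoff (j : ℕ) : HasCompactSupport (dyadicCutoff n j) := by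
  cases j with
  | zero => exact (unitBump n).hasCompactSupport
  | succ j =>
    refine HasCompactSupport.of_support_subset_isCompact
      (isCompact_closedBall 0 (2 * 2 ^ (j + 1))) fun ξ hξ => ?_
    have h1 := isAnnularCutoff_annularBump.le_two _ hξ
    rw [norm_smul, norm_inv, norm_pow, Real.norm_two, inv_mul_le_iff₀ (by positivity)] at h1
    rw [mem_closedBall_zero_iff]
    linarith

/-- The symbol `e^{iφ} a` of the operator, restricted to `x ∈ G` and `ξ ≠ 0`. -/
def symbolKernel (G : Set (Rn n)) (a : Rn n → Rn n → ℂ) (φ : Rn n → Rn n → ℝ) (x ξ : Rn n) : ℂ :=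
  G.indicator (fun x => ({0}ᶜ : Set (Rn n)).indicator
    (fun ξ => Complex.exp (Complex.I * (φ x ξ : ℂ)) * a x ξ) ξ) x

theorem symbolKernel_mul_annular (G : Set (Rn n)) (a : Rn n → Rn n → ℂ) (φ : Rn n → Rn n → ℝ)
    {κ : Rn n → ℝ} (hκ : IsAnnularCutoff κ) (lam : ℝ) (x ξ : Rn n) :
    symbolKernel G a φ x ξ * (κ (lam⁻¹ • ξ) : ℂ) = pieceKernel G a φ κ lam x ξ := by
  by_cases hξ : ξ = 0
  · have : κ (lam⁻¹ • ξ) = 0 := by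
      by_contra h
      have := hκ.half_le _ h
      rw [hξ, smul_zero, norm_zero] at this
      norm_num at this
    rw [pieceKernel, this, Complex.ofReal_zero, mul_zero, mul_zero]
  · rw [pieceKernel, symbolKernel]
    by_cases hx : x ∈ G
    · rw [Set.indicator_of_mem hx, Set.indicator_of_mem hx, Set.indicator_of_mem hξ]
    · rw [Set.indicator_of_notMem hx, Set.indicator_of_notMem hx]

theorem tendsto_unitBump_smul (ξ : Rn n) :
    Tendsto (fun J : ℕ => unitBump n (((2 : ℝ) ^ J)⁻¹ • ξ)) atTop (nhds 1) := by
  have h1 : Tendsto (fun J : ℕ => ((2 : ℝ) ^ J)⁻¹ • ξ) atTop (nhds 0) := by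
    have := (tendsto_inv_atTop_zero.comp (tendsto_pow_atTop_atTop_of_one_lt
      (one_lt_two (α := ℝ)))).smul_const ξ
    simpa using this
  have h2 := ((unitBump n).continuous.tendsto 0).comp h1
  rwa [unitBump_eq_one (by simp)] at h2

/-- Annular pieces are jointly measurable, so the symbol is recovered as their limit. The
decomposition must be two-sided, since the low frequency cutoff does not avoid the singularity of
the phase at ξ = 0. -/
theorem stronglyMeasurable_symbolKernel {m ρ : ℝ} {a : Rn n → Rn n → ℂ}
    (ha : ∀ x, ContDiff ℝ ∞ (a x)) {φ : Rn n → Rn n → ℝ} (hφ : ∀ x, ContDiffOn ℝ ∞ (φ x) {0}ᶜ)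
    {G : Set (Rn n)} {Ca Cφ : ℕ → ℝ} (hG : IsGoodSet G m ρ a φ Ca Cφ) :
    StronglyMeasurable (Function.uncurry (symbolKernel G a φ)) := by
  set c : ℕ → Rn n → ℝ := fun J ξ =>
    unitBump n (((2 : ℝ) ^ J)⁻¹ • ξ) - unitBump n ((2 : ℝ) ^ J • ξ) with hc
  have hsum : ∀ J ξ, c J ξ = ∑ i ∈ Finset.range J, annularBump n (((2 : ℝ) ^ (i + 1))⁻¹ • ξ)
      + ∑ i ∈ Finset.range J, annularBump n ((2 ^ i : ℝ) • ξ) := by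
    intro J ξ
    induction J with
    | zero => simp [hc]
    | succ J ih =>
      rw [Finset.sum_range_succ, Finset.sum_range_succ, add_add_add_comm, ← ih]
      simp only [hc, annularBump, smul_smul]
      have h1 : (2 : ℝ) * (2 ^ (J + 1))⁻¹ = (2 ^ J)⁻¹ := by
        rw [pow_succ]
        field_simp
      have h2 : (2 : ℝ) * 2 ^ J = 2 ^ (J + 1) := by ring
      rw [h1, h2]
      ring
  have hpiece : ∀ lam : ℝ, StronglyMeasurable fun p : Rn n × Rn n =>
      symbolKernel G a φ p.1 p.2 * (annularBump n (lam⁻¹ • p.2) : ℂ) := by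
    intro lam
    simp_rw [symbolKernel_mul_annular G a φ isAnnularCutoff_annularBump]
    exact stronglyMeasurable_pieceKernel ha hφ hG hG.measurableSet subset_rfl
      isAnnularCutoff_annularBump lam
  refine stronglyMeasurable_of_tendsto atTop (f := fun (J : ℕ) (p : Rn n × Rn n) =>
    symbolKernel G a φ p.1 p.2 * (c J p.2 : ℂ)) (fun J => ?_) ?_
  · simp only [hsum, Complex.ofReal_add, Complex.ofReal_sum, mul_add, Finset.mul_sum]
    refine (Finset.stronglyMeasurable_fun_sum _ fun i _ => hpiece _).add
      (Finset.stronglyMeasurable_fun_sum _ fun i _ => ?_)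
    have := hpiece (((2 : ℝ) ^ i)⁻¹)
    rwa [inv_inv] at this
  · rw [tendsto_pi_nhds]
    rintro ⟨x, ξ⟩
    by_cases hξ : ξ = 0
    · have : symbolKernel G a φ x ξ = 0 := by
        rw [symbolKernel, Set.indicator_apply_eq_zero]
        exact fun _ => by simp [hξ]
      simp [this]
    · have h1 : Tendsto (fun J : ℕ => unitBump n ((2 : ℝ) ^ J • ξ)) atTop (nhds 0) := by
        refine tendsto_const_nhds.congr' ?_
        have h2 : Tendsto (fun J : ℕ => (2 : ℝ) ^ J * ‖ξ‖) atTop atTop :=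
          (tendsto_pow_atTop_atTop_of_one_lt one_lt_two).atTop_mul_const (norm_pos_iff.mpr hξ)
        filter_upwards [h2.eventually_ge_atTop 2] with J hJ
        rw [unitBump_eq_zero]
        rwa [norm_smul, norm_pow, Real.norm_two]
      have h2 := ((tendsto_unitBump_smul ξ).sub h1)
      rw [sub_zero] at h2
      have h3 := ((Complex.continuous_ofReal.tendsto 1).comp h2).const_mul (symbolKernel G a φ x ξ)
      rwa [Complex.ofReal_one, mul_one] at h3

theorem norm_symbolKernel_le {m ρ : ℝ} {a : Rn n → Rn n → ℂ} {φ : Rn n → Rn n → ℝ}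
    {G : Set (Rn n)} {Ca Cφ : ℕ → ℝ} (hG : HasBoundsOn G m ρ a φ Ca Cφ) (x ξ : Rn n) :
    ‖symbolKernel G a φ x ξ‖ ≤ |Ca 0| * bracket ξ ^ m := by
  have hb := bracket_pos ξ
  by_cases hx : x ∈ G
  swap
  · rw [symbolKernel, Set.indicator_of_notMem hx, norm_zero]
    positivity
  rw [symbolKernel, Set.indicator_of_mem hx]
  by_cases hξ : ξ = 0
  · rw [Set.indicator_of_notMem (by simp [hξ]), norm_zero]
    positivity
  rw [Set.indicator_of_mem hξ, norm_mul, norm_cexp_I_mul_ofReal, one_mul]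
  have h1 := (hG.amp x hx 0 ξ).trans (le_abs_self _)
  rw [norm_iteratedFDeriv_zero, Nat.cast_zero, mul_zero, add_zero, Real.rpow_neg hb.le,
    inv_mul_le_iff₀ (by positivity)] at h1
  linarith

end Dyadic

/-! ### Geometric decay of the dyadic operators. -/

section DyadicOperators

variable {n : ℕ}

/-- The pieces of the operator, acting on the Fourier transform. -/
def dyadicOp (G : Set (Rn n)) (a : Rn n → Rn n → ℂ) (φ : Rn n → Rn n → ℝ) (j : ℕ) (v : Rn n → ℂ)
    (x : Rn n) : ℂ :=
  ∫ ξ, symbolKernel G a φ x ξ * (dyadicCutoff n j ξ : ℂ) * v ξ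

theorem dyadicOp_succ (G : Set (Rn n)) (a : Rn n → Rn n → ℂ) (φ : Rn n → Rn n → ℝ) (j : ℕ)
    (v : Rn n → ℂ) (x : Rn n) : dyadicOp G a φ (j + 1) v x
      = ∫ ξ, pieceKernel G a φ (annularBump n) ((2 : ℝ) ^ (j + 1)) x ξ * v ξ := by
  simp only [dyadicOp, dyadicCutoff, symbolKernel_mul_annular G a φ isAnnularCutoff_annularBump]

section

variable {m ρ : ℝ} {a : Rn n → Rn n → ℂ} {φ : Rn n → Rn n → ℝ} {G : Set (Rn n)} {Ca Cφ : ℕ → ℝ}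

theorem memLp_bracket_mul_dyadicCutoff (m C : ℝ) (j : ℕ) :
    MemLp (fun ξ : Rn n => C * bracket ξ ^ m * dyadicCutoff n j ξ) 2 := by
  have h1 : Continuous fun ξ : Rn n => C * bracket ξ ^ m * dyadicCutoff n j ξ :=
    (continuous_const.mul (continuous_bracket.rpow_const fun ξ => Or.inl (bracket_pos ξ).ne')).mul
      (continuous_dyadicCutoff j)
  exact h1.memLp_of_hasCompactSupport (hasCompactSupport_dyadicCutoff j).mul_left

theorem norm_symbolKernel_mul_le (hG : HasBoundsOn G m ρ a φ Ca Cφ) (j : ℕ) (x ξ : Rn n) :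
    ‖symbolKernel G a φ x ξ * (dyadicCutoff n j ξ : ℂ)‖
      ≤ ‖|Ca 0| * bracket ξ ^ m * dyadicCutoff n j ξ‖ := by
  have hb := bracket_pos ξ
  rw [norm_mul, norm_mul, Complex.norm_real,
    Real.norm_of_nonneg (show 0 ≤ |Ca 0| * bracket ξ ^ m by positivity)]
  exact mul_le_mul_of_nonneg_right (norm_symbolKernel_le hG x ξ) (norm_nonneg _)

theorem memLp_symbolKernel_mul (ha : ∀ x, ContDiff ℝ ∞ (a x))
    (hφ : ∀ x, ContDiffOn ℝ ∞ (φ x) {0}ᶜ) (hG : IsGoodSet G m ρ a φ Ca Cφ) (j : ℕ) (x : Rn n) :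
    MemLp (fun ξ => symbolKernel G a φ x ξ * (dyadicCutoff n j ξ : ℂ)) 2 := by
  refine (memLp_bracket_mul_dyadicCutoff m |Ca 0| j).mono ?_
    (Eventually.of_forall fun ξ => norm_symbolKernel_mul_le hG.bounds j x ξ)
  have h1 : StronglyMeasurable (symbolKernel G a φ x) :=
    (stronglyMeasurable_symbolKernel ha hφ hG).comp_measurable measurable_prodMk_left
  exact (h1.mul (Complex.continuous_ofReal.comp
    (continuous_dyadicCutoff j)).stronglyMeasurable).aestronglyMeasurable

theorem integrable_dyadicOp (ha : ∀ x, ContDiff ℝ ∞ (a x))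
    (hφ : ∀ x, ContDiffOn ℝ ∞ (φ x) {0}ᶜ) (hG : IsGoodSet G m ρ a φ Ca Cφ) (j : ℕ) (x : Rn n)
    {v : Rn n → ℂ} (hv : MemLp v 2) :
    Integrable fun ξ => symbolKernel G a φ x ξ * (dyadicCutoff n j ξ : ℂ) * v ξ :=
  (memLp_symbolKernel_mul ha hφ hG j x).integrable_mul hv

theorem dyadicOp_add (ha : ∀ x, ContDiff ℝ ∞ (a x))
    (hφ : ∀ x, ContDiffOn ℝ ∞ (φ x) {0}ᶜ) (hG : IsGoodSet G m ρ a φ Ca Cφ) (j : ℕ) (x : Rn n)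
    {v w : Rn n → ℂ} (hv : MemLp v 2) (hw : MemLp w 2) :
    dyadicOp G a φ j (v + w) x = dyadicOp G a φ j v x + dyadicOp G a φ j w x := by
  simp only [dyadicOp, Pi.add_apply, mul_add]
  exact integral_add (integrable_dyadicOp ha hφ hG j x hv) (integrable_dyadicOp ha hφ hG j x hw)

theorem dyadicOp_smul (j : ℕ) (x : Rn n) (c : ℂ) (v : Rn n → ℂ) :
    dyadicOp G a φ j (c • v) x = c * dyadicOp G a φ j v x := by
  simp only [dyadicOp, Pi.smul_apply, smul_eq_mul]
  rw [← integral_const_mul]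
  exact integral_congr_ae (Eventually.of_forall fun ξ => by ring)

theorem stronglyMeasurable_dyadicOp (ha : ∀ x, ContDiff ℝ ∞ (a x))
    (hφ : ∀ x, ContDiffOn ℝ ∞ (φ x) {0}ᶜ) (hG : IsGoodSet G m ρ a φ Ca Cφ) (j : ℕ)
    {v : Rn n → ℂ} (hv : AEStronglyMeasurable v) :
    StronglyMeasurable (dyadicOp G a φ j v) := by
  have h1 : dyadicOp G a φ j v = fun x =>
      ∫ ξ, symbolKernel G a φ x ξ * (dyadicCutoff n j ξ : ℂ) * hv.mk v ξ := by
    funext x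
    refine integral_congr_ae ?_
    filter_upwards [hv.ae_eq_mk] with ξ hξ
    rw [← hξ]
  rw [h1]
  have h2 : StronglyMeasurable fun p : Rn n × Rn n =>
      symbolKernel G a φ p.1 p.2 * (dyadicCutoff n j p.2 : ℂ) * hv.mk v p.2 := by
    have h3 : StronglyMeasurable fun p : Rn n × Rn n => symbolKernel G a φ p.1 p.2 :=
      stronglyMeasurable_symbolKernel ha hφ hG
    refine (h3.mul ?_).mul (hv.stronglyMeasurable_mk.comp_measurable measurable_snd)
    exact (Complex.continuous_ofReal.comp
      ((continuous_dyadicCutoff j).comp continuous_snd)).stronglyMeasurable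
  exact h2.integral_prod_right'

/-- Plain Cauchy-Schwarz, with a constant depending on `j`; it serves for the low frequency piece j
= 0, to which the oscillatory estimate does not apply. -/
theorem enorm_dyadicOp_le (ha : ∀ x, ContDiff ℝ ∞ (a x))
    (hφ : ∀ x, ContDiffOn ℝ ∞ (φ x) {0}ᶜ) (hG : IsGoodSet G m ρ a φ Ca Cφ) (j : ℕ) (x : Rn n)
    {v : Rn n → ℂ} (hv : AEStronglyMeasurable v) : ‖dyadicOp G a φ j v x‖ₑ
      ≤ eLpNorm (fun ξ : Rn n => |Ca 0| * bracket ξ ^ m * dyadicCutoff n j ξ) 2 volume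
        * eLpNorm v 2 volume := by
  have h1 := memLp_symbolKernel_mul ha hφ hG j x
  calc ‖dyadicOp G a φ j v x‖ₑ
      ≤ ∫⁻ ξ, ‖symbolKernel G a φ x ξ * (dyadicCutoff n j ξ : ℂ) * v ξ‖ₑ :=
        enorm_integral_le_lintegral_enorm _
    _ = eLpNorm ((fun ξ => symbolKernel G a φ x ξ * (dyadicCutoff n j ξ : ℂ)) • v) 1 volume := by
        rw [eLpNorm_one_eq_lintegral_enorm]
        rfl
    _ ≤ eLpNorm (fun ξ => symbolKernel G a φ x ξ * (dyadicCutoff n j ξ : ℂ)) 2 volume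
        * eLpNorm v 2 volume := eLpNorm_smul_le_mul_eLpNorm hv h1.1
    _ ≤ _ := by
        gcongr
        exact eLpNorm_mono (norm_symbolKernel_mul_le hG.bounds j x)

end

theorem eLpNorm_two_sq {α : Type*} [MeasurableSpace α] (μ : Measure α) (f : α → ℂ) :
    eLpNorm f 2 μ ^ 2 = ∫⁻ x, ‖f x‖ₑ ^ 2 ∂μ := by
  have := eLpNorm_nnreal_pow_eq_lintegral (f := f) (μ := μ) (p := 2) (by norm_num)
  simpa only [NNReal.coe_ofNat, ENNReal.rpow_ofNat, ENNReal.coe_ofNat] using this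

theorem ofReal_integral_norm_sq {α : Type*} [MeasurableSpace α] {μ : Measure α} {f : α → ℂ}
    (hf : MemLp f 2 μ) : ENNReal.ofReal (∫ x, ‖f x‖ ^ 2 ∂μ) = eLpNorm f 2 μ ^ 2 := by
  rw [eLpNorm_two_sq, ofReal_integral_eq_lintegral_ofReal
    ((memLp_two_iff_integrable_sq_norm hf.1).mp hf) (Eventually.of_forall fun x => by positivity)]
  refine lintegral_congr fun x => ?_
  rw [ENNReal.ofReal_pow (norm_nonneg _), ofReal_norm]

/-- Geometric decay of the pieces of the operator. -/
theorem exists_dyadicOp_bound {k : ℕ} (hk : k < n) {m ρ : ℝ} (hρ₀ : 0 ≤ ρ) (hρ₁ : ρ ≤ 1)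
    {a : Rn n → Rn n → ℂ} (hs : ∀ x, ContDiff ℝ ∞ (a x)) {φ : Rn n → Rn n → ℝ} {l : ℕ}
    (hφ : IsRoughPhase l φ) {G : Set (Rn n)} {Ca Cφ : ℕ → ℝ} (hG : IsGoodSet G m ρ a φ Ca Cφ)
    (hc : RoughCorank k a φ)
    (hm : m < -(((n : ℝ) + (k : ℝ) - 1) / 4) + ((n : ℝ) - (k : ℝ)) * (ρ - 1) / 2) :
    ∃ r : ℝ≥0, r < 1 ∧ ∀ K : Set (Rn n), IsCompact K → ∃ C : ℝ≥0, ∀ j : ℕ, ∀ v : Rn n → ℂ,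
      MemLp v 2 → eLpNorm (dyadicOp G a φ j v) 2 (volume.restrict K)
        ≤ C * r ^ j * eLpNorm v 2 volume := by
  obtain ⟨γ, hγ, hbd⟩ := exists_piece_bound hk hρ₀ hρ₁ hs hφ hG hc hm
    (isAnnularCutoff_annularBump (n := n))
  -- The piece bound controls the square of the norm by λ^(−γ) with λ = 2^j, hence the half in the
  -- ratio.
  set q : ℝ := 2 ^ (-γ / 2) with hq
  have hq0 : 0 < q := by positivity
  have hq1 : q < 1 := Real.rpow_lt_one_of_one_lt_of_neg one_lt_two (by linarith)
  obtain ⟨q', hq'⟩ : ∃ q' : ℝ≥0, (q' : ℝ) = q := ⟨⟨q, hq0.le⟩, rfl⟩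
  refine ⟨q', by rwa [← NNReal.coe_lt_coe, hq', NNReal.coe_one], fun K hK => ?_⟩
  obtain ⟨C, hC0, hC⟩ := hbd K hK
  set D := eLpNorm (fun ξ : Rn n => |Ca 0| * bracket ξ ^ m * dyadicCutoff n 0 ξ) 2 volume with hD
  have hDt : D ≠ ⊤ := (memLp_bracket_mul_dyadicCutoff m |Ca 0| 0).2.ne
  have hKt : volume K ^ (1 / 2 : ℝ) ≠ ⊤ :=
    ENNReal.rpow_ne_top_of_nonneg (by norm_num) hK.measure_lt_top.ne
  set C₁ : ℝ≥0 := (D * volume K ^ (1 / 2 : ℝ)).toNNReal with hC₁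
  have hC₁' : (C₁ : ℝ≥0∞) = D * volume K ^ (1 / 2 : ℝ) :=
    ENNReal.coe_toNNReal (ENNReal.mul_ne_top hDt hKt)
  obtain ⟨C₂, hC₂⟩ : ∃ C₂ : ℝ≥0, (C₂ : ℝ) ^ 2 = C := ⟨⟨√C, Real.sqrt_nonneg _⟩, Real.sq_sqrt hC0⟩
  refine ⟨C₁ + C₂, fun j v hv => ?_⟩
  cases j with
  | zero =>
    have h1 : eLpNorm (dyadicOp G a φ 0 v) 2 (volume.restrict K)
        ≤ eLpNorm (fun _ : Rn n => D * eLpNorm v 2 volume) 2 (volume.restrict K) :=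
      eLpNorm_mono_enorm fun x => by
        simpa using enorm_dyadicOp_le hs hφ.smooth hG 0 x hv.1
    rw [eLpNorm_const' _ (by norm_num) (by norm_num), Measure.restrict_apply_univ] at h1
    refine h1.trans ?_
    simp only [enorm_eq_self, ENNReal.toReal_ofNat, pow_zero, mul_one, ENNReal.coe_add, hC₁']
    rw [mul_right_comm]
    gcongr
    exact le_self_add
  | succ j =>
    rw [← ENNReal.pow_le_pow_left_iff two_ne_zero, eLpNorm_two_sq]
    simp_rw [dyadicOp_succ]
    refine (hC _ (one_le_pow₀ one_le_two) v hv).trans ?_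
    have h2 : ((2 : ℝ) ^ (j + 1)) ^ (-γ) = (q ^ (j + 1)) ^ 2 := by
      rw [hq, ← Real.rpow_natCast 2, ← Real.rpow_mul zero_le_two, ← Real.rpow_natCast,
        ← Real.rpow_natCast, ← Real.rpow_mul zero_le_two, ← Real.rpow_mul zero_le_two]
      congr 1
      push_cast
      ring
    have h3 : (0 : ℝ) ≤ (q ^ (j + 1)) ^ 2 := by positivity
    rw [h2, ENNReal.ofReal_mul (mul_nonneg hC0 h3), ofReal_integral_norm_sq hv, mul_pow]
    gcongr
    have h4 : ENNReal.ofReal (C * (q ^ (j + 1)) ^ 2) = (C₂ * q' ^ (j + 1)) ^ 2 := by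
      have : C * (q ^ (j + 1)) ^ 2 = ((C₂ * q' ^ (j + 1)) ^ 2 : ℝ≥0) := by
        push_cast
        rw [hq', mul_pow, hC₂]
      rw [this, ENNReal.ofReal_coe_nnreal]
      push_cast
      rfl
    rw [h4, ENNReal.coe_add]
    gcongr
    exact le_add_self

end DyadicOperators

/-! ### Summation of the pieces. -/

section Operator

variable {n : ℕ}

theorem fourierHat_congr_ae {u w : Rn n → ℂ} (h : u =ᵐ[volume] w) : fourierHat u = fourierHat w := by
  funext ξ
  refine integral_congr_ae ?_
  filter_upwards [h] with y hy
  rw [hy]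

theorem integrable_fourierHat_integrand {u : Rn n → ℂ} (hu : Integrable u) (ξ : Rn n) :
    Integrable fun y => Complex.exp (-(Complex.I * ((inner ℝ y ξ : ℝ) : ℂ))) * u y := by
  refine hu.bdd_mul (c := 1) (Continuous.aestronglyMeasurable (by fun_prop))
    (Eventually.of_forall fun y => ?_)
  rw [← mul_neg, ← Complex.ofReal_neg, norm_cexp_I_mul_ofReal]

theorem fourierHat_add {u w : Rn n → ℂ} (hu : Integrable u) (hw : Integrable w) :
    fourierHat (u + w) = fourierHat u + fourierHat w := by
  funext ξ
  simp only [fourierHat, Pi.add_apply, mul_add]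
  exact integral_add (integrable_fourierHat_integrand hu ξ) (integrable_fourierHat_integrand hw ξ)

theorem fourierHat_smul (c : ℂ) (u : Rn n → ℂ) : fourierHat (c • u) = c • fourierHat u := by
  funext ξ
  simp only [fourierHat, Pi.smul_apply, smul_eq_mul]
  rw [← integral_const_mul]
  exact integral_congr_ae (Eventually.of_forall fun y => by ring)

theorem eLpNorm_fourierHat_le {u : Rn n → ℂ} (h1 : Integrable u) (h2 : MemLp u 2) :
    eLpNorm (fourierHat u) 2 volume
      ≤ ENNReal.ofReal ((2 * Real.pi) ^ n) * eLpNorm u 2 volume := by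
  have hpi : (1 : ℝ) ≤ (2 * Real.pi) ^ n :=
    one_le_pow₀ (by linarith [Real.two_le_pi])
  rw [← ENNReal.pow_le_pow_left_iff two_ne_zero, ← ofReal_integral_norm_sq (memLp_fourierHat h1 h2),
    integral_norm_fourierHat_sq h1 h2, ENNReal.ofReal_mul (by positivity),
    ofReal_integral_norm_sq h2, mul_pow (ENNReal.ofReal _)]
  gcongr
  rw [← ENNReal.ofReal_pow (by positivity)]
  exact ENNReal.ofReal_le_ofReal (le_self_pow₀ hpi two_ne_zero)

/-- Compact support puts `L²` inside `L¹`, so `fourierHat` is an absolutely convergent integral and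
the extension can be defined directly, without a density argument. -/
theorem integrable_of_mem_L2comp (f : L2comp n) : Integrable (f : Rn n →ₘ[volume] ℂ) := by
  obtain ⟨h2, K, hK, hfK⟩ := f.2
  have hae : K.indicator (f : Rn n →ₘ[volume] ℂ) =ᵐ[volume] (f : Rn n →ₘ[volume] ℂ) := by
    filter_upwards [hfK] with x hx
    by_cases h : x ∈ K
    · rw [Set.indicator_of_mem h]
    · rw [Set.indicator_of_notMem h, hx h]
  have h3 : MemLp (K.indicator (f : Rn n →ₘ[volume] ℂ)) 2 volume := (memLp_congr_ae hae).mpr h2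
  have h4 : MemLp (K.indicator (f : Rn n →ₘ[volume] ℂ)) 1 volume :=
    h3.mono_exponent_of_measure_support_ne_top (s := K)
      (fun x hx => Set.indicator_of_notMem hx _) hK.measure_lt_top.ne (by norm_num)
  exact (memLp_one_iff_integrable.mp h4).congr hae

/-- The sum of the pieces of the operator, acting on the Fourier transform. -/
def sumOp (G : Set (Rn n)) (a : Rn n → Rn n → ℂ) (φ : Rn n → Rn n → ℝ) (v : Rn n → ℂ)
    (x : Rn n) : ℂ := ∑' j, dyadicOp G a φ j v x

section

variable {m ρ : ℝ} {a : Rn n → Rn n → ℂ} {φ : Rn n → Rn n → ℝ} {G : Set (Rn n)} {Ca Cφ : ℕ → ℝ}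
  {r : ℝ≥0}

/-- On each ball the `L²` norms are summable, hence so are the values almost everywhere; balls of
integer radius exhaust the space. -/
theorem ae_summable_dyadicOp (ha : ∀ x, ContDiff ℝ ∞ (a x))
    (hφ : ∀ x, ContDiffOn ℝ ∞ (φ x) {0}ᶜ) (hG : IsGoodSet G m ρ a φ Ca Cφ) (hr : r < 1)
    (hB : ∀ K : Set (Rn n), IsCompact K → ∃ C : ℝ≥0, ∀ j : ℕ, ∀ v : Rn n → ℂ,
      MemLp v 2 → eLpNorm (dyadicOp G a φ j v) 2 (volume.restrict K)
        ≤ C * r ^ j * eLpNorm v 2 volume) {v : Rn n → ℂ} (hv : MemLp v 2) :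
    ∀ᵐ x, Summable fun j => dyadicOp G a φ j v x := by
  rw [← Measure.restrict_univ (μ := volume), ← Metric.iUnion_closedBall_nat (0 : Rn n),
    ae_restrict_iUnion_iff]
  intro N
  obtain ⟨C, hC⟩ := hB _ (isCompact_closedBall (0 : Rn n) N)
  have h1 := summable_norm_of_tsum_eLpNorm_ne_top (p := 2)
    (μ := volume.restrict (Metric.closedBall (0 : Rn n) N)) (by norm_num)
    (f := fun j => dyadicOp G a φ j v)
    (fun j => (stronglyMeasurable_dyadicOp ha hφ hG j hv.1).aestronglyMeasurable)
    (by
      refine ne_top_of_le_ne_top ?_ (ENNReal.tsum_le_tsum fun j => hC j v hv)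
      rw [ENNReal.tsum_mul_right, ENNReal.tsum_mul_left, ENNReal.tsum_geometric]
      refine ENNReal.mul_ne_top (ENNReal.mul_ne_top ENNReal.coe_ne_top ?_) hv.2.ne
      rw [ENNReal.inv_ne_top]
      exact (tsub_pos_of_lt (by exact_mod_cast hr)).ne')
  filter_upwards [h1] with x hx
  exact hx.of_norm

theorem aestronglyMeasurable_sumOp (ha : ∀ x, ContDiff ℝ ∞ (a x))
    (hφ : ∀ x, ContDiffOn ℝ ∞ (φ x) {0}ᶜ) (hG : IsGoodSet G m ρ a φ Ca Cφ) {v : Rn n → ℂ}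
    (hv : AEStronglyMeasurable v)
    (hsum : ∀ᵐ x, Summable fun j => dyadicOp G a φ j v x) :
    AEStronglyMeasurable (sumOp G a φ v) := by
  refine aestronglyMeasurable_of_tendsto_ae atTop
    (f := fun J x => ∑ j ∈ Finset.range J, dyadicOp G a φ j v x) (fun J => ?_) ?_
  · exact (Finset.stronglyMeasurable_fun_sum _ fun j _ =>
      stronglyMeasurable_dyadicOp ha hφ hG j hv).aestronglyMeasurable
  · filter_upwards [hsum] with x hx
    exact hx.hasSum.tendsto_sum_nat

theorem eLpNorm_sumOp_le (ha : ∀ x, ContDiff ℝ ∞ (a x))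
    (hφ : ∀ x, ContDiffOn ℝ ∞ (φ x) {0}ᶜ) (hG : IsGoodSet G m ρ a φ Ca Cφ) {v : Rn n → ℂ}
    (hv : AEStronglyMeasurable v)
    (hsum : ∀ᵐ x, Summable fun j => dyadicOp G a φ j v x) {K : Set (Rn n)} {C : ℝ≥0}
    (hC : ∀ j : ℕ, eLpNorm (dyadicOp G a φ j v) 2 (volume.restrict K)
        ≤ C * r ^ j * eLpNorm v 2 volume) :
    eLpNorm (sumOp G a φ v) 2 (volume.restrict K)
      ≤ C * (1 - (r : ℝ≥0∞))⁻¹ * eLpNorm v 2 volume := by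
  have hms : ∀ j, AEStronglyMeasurable (dyadicOp G a φ j v) (volume.restrict K) := fun j =>
    (stronglyMeasurable_dyadicOp ha hφ hG j hv).aestronglyMeasurable
  -- Fatou's lemma passes the uniform bound on partial sums to the almost everywhere limit.
  refine Lp.eLpNorm_le_of_ae_tendsto (u := atTop)
    (f := fun J => ∑ j ∈ Finset.range J, dyadicOp G a φ j v)
    (Eventually.of_forall fun J => ?_) (fun J => ?_) ?_
  · calc eLpNorm (∑ j ∈ Finset.range J, dyadicOp G a φ j v) 2 (volume.restrict K)
        ≤ ∑ j ∈ Finset.range J, eLpNorm (dyadicOp G a φ j v) 2 (volume.restrict K) :=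
          eLpNorm_sum_le (fun j _ => hms j) (by norm_num)
      _ ≤ ∑ j ∈ Finset.range J, C * (r : ℝ≥0∞) ^ j * eLpNorm v 2 volume :=
          Finset.sum_le_sum fun j _ => hC j
      _ ≤ ∑' j, C * (r : ℝ≥0∞) ^ j * eLpNorm v 2 volume := ENNReal.sum_le_tsum _
      _ = _ := by rw [ENNReal.tsum_mul_right, ENNReal.tsum_mul_left, ENNReal.tsum_geometric]
  · exact Finset.aestronglyMeasurable_sum _ fun j _ => hms j
  · filter_upwards [ae_restrict_of_ae hsum] with x hx
    simpa only [Finset.sum_apply, sumOp] using hx.hasSum.tendsto_sum_nat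

theorem sumOp_add (ha : ∀ x, ContDiff ℝ ∞ (a x))
    (hφ : ∀ x, ContDiffOn ℝ ∞ (φ x) {0}ᶜ) (hG : IsGoodSet G m ρ a φ Ca Cφ) {v w : Rn n → ℂ}
    (hv : MemLp v 2) (hw : MemLp w 2) {x : Rn n} (hvs : Summable fun j => dyadicOp G a φ j v x)
    (hws : Summable fun j => dyadicOp G a φ j w x) :
    sumOp G a φ (v + w) x = sumOp G a φ v x + sumOp G a φ w x := by
  simp only [sumOp, dyadicOp_add ha hφ hG _ x hv hw]
  exact hvs.tsum_add hws

theorem sumOp_smul (c : ℂ) (v : Rn n → ℂ) (x : Rn n) :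
    sumOp G a φ (c • v) x = c * sumOp G a φ v x := by
  simp only [sumOp, dyadicOp_smul]
  exact tsum_mul_left

theorem sum_dyadicOp (ha : ∀ x, ContDiff ℝ ∞ (a x))
    (hφ : ∀ x, ContDiffOn ℝ ∞ (φ x) {0}ᶜ) (hG : IsGoodSet G m ρ a φ Ca Cφ) {v : Rn n → ℂ}
    (hv : MemLp v 2) (x : Rn n) (J : ℕ) :
    ∑ j ∈ Finset.range (J + 1), dyadicOp G a φ j v x
      = ∫ ξ, symbolKernel G a φ x ξ * (unitBump n (((2 : ℝ) ^ J)⁻¹ • ξ) : ℂ) * v ξ := by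
  simp only [dyadicOp]
  rw [← integral_finsetSum _ fun j _ => integrable_dyadicOp ha hφ hG j x hv]
  refine integral_congr_ae (Eventually.of_forall fun ξ => ?_)
  simp only
  rw [← Finset.sum_mul, ← Finset.mul_sum, ← sum_dyadicCutoff, Complex.ofReal_sum]

/-- The partial sums insert the cutoff `unitBump n (2^(-J) ξ)`, which tends to 1. Dominated
convergence applies because the symbol grows at most like ⟨ξ⟩^m while û decays rapidly. Positivity
of `n` makes the excluded frequency ξ = 0 a null set. -/
theorem sumOp_fourierHat_eq (hn : 0 < n) (ha : ∀ x, ContDiff ℝ ∞ (a x))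
    (hφ : ∀ x, ContDiffOn ℝ ∞ (φ x) {0}ᶜ) (hG : IsGoodSet G m ρ a φ Ca Cφ) {u : Rn n → ℂ}
    (hu : ContDiff ℝ ∞ u) (hc : HasCompactSupport u) {x : Rn n} (hx : x ∈ G)
    (hsum : Summable fun j => dyadicOp G a φ j (fourierHat u) x) :
    sumOp G a φ (fourierHat u) x
      = ∫ ξ, Complex.exp (Complex.I * (φ x ξ : ℂ)) * a x ξ * fourierHat u ξ := by
  have : Nonempty (Fin n) := ⟨⟨0, hn⟩⟩
  have hu1 : Integrable u := hu.continuous.integrable_of_hasCompactSupport hc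
  have hu2 : MemLp u 2 := hu.continuous.memLp_of_hasCompactSupport hc
  have hv := memLp_fourierHat hu1 hu2
  have h1 := (tendsto_add_atTop_iff_nat 1).mpr hsum.hasSum.tendsto_sum_nat
  simp_rw [sum_dyadicOp ha hφ hG hv x] at h1
  have h2 : ∫ ξ, Complex.exp (Complex.I * (φ x ξ : ℂ)) * a x ξ * fourierHat u ξ
      = ∫ ξ, symbolKernel G a φ x ξ * fourierHat u ξ := by
    refine integral_congr_ae ?_
    filter_upwards [(Set.countable_singleton (0 : Rn n)).ae_notMem volume] with ξ hξ
    rw [symbolKernel, Set.indicator_of_mem hx, Set.indicator_of_mem hξ]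
  rw [h2]
  refine tendsto_nhds_unique h1 ?_
  have hsm : StronglyMeasurable (symbolKernel G a φ x) :=
    (stronglyMeasurable_symbolKernel ha hφ hG).comp_measurable measurable_prodMk_left
  refine tendsto_integral_of_dominated_convergence
    (fun ξ => |Ca 0| * (bracket ξ ^ m * ‖fourierHat u ξ‖)) (fun J => ?_)
    ((integrable_bracket_rpow_mul_fourierHat hu hc m).const_mul _) (fun J => ?_) ?_
  · refine (hsm.aestronglyMeasurable.mul ?_).mul hv.1
    exact (Complex.continuous_ofReal.comp ((unitBump n).continuous.comp
      (continuous_const_smul _))).aestronglyMeasurable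
  · refine Eventually.of_forall fun ξ => ?_
    have hb := bracket_pos ξ
    rw [norm_mul, norm_mul, Complex.norm_real, Real.norm_of_nonneg (unitBump n).nonneg, ← mul_assoc]
    refine mul_le_mul_of_nonneg_right ?_ (norm_nonneg _)
    exact (mul_le_of_le_one_right (norm_nonneg _) (unitBump n).le_one).trans
      (norm_symbolKernel_le hG.bounds x ξ)
  · refine Eventually.of_forall fun ξ => ?_
    have h3 := (((Complex.continuous_ofReal.tendsto 1).comp (tendsto_unitBump_smul ξ)).const_mul
      (symbolKernel G a φ x ξ)).mul_const (fourierHat u ξ)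
    rwa [Complex.ofReal_one, mul_one] at h3

end

end Operator

/-! ### The bounded extension. -/

section Extension

variable {n : ℕ}

/-- The extension of the operator defined by the sum of its pieces. -/
theorem exists_extension {m ρ : ℝ} {a : Rn n → Rn n → ℂ} {φ : Rn n → Rn n → ℝ} {G : Set (Rn n)}
    {Ca Cφ : ℕ → ℝ} {r : ℝ≥0} (hn : 0 < n) (ha : ∀ x, ContDiff ℝ ∞ (a x))
    (hφ : ∀ x, ContDiffOn ℝ ∞ (φ x) {0}ᶜ) (hG : IsGoodSet G m ρ a φ Ca Cφ) (hr : r < 1)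
    (hB : ∀ K : Set (Rn n), IsCompact K → ∃ C : ℝ≥0, ∀ j : ℕ, ∀ v : Rn n → ℂ,
      MemLp v 2 → eLpNorm (dyadicOp G a φ j v) 2 (volume.restrict K)
        ≤ C * r ^ j * eLpNorm v 2 volume) :
    ∃ S : L2comp n →ₗ[ℂ] L2loc n, IsBoundedCompLoc S ∧ ExtendsOnTest S (fio a φ) := by
  set c : ℂ := ((((2 * Real.pi) ^ n)⁻¹ : ℝ) : ℂ) with hc
  set v : L2comp n → Rn n → ℂ := fun f => fourierHat (f : Rn n →ₘ[volume] ℂ) with hv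
  have hvL : ∀ f, MemLp (v f) 2 := fun f => memLp_fourierHat (integrable_of_mem_L2comp f) f.2.1
  have hsum : ∀ f, ∀ᵐ x, Summable fun j => dyadicOp G a φ j (v f) x := fun f =>
    ae_summable_dyadicOp ha hφ hG hr hB (hvL f)
  have hmeas : ∀ f, AEStronglyMeasurable (c • sumOp G a φ (v f)) := fun f =>
    (aestronglyMeasurable_sumOp ha hφ hG (hvL f).1 (hsum f)).const_smul c
  have hr' : (1 - (r : ℝ≥0∞))⁻¹ ≠ ⊤ := by
    rw [ENNReal.inv_ne_top]
    exact (tsub_pos_of_lt (by exact_mod_cast hr)).ne'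
  have hbound : ∀ K : Set (Rn n), IsCompact K → ∃ C : ℝ≥0, ∀ f : L2comp n,
      eLpNorm (c • sumOp G a φ (v f)) 2 (volume.restrict K)
        ≤ C * eLpNorm (f : Rn n →ₘ[volume] ℂ) 2 volume := by
    intro K hK
    obtain ⟨C, hC⟩ := hB K hK
    set M : ℝ≥0∞ := ‖c‖ₑ * (C * (1 - (r : ℝ≥0∞))⁻¹ * ENNReal.ofReal ((2 * Real.pi) ^ n)) with hM
    have hMt : M ≠ ⊤ := ENNReal.mul_ne_top enorm_ne_top
      (ENNReal.mul_ne_top (ENNReal.mul_ne_top ENNReal.coe_ne_top hr') ENNReal.ofReal_ne_top)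
    refine ⟨M.toNNReal, fun f => ?_⟩
    rw [ENNReal.coe_toNNReal hMt, eLpNorm_const_smul]
    calc ‖c‖ₑ * eLpNorm (sumOp G a φ (v f)) 2 (volume.restrict K)
        ≤ ‖c‖ₑ * (C * (1 - (r : ℝ≥0∞))⁻¹ * (ENNReal.ofReal ((2 * Real.pi) ^ n)
          * eLpNorm (f : Rn n →ₘ[volume] ℂ) 2 volume)) := by
          refine mul_le_mul' le_rfl ((eLpNorm_sumOp_le ha hφ hG (hvL f).1 (hsum f)
            fun j => hC j (v f) (hvL f)).trans (mul_le_mul' le_rfl ?_))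
          exact eLpNorm_fourierHat_le (integrable_of_mem_L2comp f) f.2.1
      _ = M * eLpNorm (f : Rn n →ₘ[volume] ℂ) 2 volume := by rw [hM]; ring
  have hmk : ∀ f, (AEEqFun.mk _ (hmeas f) : Rn n → ℂ) =ᵐ[volume] c • sumOp G a φ (v f) := fun f =>
    AEEqFun.coeFn_mk _ _
  have hloc : ∀ f, AEEqFun.mk _ (hmeas f) ∈ L2loc n := by
    intro f K hK
    obtain ⟨C, hC⟩ := hbound K hK
    refine (memLp_congr_ae (ae_restrict_of_ae (hmk f))).mpr ⟨(hmeas f).restrict, ?_⟩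
    exact (hC f).trans_lt (ENNReal.mul_lt_top ENNReal.coe_lt_top f.2.1.2)
  refine ⟨{ toFun := fun f => ⟨AEEqFun.mk _ (hmeas f), hloc f⟩, map_add' := ?_, map_smul' := ?_ },
    ?_, ?_⟩
  · intro f g
    have hadd : v (f + g) = v f + v g := by
      rw [hv]
      simp only
      rw [← fourierHat_add (integrable_of_mem_L2comp f) (integrable_of_mem_L2comp g)]
      exact fourierHat_congr_ae (AEEqFun.coeFn_add _ _)
    refine Subtype.ext ?_
    rw [Submodule.coe_add, AEEqFun.mk_add_mk, AEEqFun.mk_eq_mk]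
    -- Additivity of the series holds where both series converge, that is almost everywhere, which
    -- suffices for classes.
    filter_upwards [hsum f, hsum g] with x hf hg
    simp only [Pi.smul_apply, Pi.add_apply, smul_eq_mul, hadd,
      sumOp_add ha hφ hG (hvL f) (hvL g) hf hg, mul_add]
  · intro z f
    have hsmul : v (z • f) = z • v f := by
      rw [hv]
      simp only
      rw [← fourierHat_smul]
      exact fourierHat_congr_ae (AEEqFun.coeFn_smul _ _)
    refine Subtype.ext ?_
    rw [RingHom.id_apply, Submodule.coe_smul]
    refine AEEqFun.mk_eq_mk.mpr ?_
    refine Eventually.of_forall fun x => ?_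
    simp only [Function.comp_apply, Pi.smul_apply, smul_eq_mul, hsmul, sumOp_smul]
    ring
  · intro K K' _ hK'
    obtain ⟨C, hC⟩ := hbound K' hK'
    exact ⟨C, fun f _ => (eLpNorm_congr_ae (ae_restrict_of_ae (hmk f))).trans_le (hC f)⟩
  · intro u hu huc f hfu
    refine (hmk f).trans ?_
    filter_upwards [hsum f, hG.conull] with x hx hxG
    have hvu : v f = fourierHat u := fourierHat_congr_ae hfu
    rw [hvu] at hx
    rw [Pi.smul_apply, smul_eq_mul, hvu, sumOp_fourierHat_eq hn ha hφ hG hu huc hxG hx, fio]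

end Extension

end RoughFIO

end

theorem mainTheorem10 (n k : ℕ) (hk : k < n) (m ρ : ℝ) (hρ₀ : 0 ≤ ρ) (hρ₁ : ρ ≤ 1)
    (a : RoughFIO.Rn n → RoughFIO.Rn n → ℂ) (ha : RoughFIO.IsRoughAmplitude m ρ a)
    (φ : RoughFIO.Rn n → RoughFIO.Rn n → ℝ) (hφ : RoughFIO.IsRoughPhase 2 φ)
    (hcorank : RoughFIO.RoughCorank k a φ)
    (hm : m < -(((n : ℝ) + (k : ℝ) - 1) / 4) + ((n : ℝ) - (k : ℝ)) * (ρ - 1) / 2) :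
    ∃ S : RoughFIO.L2comp n →ₗ[ℂ] RoughFIO.L2loc n,
      RoughFIO.IsBoundedCompLoc S ∧ RoughFIO.ExtendsOnTest S (RoughFIO.fio a φ) := by
  obtain ⟨G, Ca, Cφ, hG⟩ := RoughFIO.exists_isGoodSet ha hφ
  obtain ⟨r, hr, hB⟩ := RoughFIO.exists_dyadicOp_bound hk hρ₀ hρ₁ ha.smooth hφ hG hcorank hm
  exact RoughFIO.exists_extension (by omega) ha.smooth hφ.smooth hG hr hB
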